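/- Let $\kappa\ge -1$ be an integer, $\varsigma\in\{-1,+1\}$, $\alpha\in\mathbb C$ with $\Re\alpha\ge 0$. Let $\Psi:[0,\infty)\to\mathbb C$ be smooth with $\Psi(0)=0$ and such that $t\mapsto\Psi(t^{-1/(\kappa+2)})$, $t>0$, extends smoothly to $t=0$. Let $\mathcal Q$ be the space of $Q\in C^\infty((0,\infty);\mathbb C)$ with $NQ=0$, where $$N=-\partial_\lambda^2+\varsigma\lambda^\kappa+\frac{\alpha^2-1/4}{\lambda^2}+\frac{\Psi(\lambda)}{\lambda^2}.$$ An index set is a set $\mathcal E\subseteq\mathbb C\times\mathbb N$ such that $\{(j,k)\in\mathcal E:\Re j<a\}$ is finite for each $a\in\mathbb R$, and which is closed under $(j,k)\mapsto(j+1,k)$ and under $(j,k+1)\mapsto(j,k)$. For $Z>0$ let $M$ be the manifold-with-corners compactifying $(0,Z)_\zeta\times(0,\infty)_h$ obtained from $[0,Z]_\zeta\times[0,\infty)_{h^2}$ by the quasihomogeneous blowup of the corner $\{\zeta=h=0\}$ that resolves $\zeta/h^{2/(\kappa+2)}$. Its faces are $\mathrm{ie}=\{\zeta=Z\}$, $\mathrm{ze}$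 (the lift of $h=0$), the front face $\mathrm{fe}$, and $\mathrm{be}$ (the lift of $\zeta=0$). A function on $(0,Z)\times(0,\infty)$ is polyhomogeneous on $M$ if it is smooth and if, for some index set at each face, it has near every boundary point of $M$ a full expansion in terms $\varrho^j(\log\varrho)^k$ ($\varrho$ a local defining function of the face, $(j,k)$ in its index set), jointly at the corners, with conormal remainders. 1. *(Small argument.)* Every $Q\in\mathcal Q$ is polyhomogeneous at $\lambda=0$ with index set $\mathcal F(\alpha)$, the smallest index set containing $(1/2-\alpha,0)$ and $(1/2+\alpha,\epsilon)$, where $\epsilon=1$ if $2\alpha\in\mathbb Z$ and $\epsilon=0$ otherwise. 2. *(Large argument.)* Put $\rho=\lambda^{-(\kappa+2)/2}$ and $\varphi=\frac{2}{\kappa+2}\lambda^{(\kappa+2)/2}=\frac{2}{\kappa+2}\rho^{-1}$. * If $\varsigma=+1$, then $Q\in e^{\varphi}\rho^{\kappa/(2\kappa+4)}C^\infty[0,\infty)_\rho$ for every $Q\in\mathcal Q$, and there is $Q_\infty\in\mathcal Q$ with $Q_\infty\in e^{-\varphi}\rho^{\kappa/(2\kappa+4)}C^\infty[0,\infty)_\rho$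 whose smooth factor is nonzero at $\rho=0$. If $Q\in\mathcal Q$ and $\rho^{-\kappa/(2\kappa+4)}e^{-\varphi}Q\to 0$ as $\lambda\to\infty$, then $Q\in\operatorname{span}_{\mathbb C}Q_\infty$. * If $\varsigma=-1$, then there are $Q_\pm\in\mathcal Q$ with $Q_\pm\in e^{\pm i\varphi}\rho^{\kappa/(2\kappa+4)}C^\infty[0,\infty)_\rho$, whose smooth factors are nonzero at $\rho=0$, such that $\mathcal Q=\operatorname{span}_{\mathbb C}\{Q_+,Q_-\}$. 3. *(On $M$.)* For every $Q\in\mathcal Q$ and $Z>0$, the function $Q(\zeta/h^{2/(\kappa+2)})$ is of nontrivial exponential-polyhomogeneous type on $M$: it equals $\sum_{n=1}^{N}u_ne^{\theta_n}$ on $(0,Z)\times(0,\infty)$ with $u_n,\theta_n$ polyhomogeneous on $M$, where (a) no exponential is superfluous: for no proper subset $S\subsetneq\{1,\dots,N\}$ is the function of the form $\sum_{n\in S}v_ne^{\theta_n}$ with polyhomogeneous $v_n$; and (b) for each $n$, the index set of $u_n$ at each face cannot be taken empty, and the joint expansion of $u_n$ at each corner of $M$ is not zero. One can take $N\le 1$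 if $\varsigma=+1$ and $N\le 2$ if $\varsigma=-1$. (For $Q=0$ one takes $N=0$.) -/

import Mathlib

open Set Filter Topology
open scoped ContDiff

noncomputable section

/-- An index set: a set of pairs (exponent, power of the logarithm) with finitely many members in
every left half plane, closed under raising the exponent by one and under lowering the power of
the logarithm. -/
structure IndexSet where
  carrier : Set (ℂ × ℕ)
  finite_lt : ∀ a : ℝ, {e : ℂ × ℕ | e ∈ carrier ∧ e.1.re < a}.Finite
  add_one : ∀ (j : ℂ) (k : ℕ), (j, k) ∈ carrier → (j + 1, k) ∈ carrier
  log_down : ∀ (j : ℂ) (k : ℕ), (j, k + 1) ∈ carrier → (j, k) ∈ carrier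

namespace IndexSet

theorem finite_le (E : IndexSet) (a : ℝ) : {e : ℂ × ℕ | e ∈ E.carrier ∧ e.1.re ≤ a}.Finite :=
  (E.finite_lt (a + 1)).subset fun _ he => ⟨he.1, lt_of_le_of_lt he.2 (lt_add_one a)⟩

/-- The finitely many members of an index set whose exponent has real part at most `a`. -/
def upTo (E : IndexSet) (a : ℝ) : Finset (ℂ × ℕ) := (E.finite_le a).toFinset

/-- The smallest index set containing `(j, k)`. -/
def gen (j : ℂ) (k : ℕ) : IndexSet where
  carrier := {e | (∃ n : ℕ, e.1 = j + n) ∧ e.2 ≤ k}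
  finite_lt := by
    intro a
    obtain ⟨m, hm⟩ := exists_nat_gt (a - j.re)
    refine (((Finset.range m) ×ˢ (Finset.range (k + 1))).image
      (fun p : ℕ × ℕ => ((j + p.1 : ℂ), p.2))).finite_toSet.subset ?_
    rintro ⟨e, l⟩ ⟨⟨⟨n, hn⟩, hl⟩, hlt⟩
    simp only at hn hl hlt
    subst hn
    have hre : j.re + (n : ℝ) < a := by simpa using hlt
    have hnm : n < m := by
      have h : (n : ℝ) < m := by linarith
      exact_mod_cast h
    simp only [Finset.coe_image, Finset.coe_product, Finset.coe_range, Set.mem_image,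
      Set.mem_prod, Set.mem_Iio, Prod.exists]
    exact ⟨n, l, ⟨hnm, Nat.lt_succ_of_le hl⟩, rfl⟩
  add_one := by
    rintro j' l ⟨⟨n, hn⟩, hl⟩
    simp only at hn hl
    exact ⟨⟨n + 1, by simp only [hn]; push_cast; ring⟩, hl⟩
  log_down := by
    rintro j' l ⟨⟨n, hn⟩, hl⟩
    simp only at hn hl
    exact ⟨⟨n, hn⟩, by simp only; omega⟩

/-- The union of two index sets. -/
def union (E F : IndexSet) : IndexSet where
  carrier := E.carrier ∪ F.carrier
  finite_lt := by
    intro a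
    refine ((E.finite_lt a).union (F.finite_lt a)).subset ?_
    rintro e ⟨he | he, hlt⟩
    · exact Or.inl ⟨he, hlt⟩
    · exact Or.inr ⟨he, hlt⟩
  add_one := by
    rintro j k (h | h)
    · exact Or.inl (E.add_one j k h)
    · exact Or.inr (F.add_one j k h)
  log_down := by
    rintro j k (h | h)
    · exact Or.inl (E.log_down j k h)
    · exact Or.inr (F.log_down j k h)

end IndexSet

open Classical in
/-- The index set generated by the roots `1/2 - α` and `1/2 + α`, with one logarithm at
`1/2 + α` exactly when `2α` is an integer. -/
def rootIndexSet (α : ℂ) : IndexSet :=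
  (IndexSet.gen (1 / 2 - α) 0).union
    (IndexSet.gen (1 / 2 + α) (if ∃ m : ℤ, 2 * α = m then 1 else 0))

/-- The function `x ^ j * (log x) ^ k` of `x > 0`, where `e = (j, k)`. -/
def logMonomial (e : ℂ × ℕ) (x : ℝ) : ℂ := (x : ℂ) ^ e.1 * (Real.log x : ℂ) ^ e.2

/-- The operator `x ∂ₓ` on functions of one variable. -/
def bDeriv (g : ℝ → ℂ) : ℝ → ℂ := fun x => (x : ℂ) * deriv g x

/-- The operator `x ∂ₓ` in the first variable. -/
def bDerivFst (g : ℝ → ℝ → ℂ) : ℝ → ℝ → ℂ := fun x y => (x : ℂ) * deriv (fun t => g t y) x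

/-- The operator `y ∂_y` in the second variable. -/
def bDerivSnd (g : ℝ → ℝ → ℂ) : ℝ → ℝ → ℂ := fun x y => (y : ℂ) * deriv (g x) y

/-- The operator `∂_y` in the second variable. -/
def derivSnd (g : ℝ → ℝ → ℂ) : ℝ → ℝ → ℂ := fun x y => deriv (g x) y

/-- On `(0, ε)` the function `g` is smooth and polyhomogeneous at `0`, with index set `E` and
expansion `∑ c (j, k) x ^ j (log x) ^ k`: subtracting the terms with `Re j ≤ a` leaves a conormal
function of order `a`. -/
def HasExpansion (E : IndexSet) (c : ℂ × ℕ → ℂ) (ε : ℝ) (g : ℝ → ℂ) : Prop :=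
  ContDiffOn ℝ ∞ g (Ioo 0 ε) ∧
  ∀ (a : ℝ) (m : ℕ), ∃ C : ℝ, ∀ x ∈ Ioo 0 ε,
    ‖(bDeriv^[m] fun t => g t - ∑ e ∈ E.upTo a, c e * logMonomial e t) x‖ ≤ C * x ^ a

/-- `g` is polyhomogeneous at `0` (from the right) with index set `E`. -/
def IsPolyhomogeneousAtZero (E : IndexSet) (g : ℝ → ℂ) : Prop :=
  ∃ ε > 0, ∃ c, HasExpansion E c ε g

/-- Polyhomogeneity near the point `(0, y₀)` of the half plane `[0, ∞) × ℝ`: an expansion in `x`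
with index set `E` and values in the smooth functions of `y`. -/
def IsPolyhomogeneousAtFace (E : IndexSet) (y₀ : ℝ) (g : ℝ → ℝ → ℂ) : Prop :=
  ∃ ε > 0, ∃ a : ℂ × ℕ → ℝ → ℂ,
    ContDiffOn ℝ ∞ (Function.uncurry g) (Ioo 0 ε ×ˢ Ioo (y₀ - ε) (y₀ + ε)) ∧
    (∀ e ∈ E.carrier, ContDiffOn ℝ ∞ (a e) (Ioo (y₀ - ε) (y₀ + ε))) ∧
    ∀ (r : ℝ) (m n : ℕ), ∃ C : ℝ, ∀ x ∈ Ioo 0 ε, ∀ y ∈ Ioo (y₀ - ε) (y₀ + ε),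
      ‖(bDerivFst^[m] (derivSnd^[n] fun s t =>
        g s t - ∑ e ∈ E.upTo r, a e t * logMonomial e s)) x y‖ ≤ C * x ^ r

/-- Polyhomogeneity near the corner of the quadrant `[0, ∞) × [0, ∞)`, with index set `E` at
`x = 0` and `F` at `y = 0`, and joint coefficients `c`. This is an expansion in `x` with index set
`E` whose values are polyhomogeneous functions of `y` with index set `F`, written out: the
coefficients `a e` at `x = 0` are polyhomogeneous in `y`, the coefficients `b f` at `y = 0` are
polyhomogeneous in `x`, both have the same joint coefficients, and what is left after subtracting
the expansions up to orders `r` and `s` is conormal of order `(r, s)`. -/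
def HasCornerExpansion (E F : IndexSet) (c : ℂ × ℕ → ℂ × ℕ → ℂ) (g : ℝ → ℝ → ℂ) : Prop :=
  ∃ ε > 0, ∃ a b : ℂ × ℕ → ℝ → ℂ,
    ContDiffOn ℝ ∞ (Function.uncurry g) (Ioo 0 ε ×ˢ Ioo 0 ε) ∧
    (∀ e ∈ E.carrier, HasExpansion F (c e) ε (a e)) ∧
    (∀ f ∈ F.carrier, HasExpansion E (fun e => c e f) ε (b f)) ∧
    ∀ (r s : ℝ) (m n : ℕ), ∃ C : ℝ, ∀ x ∈ Ioo 0 ε, ∀ y ∈ Ioo 0 ε,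
      ‖(bDerivFst^[m] (bDerivSnd^[n] fun t u =>
        g t u - ∑ e ∈ E.upTo r, a e u * logMonomial e t
          - ∑ f ∈ F.upTo s, b f t * logMonomial f u
          + ∑ e ∈ E.upTo r, ∑ f ∈ F.upTo s, c e f * logMonomial e t * logMonomial f u)) x y‖
        ≤ C * x ^ r * y ^ s

/-- The boundary hypersurfaces of the blowup `M` of the corner `z = h = 0` of
`[0, Z] × [0, ∞)` that resolves `z / h ^ (2 / (κ + 2))`: `ie` is `z = Z`, `ze` is the lift of
`h = 0`, `fe` is the front face, and `be` is the lift of `z = 0`. -/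
inductive Face
  | ie | ze | fe | be

/-- The corners of `M`. -/
inductive Corner
  | zeIe | zeFe | feBe

/-- The face on which the first coordinate of the chart at a corner vanishes. -/
def Corner.fst : Corner → Face
  | .zeIe => .ze
  | .zeFe => .ze
  | .feBe => .fe

/-- The face on which the second coordinate of the chart at a corner vanishes. -/
def Corner.snd : Corner → Face
  | .zeIe => .ie
  | .zeFe => .fe
  | .feBe => .be

/-- The value of `h` for which `h ^ 2 / z ^ (κ + 2) = s`. -/
def semiclassical (κ : ℤ) (s z : ℝ) : ℝ := √s * z ^ (((κ : ℝ) + 2) / 2)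

/-- A function `f z h` on the interior of `M`, written in coordinates `(x, y)` near the interior
of a face, where `x` defines the face: `(Z - z, h)` at `ie`, `(h ^ 2 / z ^ (κ + 2), z)` at `ze`,
`(z, h ^ 2 / z ^ (κ + 2))` at `fe`, and `(z, h)` at `be`. -/
def faceChart (κ : ℤ) (Z : ℝ) (f : ℝ → ℝ → ℂ) : Face → ℝ → ℝ → ℂ
  | .ie => fun x h => f (Z - x) h
  | .ze => fun s z => f z (semiclassical κ s z)
  | .fe => fun z s => f z (semiclassical κ s z)
  | .be => fun z h => f z h

/-- The values of the second coordinate of `faceChart` on the interior of a face. -/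
def faceInterior (Z : ℝ) : Face → Set ℝ
  | .ie => Ioi 0
  | .ze => Ioo 0 Z
  | .fe => Ioi 0
  | .be => Ioi 0

/-- A function `f z h` on the interior of `M`, written in coordinates near a corner:
`(h ^ 2 / z ^ (κ + 2), Z - z)` at the corner of `ze` and `ie`, `(h ^ 2 / z ^ (κ + 2), z)` at that
of `ze` and `fe`, and `(h ^ (2 / (κ + 2)), z / h ^ (2 / (κ + 2)))` at that of `fe` and `be`. -/
def cornerChart (κ : ℤ) (Z : ℝ) (f : ℝ → ℝ → ℂ) : Corner → ℝ → ℝ → ℂ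
  | .zeIe => fun s y => f (Z - y) (semiclassical κ s (Z - y))
  | .zeFe => fun s z => f z (semiclassical κ s z)
  | .feBe => fun w l => f (l * w) (w ^ (((κ : ℝ) + 2) / 2))

/-- `f` (a function of `z ∈ (0, Z)` and `h > 0`) is polyhomogeneous on `M`, with index set `E i` at
the face `i`. -/
def IsPolyhomogeneousOn (κ : ℤ) (Z : ℝ) (E : Face → IndexSet) (f : ℝ → ℝ → ℂ) : Prop :=
  ContDiffOn ℝ ∞ (Function.uncurry f) (Ioo 0 Z ×ˢ Ioi 0) ∧
  (∀ i : Face, ∀ y₀ ∈ faceInterior Z i, IsPolyhomogeneousAtFace (E i) y₀ (faceChart κ Z f i)) ∧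
  ∀ v : Corner, ∃ c, HasCornerExpansion (E v.fst) (E v.snd) c (cornerChart κ Z f v)

/-- `f` is polyhomogeneous on `M`, its index set at each face cannot be taken empty, and its joint
expansion at each corner is not zero. -/
def IsNontrivialPolyhomogeneousOn (κ : ℤ) (Z : ℝ) (f : ℝ → ℝ → ℂ) : Prop :=
  (∃ E, IsPolyhomogeneousOn κ Z E f) ∧
  (∀ (i : Face) (E : Face → IndexSet),
    IsPolyhomogeneousOn κ Z E f → (E i).carrier.Nonempty) ∧
  ∀ v : Corner, ∃ E F c, HasCornerExpansion E F c (cornerChart κ Z f v) ∧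
    ∃ e ∈ E.carrier, ∃ e' ∈ F.carrier, c e e' ≠ 0

/-- `f = ∑ u n * exp (θ n)` on the interior of `M`, the sum being over `n ∈ S`, with polyhomogeneous
amplitudes `u n`. -/
def IsPresentation {ι : Type} (κ : ℤ) (Z : ℝ) (f : ℝ → ℝ → ℂ) (S : Finset ι)
    (u θ : ι → ℝ → ℝ → ℂ) : Prop :=
  (∀ n ∈ S, ∃ E, IsPolyhomogeneousOn κ Z E (u n)) ∧
  ∀ z ∈ Ioo 0 Z, ∀ h ∈ Ioi (0 : ℝ), f z h = ∑ n ∈ S, u n z h * Complex.exp (θ n z h)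

/-- `f` is of nontrivial exponential-polyhomogeneous type on `M`, with `N` exponentials: it has a
presentation `f = ∑ u n * exp (θ n)` with `N` terms and polyhomogeneous `u n`, `θ n`, the number of
exponentials is minimal (none of the `exp (θ n)` can be dispensed with, even if all amplitudes are
changed), and all `u n` have nonempty index sets at every face and corner. -/
def IsNontrivialExpPolyhomogeneousOn (κ : ℤ) (Z : ℝ) (N : ℕ) (f : ℝ → ℝ → ℂ) : Prop :=
  ∃ u θ : Fin N → ℝ → ℝ → ℂ,
    (∀ n, ∃ E, IsPolyhomogeneousOn κ Z E (θ n)) ∧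
    IsPresentation κ Z f Finset.univ u θ ∧
    (∀ S : Finset (Fin N), S ≠ Finset.univ → ¬ ∃ v, IsPresentation κ Z f S v θ) ∧
    ∀ n, IsNontrivialPolyhomogeneousOn κ Z (u n)

/-- `Ψ` is smooth on the closed front face `[0, ∞]` (smooth in `λ` down to `λ = 0`, and in
`1 / λ ^ (κ + 2)` down to `λ = ∞`), and vanishes at `λ = 0`. -/
def IsAdmissible (κ : ℤ) (Ψ : ℝ → ℂ) : Prop :=
  ContDiffOn ℝ ∞ Ψ (Ici 0) ∧ Ψ 0 = 0 ∧
  ∃ Φ : ℝ → ℂ, ContDiffOn ℝ ∞ Φ (Ici 0) ∧ ∀ t > 0, Φ t = Ψ (t ^ (-(1 / ((κ : ℝ) + 2))))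

/-- The smooth solutions on `(0, ∞)` of `N Q = 0`, for
`N = -∂² + ς λ ^ κ + (α ^ 2 - 1 / 4) / λ ^ 2 + Ψ λ / λ ^ 2`. Values at `λ ≤ 0` are irrelevant. -/
def modelKernel (ς : ℝ) (κ : ℤ) (α : ℂ) (Ψ : ℝ → ℂ) : Set (ℝ → ℂ) :=
  {Q | ContDiffOn ℝ ∞ Q (Ioi 0) ∧ ∀ l > (0 : ℝ),
    -deriv (deriv Q) l + (ς : ℂ) * (l : ℂ) ^ κ * Q l
      + (α ^ 2 - 1 / 4) / (l : ℂ) ^ 2 * Q l + Ψ l / (l : ℂ) ^ 2 * Q l = 0}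

/-- The phase `2 λ ^ ((κ + 2) / 2) / (κ + 2)`. -/
def modelPhase (κ : ℤ) (l : ℝ) : ℝ := 2 * l ^ (((κ : ℝ) + 2) / 2) / ((κ : ℝ) + 2)

/-- With `ρ = 1 / λ ^ ((κ + 2) / 2)`: `Q = exp (σ * phase) * ρ ^ (κ / (2 κ + 4)) * q ρ` on `(0, ∞)`,
where `q` is smooth on `[0, ∞)`. -/
def IsExpAtInfinity (κ : ℤ) (σ : ℂ) (q : ℝ → ℂ) (Q : ℝ → ℂ) : Prop :=
  ContDiffOn ℝ ∞ q (Ici 0) ∧ ∀ l > (0 : ℝ),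
    Q l = Complex.exp (σ * modelPhase κ l)
      * (((l ^ (-(((κ : ℝ) + 2) / 2))) ^ ((κ : ℝ) / (2 * κ + 4)) : ℝ) : ℂ)
      * q (l ^ (-(((κ : ℝ) + 2) / 2)))

end

/-!
The equation `N Q = 0` has two singular points. At `0` it is of Fuchs type with roots `1/2 ± α`.
At infinity it is irregular, and the WKB exponentials are the exact exponential factors of the
solutions. Each half of the theorem is a regularity statement for a solution in a suitable form.

*At zero.* A solution is written as `Q = l ^ (1/2 + α) v`; the equation becomes
`l v'' + (1 + 2 α) v' = B v` with `B` smooth up to `0`. As `Re α ≥ 0`, this is a Volterra equation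
with bounded kernel, and it has a solution with `v 0 = 1` that is smooth up to `0`
(`exists_regular_solution`, `exists_local_solution`). All other solutions follow by reduction of
order: the Wronskian is constant, so that the quotient of two solutions is a primitive of
`l ^ (-1 - 2 α)` times a smooth function, and such primitives contain a logarithm only if `2 α` is
an integer (`exists_primitive_cpow_mul`, `exists_local_terms`). It follows too that only the zero
solution vanishes to infinite order at `0` (`eq_zero_of_isBigO_pow`).

*At infinity.* With `σ ^ 2 = ς`, the substitution
`Q l = exp (σ φ) l ^ (-κ / 4) q (l ^ (-(κ + 2) / 2))` turns the equation into
`ρ ^ 2 q'' + (2 ρ - 2 τ) q' = Γ q` with `τ = 2 σ / (κ + 2)` and `Γ` smooth up to `ρ = 0`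
(`hasDerivAt_wkbDeriv`). Its derivatives are equations of the same shape, of first order for the
next derivative of `q`; bounds for their solutions give smoothness at `ρ = 0` by induction on the
number of derivatives. If `Re τ ≤ 0`, the equation is of Volterra type, because the factor
`exp (2 τ / y - 2 τ / ρ)` is bounded for `y ≤ ρ`; it has a solution with `q 0 = 1`, and this
solution is smooth (`exists_irregular_solution`). If `τ > 0`, the homogeneous first order equation
is damped on the way to `ρ = 0`, and every solution is smooth (`exists_smooth_of_pos`). The
Wronskian of two solutions with opposite exponentials is `-2 σ` times the product of their
amplitudes at infinity (`wronskian_eq`); this decides linear dependence, and proves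
`forbidden_case` and `allowed_case`.

*On the blowup.* All functions that occur depend on `l = z / h ^ (2 / (κ + 2))` only. Their
expansions at `l = 0` and at `l = ∞` give the expansions at `be` and at `ze` and, as the functions
depend on one coordinate only in suitable charts, at the corners; at the interior points of `ie`
and `fe` the variable `l` stays in `(0, ∞)`, and Taylor expansion is enough
(`isPolyhomogeneousOn_frontFace`, `hasCornerExpansion_frontFace`). The phase `σ φ` is cut off near
`l = 0`, where it is not needed, and the amplitude is `Q` divided by the exponential of the cut off
phase (`cutPhase`, `cutAmplitude`). The amplitude has a nonzero leading coefficient at `l = ∞`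
because `q 0 ≠ 0`, and it does not vanish to infinite order at `l = 0`; hence it is nontrivial at
each face and corner (`isNontrivialPolyhomogeneousOn_cutAmplitude`).

If `ς = 1`, one exponential is enough: either the growing amplitude is nonzero at infinity, or the
solution is a multiple of the decaying one. If `ς = -1` and both exponentials occur, neither can
be dropped: otherwise `s ^ j P (s ^ (1/2)) exp (τ s ^ (-1/2))`, with `τ ≠ 0` imaginary and
`P 0 ≠ 0`, would satisfy one power bound together with all its derivatives under `s ∂ₛ`, whereas
each `s ∂ₛ` loses half an order (`not_single_exponential`).
-/

/-! ### Smoothness up to the end point of a half line -/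

theorem exists_tendsto_zero_of_deriv_isBigO {f : ℝ → ℂ} (hf : DifferentiableOn ℝ f (Ioi 0))
    (hb : deriv f =O[𝓝[>] 0] (fun _ => (1 : ℝ))) : ∃ c, Tendsto f (𝓝[>] 0) (𝓝 c) := by
  obtain ⟨C, hC⟩ := hb.bound
  obtain ⟨ε, hε, h⟩ := mem_nhdsGT_iff_exists_Ioo_subset.1 hC
  have hε' : (0 : ℝ) < ε := hε
  have hL : LipschitzOnWith (Real.toNNReal C) f (Ioo 0 ε) := by
    refine Convex.lipschitzOnWith_of_nnnorm_deriv_le (𝕜 := ℝ) (fun x hx => ?_) (fun x hx => ?_)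
      (convex_Ioo 0 ε)
    · exact (hf x hx.1).differentiableAt (Ioi_mem_nhds hx.1)
    · have := h hx
      simp only [mem_ofPred_eq, norm_one, mul_one] at this
      exact NNReal.coe_le_coe.1 (by simpa using Or.inl this)
  obtain ⟨g, hg, hgf⟩ := hL.extend_finite_dimension
  refine ⟨g 0, ?_⟩
  have : Tendsto g (𝓝[>] 0) (𝓝 (g 0)) := hg.continuous.continuousAt.mono_left inf_le_left
  refine this.congr' ?_
  filter_upwards [Ioo_mem_nhdsGT hε'] with x hx using (hgf hx).symm

/-- A function that is smooth on `(0, ∞)` with all derivatives bounded near `0` is smooth on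
`[0, ∞)` once it is given its limit as value at `0`. -/
theorem contDiffOn_update_of_isBigO (n : ℕ) : ∀ {f : ℝ → ℂ}, ContDiffOn ℝ ∞ f (Ioi 0) →
    (∀ k, iteratedDeriv k f =O[𝓝[>] 0] (fun _ => (1 : ℝ))) → ∀ {c : ℂ},
    Tendsto f (𝓝[>] 0) (𝓝 c) → ContDiffOn ℝ n (Function.update f 0 c) (Ici 0) := by
  induction n with
  | zero =>
    intro f hf _ c hc
    rw [Nat.cast_zero, contDiffOn_zero]
    intro x hx
    rcases eq_or_lt_of_le (show (0 : ℝ) ≤ x from hx) with rfl | h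
    · rw [continuousWithinAt_update_same]
      simpa using hc
    · refine ContinuousAt.continuousWithinAt ?_
      rw [continuousAt_update_of_ne h.ne']
      exact (hf.continuousOn x h).continuousAt (Ioi_mem_nhds h)
  | succ n ih =>
    intro f hf hb c hc
    have hd : ContDiffOn ℝ ∞ (deriv f) (Ioi 0) :=
      ((contDiffOn_infty_iff_deriv_of_isOpen isOpen_Ioi).1 hf).2
    have hdiff : DifferentiableOn ℝ f (Ioi 0) := hf.differentiableOn (by simp)
    have hbd : ∀ k, iteratedDeriv k (deriv f) =O[𝓝[>] 0] (fun _ => (1 : ℝ)) := fun k => by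
      have := hb (k + 1)
      rwa [iteratedDeriv_succ'] at this
    obtain ⟨c', hc'⟩ := exists_tendsto_zero_of_deriv_isBigO (hd.differentiableOn (by simp))
      (by simpa [iteratedDeriv_one] using hbd 1)
    have hpos : ∀ x > (0 : ℝ), HasDerivAt (Function.update f 0 c) (deriv f x) x := by
      intro x hx
      refine ((hdiff x hx).differentiableAt (Ioi_mem_nhds hx)).hasDerivAt.congr_of_eventuallyEq ?_
      filter_upwards [Ioi_mem_nhds hx] with y hy
      exact Function.update_of_ne (ne_of_gt hy) _ _
    have h0 : HasDerivWithinAt (Function.update f 0 c) c' (Ici 0) 0 := by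
      refine hasDerivWithinAt_Ici_of_tendsto_deriv (s := Ioi 0)
        (fun x hx => (hpos x hx).differentiableAt.differentiableWithinAt) ?_ self_mem_nhdsWithin ?_
      · rw [continuousWithinAt_update_same]
        simpa using hc
      · refine hc'.congr' ?_
        filter_upwards [self_mem_nhdsWithin] with x hx using (hpos x hx).deriv.symm
    have hall : ∀ x ∈ Ici (0 : ℝ), HasDerivWithinAt (Function.update f 0 c)
        (Function.update (deriv f) 0 c' x) (Ici 0) x := by
      intro x hx
      rcases eq_or_lt_of_le (show (0 : ℝ) ≤ x from hx) with rfl | h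
      · simpa using h0
      · rw [Function.update_of_ne h.ne']
        exact (hpos x h).hasDerivWithinAt
    rw [Nat.cast_succ, contDiffOn_succ_iff_derivWithin (uniqueDiffOn_Ici 0)]
    refine ⟨fun x hx => (hall x hx).differentiableWithinAt, by simp, ?_⟩
    exact (ih hd hbd hc').congr fun x hx => (hall x hx).derivWithin (uniqueDiffOn_Ici 0 x hx)

/-- A function that is smooth on `(0, ∞)` with all derivatives bounded near `0` extends smoothly to
`[0, ∞)`. -/
theorem exists_contDiffOn_Ici {f : ℝ → ℂ} (hf : ContDiffOn ℝ ∞ f (Ioi 0))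
    (hb : ∀ k, iteratedDeriv k f =O[𝓝[>] 0] (fun _ => (1 : ℝ))) :
    ∃ F : ℝ → ℂ, ContDiffOn ℝ ∞ F (Ici 0) ∧ ∀ x > 0, F x = f x := by
  obtain ⟨c, hc⟩ := exists_tendsto_zero_of_deriv_isBigO (hf.differentiableOn (by simp))
      (by simpa [iteratedDeriv_one] using hb 1)
  exact ⟨Function.update f 0 c, contDiffOn_infty.2 fun n => contDiffOn_update_of_isBigO n hf hb hc,
    fun x hx => Function.update_of_ne (ne_of_gt hx) _ _⟩

theorem iteratedDeriv_isBigO_one_of_contDiffOn_Ici {f : ℝ → ℂ} (hf : ContDiffOn ℝ ∞ f (Ici 0))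
    (k : ℕ) : iteratedDeriv k f =O[𝓝[>] 0] (fun _ => (1 : ℝ)) := by
  have hc : ContinuousOn (iteratedDerivWithin k f (Ici 0)) (Ici 0) :=
    hf.continuousOn_iteratedDerivWithin (by exact_mod_cast le_top) (uniqueDiffOn_Ici 0)
  have h0 : Tendsto (iteratedDerivWithin k f (Ici 0)) (𝓝[>] 0)
      (𝓝 (iteratedDerivWithin k f (Ici 0) 0)) :=
    (hc 0 self_mem_Ici).mono_left (nhdsWithin_mono _ Ioi_subset_Ici_self)
  refine (h0.isBigO_one ℝ).congr' ?_ EventuallyEq.rfl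
  filter_upwards [self_mem_nhdsWithin] with x hx
  have hx : (0 : ℝ) < x := hx
  rw [iteratedDerivWithin, iteratedDeriv,
    iteratedFDerivWithin_eq_iteratedFDeriv (uniqueDiffOn_Ici 0)
      ((hf.contDiffAt (Ici_mem_nhds hx)).of_le (by exact_mod_cast le_top)) hx.le]

theorem iteratedDeriv_isBigO_congr {f g : ℝ → ℂ} (h : ∀ x > 0, f x = g x) (k : ℕ)
    (hf : iteratedDeriv k f =O[𝓝[>] 0] (fun _ => (1 : ℝ))) :
    iteratedDeriv k g =O[𝓝[>] 0] (fun _ => (1 : ℝ)) := by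
  refine hf.congr' ?_ EventuallyEq.rfl
  filter_upwards [self_mem_nhdsWithin] with x hx
  refine Filter.EventuallyEq.iteratedDeriv_eq k ?_
  filter_upwards [Ioi_mem_nhds hx] with y hy using h y hy

/-- Weighted Leibniz estimate at the end point `0`. -/
theorem iteratedDeriv_mul_isBigO {f g : ℝ → ℂ} (hf : ContDiffOn ℝ ∞ f (Ici 0))
    (hg : ContDiffOn ℝ ∞ g (Ioi 0)) {w : ℝ → ℝ} {k : ℕ}
    (h : ∀ i ≤ k, (fun x => (w x : ℂ) * iteratedDeriv i g x) =O[𝓝[>] 0] (fun _ => (1 : ℝ))) :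
    (fun x => (w x : ℂ) * iteratedDeriv k (fun x => f x * g x) x)
      =O[𝓝[>] 0] (fun _ => (1 : ℝ)) := by
  have h1 : (fun x => ∑ i ∈ Finset.range (k + 1), (k.choose i : ℂ) * iteratedDeriv i f x *
      ((w x : ℂ) * iteratedDeriv (k - i) g x)) =O[𝓝[>] 0] (fun _ => (1 : ℝ)) := by
    refine Asymptotics.IsBigO.fun_sum (s := Finset.range (k + 1)) fun i hi => ?_
    have := ((iteratedDeriv_isBigO_one_of_contDiffOn_Ici hf i).const_mul_left
      (k.choose i : ℂ)).mul (h (k - i) (Nat.sub_le _ _))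
    simpa using this
  refine h1.congr' ?_ EventuallyEq.rfl
  filter_upwards [self_mem_nhdsWithin] with x hx
  have hx : (0 : ℝ) < x := hx
  have e := iteratedDeriv_mul (n := k) (x := x) (f := f) (g := g)
    ((hf.contDiffAt (Ici_mem_nhds hx)).of_le (by exact_mod_cast le_top))
    ((hg.contDiffAt (Ioi_mem_nhds hx)).of_le (by exact_mod_cast le_top))
  have e2 : iteratedDeriv k (fun x => f x * g x) x = iteratedDeriv k (f * g) x := rfl
  rw [e2, e, Finset.mul_sum]
  exact Finset.sum_congr rfl fun i _ => by ring

/-! ### First order singular equations -/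

theorem norm_sub_le_sub_of_norm_deriv_le {f f' : ℝ → ℂ} {B B' : ℝ → ℝ} {a b : ℝ} (hab : a ≤ b)
    (hf : ∀ y ∈ Icc a b, HasDerivAt f (f' y) y) (hB : ∀ y ∈ Icc a b, HasDerivAt B (B' y) y)
    (h : ∀ y ∈ Icc a b, ‖f' y‖ ≤ B' y) : ‖f b - f a‖ ≤ B b - B a := by
  refine image_norm_le_of_norm_deriv_right_le_deriv_boundary' (f := fun y => f y - f a)
    (f' := f') (B := fun y => B y - B a) (B' := B') (a := a) (b := b)
    (fun y hy => ((hf y hy).sub_const _).continuousAt.continuousWithinAt)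
    (fun y hy => ((hf y (Ico_subset_Icc_self hy)).sub_const _).hasDerivWithinAt) (by simp)
    (fun y hy => ((hB y hy).sub_const _).continuousAt.continuousWithinAt)
    (fun y hy => ((hB y (Ico_subset_Icc_self hy)).sub_const _).hasDerivWithinAt)
    (fun y hy => h y (Ico_subset_Icc_self hy)) (right_mem_Icc.2 hab)

/-- Comparison from the end point `0`, at which the differential inequality need not make sense. -/
theorem norm_le_of_norm_deriv_le_of_tendsto_zero {f f' : ℝ → ℂ} {B B' : ℝ → ℝ} {x : ℝ}
    (hx : 0 < x) (hf : ∀ y ∈ Ioc 0 x, HasDerivAt f (f' y) y)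
    (hB : ∀ y ∈ Ioc 0 x, HasDerivAt B (B' y) y) (hB0 : ∀ y ∈ Ioc 0 x, 0 ≤ B y)
    (h : ∀ y ∈ Ioc 0 x, ‖f' y‖ ≤ B' y) (h0 : Tendsto f (𝓝[>] 0) (𝓝 0)) : ‖f x‖ ≤ B x := by
  have h1 : Tendsto (fun y => ‖f x - f y‖) (𝓝[>] 0) (𝓝 ‖f x‖) := by
    simpa using (tendsto_const_nhds.sub h0).norm
  refine le_of_tendsto h1 ?_
  filter_upwards [Ioo_mem_nhdsGT hx] with y hy
  have hs : ∀ z ∈ Icc y x, z ∈ Ioc 0 x := fun z hz => ⟨hy.1.trans_le hz.1, hz.2⟩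
  have := norm_sub_le_sub_of_norm_deriv_le hy.2.le (fun z hz => hf z (hs z hz))
    (fun z hz => hB z (hs z hz)) (fun z hz => h z (hs z hz))
  linarith [hB0 y ⟨hy.1, hy.2.le⟩]

theorem contDiffOn_iteratedDeriv_Ioi {f : ℝ → ℂ} (hf : ContDiffOn ℝ ∞ f (Ioi 0)) (k : ℕ) :
    ContDiffOn ℝ ∞ (iteratedDeriv k f) (Ioi 0) := by
  induction k with
  | zero => simpa using hf
  | succ k ih =>
    rw [iteratedDeriv_succ]
    exact ((contDiffOn_infty_iff_deriv_of_isOpen isOpen_Ioi).1 ih).2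

theorem hasDerivAt_of_contDiffOn_Ioi {f : ℝ → ℂ} (hf : ContDiffOn ℝ ∞ f (Ioi 0)) {x : ℝ}
    (hx : 0 < x) : HasDerivAt f (deriv f x) x :=
  ((hf.differentiableOn (by simp) x hx).differentiableAt (Ioi_mem_nhds hx)).hasDerivAt

theorem hasDerivAt_iteratedDeriv {f : ℝ → ℂ} (hf : ContDiffOn ℝ ∞ f (Ioi 0)) (k : ℕ) {x : ℝ}
    (hx : 0 < x) : HasDerivAt (iteratedDeriv k f) (iteratedDeriv (k + 1) f x) x := by
  rw [iteratedDeriv_succ]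
  exact hasDerivAt_of_contDiffOn_Ioi (contDiffOn_iteratedDeriv_Ioi hf k) hx

theorem hasDerivAt_cpow_of_pos (c : ℂ) {x : ℝ} (hx : 0 < x) :
    HasDerivAt (fun y : ℝ => (y : ℂ) ^ c) (c * (x : ℂ) ^ (c - 1)) x := by
  rcases eq_or_ne c 0 with rfl | h
  · simpa using hasDerivAt_const x (1 : ℂ)
  · exact hasDerivAt_ofReal_cpow_const hx.ne' h

/-- If `y P' + c P = g` with `Re c > 0`, the solution that is `o(y ^ (-c))` at `0` is bounded by
the right-hand side. -/
theorem norm_le_div_re {P P' g : ℝ → ℂ} {c : ℂ} (hc : 0 < c.re) {x M : ℝ} (hx : 0 < x)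
    (hP : ∀ y ∈ Ioc 0 x, HasDerivAt P (P' y) y) (hE : ∀ y ∈ Ioc 0 x, y * P' y + c * P y = g y)
    (hg : ∀ y ∈ Ioc 0 x, ‖g y‖ ≤ M)
    (h0 : Tendsto (fun y : ℝ => (y : ℂ) ^ c * P y) (𝓝[>] 0) (𝓝 0)) : ‖P x‖ ≤ M / c.re := by
  have hM : 0 ≤ M := (norm_nonneg _).trans (hg x ⟨hx, le_rfl⟩)
  have hd : ∀ y ∈ Ioc 0 x, HasDerivAt (fun y : ℝ => (y : ℂ) ^ c * P y)
      ((y : ℂ) ^ (c - 1) * g y) y := by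
    intro y hy
    have hy0 : (y : ℂ) ≠ 0 := by exact_mod_cast hy.1.ne'
    have h1 := hasDerivAt_cpow_of_pos c hy.1
    refine (h1.mul (hP y hy)).congr_deriv ?_
    rw [← hE y hy, Complex.cpow_sub _ _ hy0, Complex.cpow_one]
    field_simp
    ring
  have h := norm_le_of_norm_deriv_le_of_tendsto_zero hx hd
    (B := fun y => M / c.re * y ^ c.re) (B' := fun y => M * y ^ (c.re - 1))
    (fun y hy => by
      refine ((Real.hasDerivAt_rpow_const (Or.inl hy.1.ne')).const_mul (M / c.re)).congr_deriv ?_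
      field_simp)
    (fun y hy => by have := hy.1; positivity)
    (fun y hy => by
      rw [norm_mul, Complex.norm_cpow_eq_rpow_re_of_pos hy.1, mul_comm]
      simp only [Complex.sub_re, Complex.one_re]
      exact mul_le_mul_of_nonneg_right (hg y hy) (Real.rpow_nonneg hy.1.le _)) h0
  rw [norm_mul, Complex.norm_cpow_eq_rpow_re_of_pos hx, mul_comm] at h
  exact le_of_mul_le_mul_right h (Real.rpow_pos_of_pos hx _)

theorem eventually_forall_Ioc {p : ℝ → Prop} (h : ∀ᶠ x in 𝓝[>] (0 : ℝ), p x) :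
    ∀ᶠ x in 𝓝[>] (0 : ℝ), ∀ y ∈ Ioc 0 x, p y := by
  obtain ⟨ε, hε, h'⟩ := mem_nhdsGT_iff_exists_Ioo_subset.1 h
  filter_upwards [Ioo_mem_nhdsGT (show (0 : ℝ) < ε from hε)] with x hx y hy
  exact h' ⟨hy.1, hy.2.trans_lt hx.2⟩

/-- Solutions of `y P' + c P = g` with `Re c > 0` and `g` bounded are bounded at `0`, apart from the
homogeneous solution `y ^ (-c)`, which the last hypothesis excludes. -/
theorem isBigO_one_of_mul_deriv_add {P g : ℝ → ℂ} {c : ℂ} (hc : 0 < c.re)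
    (hP : ∀ y > (0 : ℝ), DifferentiableAt ℝ P y) (hE : ∀ y > (0 : ℝ), y * deriv P y + c * P y = g y)
    (hg : g =O[𝓝[>] 0] (fun _ => (1 : ℝ)))
    (h0 : Tendsto (fun y : ℝ => (y : ℂ) ^ c * P y) (𝓝[>] 0) (𝓝 0)) :
    P =O[𝓝[>] 0] (fun _ => (1 : ℝ)) := by
  obtain ⟨M, hM⟩ := hg.bound
  refine Asymptotics.IsBigO.of_bound (M / c.re) ?_
  filter_upwards [eventually_forall_Ioc hM, self_mem_nhdsWithin] with x hx h
  simp only [norm_one, mul_one] at hx ⊢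
  exact norm_le_div_re hc h (fun y hy => (hP y hy.1).hasDerivAt) (fun y hy => hE y hy.1) hx h0

theorem iteratedDeriv_mul_deriv {f : ℝ → ℂ} (hf : ContDiffOn ℝ ∞ f (Ioi 0)) (k : ℕ) :
    ∀ x > (0 : ℝ), iteratedDeriv k (fun y : ℝ => (y : ℂ) * deriv f y) x
      = x * iteratedDeriv (k + 1) f x + k * iteratedDeriv k f x := by
  induction k with
  | zero => intro x _; simp [iteratedDeriv_one]
  | succ k ih =>
    intro x hx
    have h1 : HasDerivAt (fun y : ℝ => (y : ℂ) * iteratedDeriv (k + 1) f y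
        + k * iteratedDeriv k f y) (1 * iteratedDeriv (k + 1) f x
          + x * iteratedDeriv (k + 1 + 1) f x + k * iteratedDeriv (k + 1) f x) x :=
      ((hasDerivAt_id x).ofReal_comp.mul (hasDerivAt_iteratedDeriv hf (k + 1) hx)).add
        ((hasDerivAt_iteratedDeriv hf k hx).const_mul _)
    rw [iteratedDeriv_succ, Filter.EventuallyEq.deriv_eq
      (f := fun y : ℝ => (y : ℂ) * iteratedDeriv (k + 1) f y + k * iteratedDeriv k f y)
      (by filter_upwards [Ioi_mem_nhds hx] with y hy using ih y hy), h1.deriv]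
    push_cast
    ring

theorem tendsto_cpow_zero {c : ℂ} (hc : 0 < c.re) :
    Tendsto (fun y : ℝ => (y : ℂ) ^ c) (𝓝[>] 0) (𝓝 0) := by
  rw [tendsto_zero_iff_norm_tendsto_zero]
  have h : Tendsto (fun y : ℝ => y ^ c.re) (𝓝[>] 0) (𝓝 0) := by
    have := (Real.continuousAt_rpow_const 0 c.re (Or.inr hc.le)).tendsto
    rw [Real.zero_rpow hc.ne'] at this
    exact this.mono_left inf_le_left
  refine h.congr' ?_
  filter_upwards [self_mem_nhdsWithin] with y hy
  rw [Complex.norm_cpow_eq_rpow_re_of_pos hy]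

theorem isBigO_one_mul_tendsto_zero {f g : ℝ → ℂ} (hf : Tendsto f (𝓝[>] 0) (𝓝 0))
    (hg : g =O[𝓝[>] 0] (fun _ => (1 : ℝ))) :
    Tendsto (fun y => f y * g y) (𝓝[>] 0) (𝓝 0) := by
  have h1 : f =o[𝓝[>] 0] (fun _ => (1 : ℝ)) := (Asymptotics.isLittleO_one_iff ℝ).2 hf
  have := h1.mul_isBigO hg
  simpa using (Asymptotics.isLittleO_one_iff ℝ).1 (by simpa using this)

/-- Regularity for `x r' + c r = w`: as many derivatives of `r` are bounded at `0` as of `w`. -/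
theorem iteratedDeriv_isBigO_of_mul_deriv_add {r w : ℝ → ℂ} {c : ℂ} (hc : 0 < c.re)
    (hr : ContDiffOn ℝ ∞ r (Ioi 0)) (hE : ∀ x > (0 : ℝ), x * deriv r x + c * r x = w x)
    (h0 : Tendsto (fun y : ℝ => (y : ℂ) ^ c * r y) (𝓝[>] 0) (𝓝 0)) (k : ℕ)
    (hw : ∀ j ≤ k, iteratedDeriv j w =O[𝓝[>] 0] (fun _ => (1 : ℝ))) :
    iteratedDeriv k r =O[𝓝[>] 0] (fun _ => (1 : ℝ)) := by
  have hxr : ContDiffOn ℝ ∞ (fun y : ℝ => (y : ℂ) * deriv r y) (Ioi 0) :=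
    (Complex.ofRealCLM.contDiff.contDiffOn).mul
      ((contDiffOn_infty_iff_deriv_of_isOpen isOpen_Ioi).1 hr).2
  have hEk : ∀ k, ∀ x > (0 : ℝ), x * deriv (iteratedDeriv k r) x + (c + k) * iteratedDeriv k r x
      = iteratedDeriv k w x := by
    intro k x hx
    have e : iteratedDeriv k w x = iteratedDeriv k (fun y : ℝ => (y : ℂ) * deriv r y + c * r y) x
        := by
      refine Filter.EventuallyEq.iteratedDeriv_eq k ?_
      filter_upwards [Ioi_mem_nhds hx] with y hy using (hE y hy).symm
    have hn : ((k : ℕ) : WithTop ℕ∞) ≤ (∞ : WithTop ℕ∞) := by exact_mod_cast le_top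
    rw [e, iteratedDeriv_fun_add ((hxr.contDiffAt (Ioi_mem_nhds hx)).of_le hn)
      ((contDiffAt_const.mul (hr.contDiffAt (Ioi_mem_nhds hx))).of_le hn),
      iteratedDeriv_mul_deriv hr k x hx, ← iteratedDeriv_succ,
      iteratedDeriv_const_mul_field]
    ring
  induction k with
  | zero =>
    have := isBigO_one_of_mul_deriv_add hc (fun y hy => (hasDerivAt_of_contDiffOn_Ioi hr
        hy).differentiableAt)
      hE (by simpa using hw 0 le_rfl) h0
    simpa using this
  | succ k ih =>
    have ihk := ih fun j hj => hw j (hj.trans (Nat.le_succ k))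
    -- the homogeneous solution `x ^ (-(c + k + 1))` is excluded by the equation one order below,
    -- which bounds `x` times the next derivative
    have hcre : 0 < (c + (k : ℂ)).re := by
      have : (0 : ℝ) ≤ k := k.cast_nonneg
      simp only [Complex.add_re, Complex.natCast_re]
      linarith
    refine isBigO_one_of_mul_deriv_add (c := c + ((k + 1 : ℕ) : ℂ)) (by
      have : (0 : ℝ) ≤ k := k.cast_nonneg
      simp only [Complex.add_re, Complex.natCast_re]
      push_cast
      linarith) (fun y hy => (hasDerivAt_iteratedDeriv hr (k + 1) hy).differentiableAt)
      (hEk (k + 1)) (hw (k + 1) le_rfl) ?_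
    have h1 : (fun y : ℝ => (y : ℂ) * iteratedDeriv (k + 1) r y) =O[𝓝[>] 0] (fun _ => (1 : ℝ)) := by
      refine ((hw k (Nat.le_succ k)).sub (ihk.const_mul_left (c + k))).congr' ?_ EventuallyEq.rfl
      filter_upwards [self_mem_nhdsWithin] with x hx
      rw [← hEk k x hx, iteratedDeriv_succ]
      ring
    refine (isBigO_one_mul_tendsto_zero (tendsto_cpow_zero hcre) h1).congr' ?_
    filter_upwards [self_mem_nhdsWithin] with x hx
    have hx0 : (x : ℂ) ≠ 0 := by exact_mod_cast (ne_of_gt hx)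
    have e : (x : ℂ) ^ (c + ((k + 1 : ℕ) : ℂ)) = (x : ℂ) ^ (c + (k : ℂ)) * x := by
      rw [Nat.cast_succ, ← add_assoc, Complex.cpow_add _ _ hx0, Complex.cpow_one]
    rw [e]
    ring

/-! ### Primitives from the end point, radial means, and Hadamard's lemma -/

theorem intervalIntegrable_of_locally_bounded {f : ℝ → ℂ} (hf : ContinuousOn f (Ioi 0))
    (hb : ∀ X > (0 : ℝ), ∃ C, ∀ y ∈ Ioc 0 X, ‖f y‖ ≤ C) {x : ℝ} (hx : 0 ≤ x) :
    IntervalIntegrable f MeasureTheory.volume 0 x := by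
  rw [intervalIntegrable_iff_integrableOn_Ioc_of_le hx]
  obtain ⟨C, hC⟩ := hb (x + 1) (by linarith)
  refine MeasureTheory.IntegrableOn.of_bound (by simp)
    ((hf.mono Ioc_subset_Ioi_self).aestronglyMeasurable measurableSet_Ioc) C ?_
  filter_upwards [MeasureTheory.ae_restrict_mem measurableSet_Ioc] with y hy
  exact hC y ⟨hy.1, by linarith [hy.2]⟩

theorem hasDerivAt_integral_of_locally_bounded {f : ℝ → ℂ} (hf : ContinuousOn f (Ioi 0))
    (hb : ∀ X > (0 : ℝ), ∃ C, ∀ y ∈ Ioc 0 X, ‖f y‖ ≤ C) {x : ℝ} (hx : 0 < x) :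
    HasDerivAt (fun x => ∫ y in (0 : ℝ)..x, f y) (f x) x :=
  intervalIntegral.integral_hasDerivAt_right (intervalIntegrable_of_locally_bounded hf hb hx.le)
    (hf.stronglyMeasurableAtFilter isOpen_Ioi x hx) (hf.continuousAt (Ioi_mem_nhds hx))

theorem norm_integral_zero_le {f : ℝ → ℂ} {x C : ℝ} (hx : 0 ≤ x)
    (h : ∀ y ∈ Ioc 0 x, ‖f y‖ ≤ C) : ‖∫ y in (0 : ℝ)..x, f y‖ ≤ C * x := by
  have := intervalIntegral.norm_integral_le_of_norm_le_const (a := 0) (b := x) (f := f) (C := C)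
    (by rwa [uIoc_of_le hx])
  simpa [abs_of_nonneg hx] using this

theorem exists_bound_Ioc_of_continuousOn {f : ℝ → ℂ} (hf : ContinuousOn f (Ici 0)) (X : ℝ) :
    ∃ C, ∀ y ∈ Icc 0 X, ‖f y‖ ≤ C :=
  isCompact_Icc.exists_bound_of_continuousOn (hf.mono Icc_subset_Ici_self)

/-- The weighted mean `x ^ (-c) ∫₀ˣ y ^ (c - 1) w y dy`. -/
noncomputable def radialMean (c : ℂ) (w : ℝ → ℂ) (x : ℝ) : ℂ :=
  (x : ℂ) ^ (-c) * ∫ y in (0 : ℝ)..x, (y : ℂ) ^ (c - 1) * w y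

theorem continuousOn_cpow_Ioi (c : ℂ) : ContinuousOn (fun y : ℝ => (y : ℂ) ^ c) (Ioi 0) :=
  fun _ hx => (hasDerivAt_cpow_of_pos c hx).continuousAt.continuousWithinAt

theorem norm_cpow_mul_le {c : ℂ} (hc : 1 ≤ c.re) {w : ℝ → ℂ} {x C : ℝ} {y : ℝ} (hy : y ∈ Ioc 0 x)
    (hw : ‖w y‖ ≤ C) : ‖(y : ℂ) ^ (c - 1) * w y‖ ≤ x ^ (c.re - 1) * C := by
  rw [norm_mul, Complex.norm_cpow_eq_rpow_re_of_pos hy.1]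
  simp only [Complex.sub_re, Complex.one_re]
  exact mul_le_mul (Real.rpow_le_rpow hy.1.le hy.2 (by linarith)) hw (norm_nonneg _)
    (Real.rpow_nonneg (hy.1.le.trans hy.2) _)

theorem hasDerivAt_radialMean {c : ℂ} (hc : 1 ≤ c.re) {w : ℝ → ℂ} (hw : ContinuousOn w (Ici 0))
    {x : ℝ} (hx : 0 < x) :
    HasDerivAt (radialMean c w) ((w x - c * radialMean c w x) / x) x := by
  have h := hasDerivAt_integral_of_locally_bounded (f := fun y : ℝ => (y : ℂ) ^ (c - 1) * w y)
    ((continuousOn_cpow_Ioi _).mul (hw.mono Ioi_subset_Ici_self)) (fun X _ => by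
      obtain ⟨C, hC⟩ := exists_bound_Ioc_of_continuousOn hw X
      exact ⟨_, fun y hy => norm_cpow_mul_le hc hy (hC y (Ioc_subset_Icc_self hy))⟩) hx
  have hx0 : (x : ℂ) ≠ 0 := by exact_mod_cast hx.ne'
  refine ((hasDerivAt_cpow_of_pos (-c) hx).mul h).congr_deriv ?_
  rw [radialMean, Complex.cpow_sub _ _ hx0, Complex.cpow_sub _ _ hx0, Complex.cpow_one,
    Complex.cpow_neg]
  have : (x : ℂ) ^ c ≠ 0 := by simp [Complex.cpow_eq_zero_iff, hx0]
  field_simp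
  ring

theorem norm_radialMean_le {c : ℂ} (hc : 1 ≤ c.re) {w : ℝ → ℂ} {x C : ℝ} (hx : 0 < x)
    (hC : ∀ y ∈ Ioc 0 x, ‖w y‖ ≤ C) : ‖radialMean c w x‖ ≤ C := by
  have h := norm_integral_zero_le hx.le (fun y hy => norm_cpow_mul_le hc hy (hC y hy))
  rw [radialMean, norm_mul, Complex.norm_cpow_eq_rpow_re_of_pos hx, Complex.neg_re]
  calc _ ≤ x ^ (-c.re) * (x ^ (c.re - 1) * C * x) :=
        mul_le_mul_of_nonneg_left h (Real.rpow_nonneg hx.le _)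
    _ = C := by
      rw [Real.rpow_sub hx, Real.rpow_one, Real.rpow_neg hx.le]
      have := (Real.rpow_pos_of_pos hx c.re).ne'
      field_simp

theorem continuousOn_radialMean {c : ℂ} (hc : 1 ≤ c.re) {w : ℝ → ℂ} (hw : ContinuousOn w (Ici 0)) :
    ContinuousOn (radialMean c w) (Ioi 0) :=
  fun _ hx => (hasDerivAt_radialMean hc hw hx).continuousAt.continuousWithinAt

theorem radialMean_isBigO {c : ℂ} (hc : 1 ≤ c.re) {w : ℝ → ℂ} (hw : ContinuousOn w (Ici 0)) :
    radialMean c w =O[𝓝[>] 0] (fun _ => (1 : ℝ)) := by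
  obtain ⟨C, hC⟩ := exists_bound_Ioc_of_continuousOn hw 1
  refine Asymptotics.IsBigO.of_bound C ?_
  filter_upwards [Ioo_mem_nhdsGT one_pos] with x hx
  simpa using norm_radialMean_le hc hx.1 fun y hy => hC y ⟨hy.1.le, hy.2.trans hx.2.le⟩

/-- A first order linear equation with smooth coefficients has smooth solutions. -/
theorem contDiffOn_of_hasDerivAt_linear {r a b : ℝ → ℂ} (ha : ContDiffOn ℝ ∞ a (Ioi 0))
    (hb : ContDiffOn ℝ ∞ b (Ioi 0)) (h : ∀ x > 0, HasDerivAt r (a x * r x + b x) x) :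
    ContDiffOn ℝ ∞ r (Ioi 0) := by
  refine contDiffOn_infty.2 fun n => ?_
  induction n with
  | zero =>
    rw [Nat.cast_zero, contDiffOn_zero]
    exact fun x hx => (h x hx).continuousAt.continuousWithinAt
  | succ n ih =>
    rw [Nat.cast_succ, contDiffOn_succ_iff_deriv_of_isOpen isOpen_Ioi]
    refine ⟨fun x hx => (h x hx).differentiableAt.differentiableWithinAt, by simp, ?_⟩
    have hn : (n : WithTop ℕ∞) ≤ ∞ := by exact_mod_cast le_top
    exact (((ha.of_le hn).mul ih).add (hb.of_le hn)).congr fun x hx => (h x hx).deriv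

theorem contDiffOn_ofReal {s : Set ℝ} : ContDiffOn ℝ ∞ (fun x : ℝ => (x : ℂ)) s :=
  Complex.ofRealCLM.contDiff.contDiffOn

theorem contDiffOn_cpow_Ioi (c : ℂ) : ContDiffOn ℝ ∞ (fun y : ℝ => (y : ℂ) ^ c) (Ioi 0) := by
  refine contDiffOn_of_hasDerivAt_linear (a := fun y : ℝ => c * (y : ℂ)⁻¹) (b := fun _ => 0)
    (contDiffOn_const.mul (contDiffOn_ofReal.inv fun x hx => ?_)) contDiffOn_const fun x hx => ?_
  · exact_mod_cast (ne_of_gt (show (0 : ℝ) < x from hx))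
  · refine (hasDerivAt_cpow_of_pos c hx).congr_deriv ?_
    have hx0 : (x : ℂ) ≠ 0 := by exact_mod_cast (ne_of_gt hx)
    rw [Complex.cpow_sub _ _ hx0, Complex.cpow_one]
    field_simp
    simp

/-- For `w` smooth on `[0, ∞)`, the equation `x r' + c r = w` has a solution that is smooth
on `[0, ∞)`. -/
theorem exists_smooth_mul_deriv_add {c : ℂ} (hc : 1 ≤ c.re) {w : ℝ → ℂ}
    (hw : ContDiffOn ℝ ∞ w (Ici 0)) :
    ∃ r : ℝ → ℂ, ContDiffOn ℝ ∞ r (Ici 0) ∧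
      ∀ x > (0 : ℝ), HasDerivAt r ((w x - c * r x) / x) x := by
  have hd := fun x (hx : 0 < x) => hasDerivAt_radialMean hc hw.continuousOn hx
  have hinv : ContDiffOn ℝ ∞ (fun x : ℝ => (x : ℂ)⁻¹) (Ioi 0) := contDiffOn_ofReal.inv fun x hx =>
    by exact_mod_cast (ne_of_gt (show (0 : ℝ) < x from hx))
  have hs : ContDiffOn ℝ ∞ (radialMean c w) (Ioi 0) :=
    contDiffOn_of_hasDerivAt_linear (a := fun x : ℝ => -c * (x : ℂ)⁻¹)
      (b := fun x : ℝ => w x * (x : ℂ)⁻¹) (contDiffOn_const.mul hinv)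
      ((hw.mono Ioi_subset_Ici_self).mul hinv) fun x hx => (hd x hx).congr_deriv (by ring)
  obtain ⟨r, hr, he⟩ := exists_contDiffOn_Ici hs fun k =>
    iteratedDeriv_isBigO_of_mul_deriv_add (c := c) (w := w) (by linarith) hs (fun x hx => by
      have hx0 : (x : ℂ) ≠ 0 := by exact_mod_cast (ne_of_gt hx)
      rw [(hd x hx).deriv]
      field_simp
      ring)
      (isBigO_one_mul_tendsto_zero (tendsto_cpow_zero (by linarith))
        (radialMean_isBigO hc hw.continuousOn)) k
      fun j _ => iteratedDeriv_isBigO_one_of_contDiffOn_Ici hw j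
  refine ⟨r, hr, fun x hx => ?_⟩
  rw [he x hx]
  refine (hd x hx).congr_of_eventuallyEq ?_
  filter_upwards [Ioi_mem_nhds hx] with y hy using he y hy

theorem contDiffOn_derivWithin_Ici {f : ℝ → ℂ} (hf : ContDiffOn ℝ ∞ f (Ici 0)) :
    ContDiffOn ℝ ∞ (derivWithin f (Ici 0)) (Ici 0) :=
  ((contDiffOn_infty_iff_derivWithin (uniqueDiffOn_Ici 0)).1 hf).2

theorem hasDerivAt_of_contDiffOn_Ici {f : ℝ → ℂ} (hf : ContDiffOn ℝ ∞ f (Ici 0)) {x : ℝ}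
    (hx : 0 < x) : HasDerivAt f (derivWithin f (Ici 0) x) x :=
  ((hf.differentiableOn (by simp) x hx.le).hasDerivWithinAt).hasDerivAt (Ici_mem_nhds hx)

theorem eq_of_hasDerivAt_eq {I : Set ℝ} (hI : IsOpen I) (hI' : Convex ℝ I) {f g f' : ℝ → ℂ}
    (hf : ∀ x ∈ I, HasDerivAt f (f' x) x) (hg : ∀ x ∈ I, HasDerivAt g (f' x) x) {x y : ℝ}
    (hx : x ∈ I) (hy : y ∈ I) : f x - g x = f y - g y := by
  refine hI'.is_const_of_fderivWithin_eq_zero (𝕜 := ℝ) (f := fun x => f x - g x)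
    (fun z hz => ((hf z hz).sub (hg z hz)).differentiableAt.differentiableWithinAt)
    (fun z hz => ?_) hx hy
  rw [fderivWithin_of_isOpen hI hz]
  have := ((hf z hz).sub (hg z hz)).hasFDerivAt.fderiv
  rw [show (fun x => f x - g x) = f - g from rfl, this]
  ext
  simp

/-- Hadamard's lemma on a half line. -/
theorem exists_eq_add_mul {f : ℝ → ℂ} (hf : ContDiffOn ℝ ∞ f (Ici 0)) :
    ∃ g : ℝ → ℂ, ContDiffOn ℝ ∞ g (Ici 0) ∧ ∀ x ≥ (0 : ℝ), f x = f 0 + x * g x := by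
  obtain ⟨r, hr, hd⟩ := exists_smooth_mul_deriv_add (c := 1) (by simp)
    (contDiffOn_derivWithin_Ici hf)
  refine ⟨r, hr, fun x hx => ?_⟩
  have hd' : ∀ x > (0 : ℝ), HasDerivAt (fun x : ℝ => (x : ℂ) * r x) (derivWithin f (Ici 0) x) x
      := by
    intro x hx
    have hx0 : (x : ℂ) ≠ 0 := by exact_mod_cast (ne_of_gt hx)
    refine ((hasDerivAt_id x).ofReal_comp.mul (hd x hx)).congr_deriv ?_
    simp
    field_simp
    ring
  rcases eq_or_lt_of_le (show (0 : ℝ) ≤ x from hx) with rfl | h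
  · simp
  have hc := fun y (hy : y ∈ Ioi (0 : ℝ)) => eq_of_hasDerivAt_eq isOpen_Ioi (convex_Ioi 0)
    (fun x hx => hasDerivAt_of_contDiffOn_Ici hf hx) hd' h hy
  have hlim : Tendsto (fun y : ℝ => f y - y * r y) (𝓝[>] 0) (𝓝 (f 0 - (0 : ℝ) * r 0)) := by
    have : ContinuousOn (fun y : ℝ => f y - y * r y) (Ici 0) :=
      hf.continuousOn.sub (contDiffOn_ofReal.continuousOn.mul hr.continuousOn)
    exact (this 0 self_mem_Ici).mono_left (nhdsWithin_mono _ Ioi_subset_Ici_self)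
  have hconst : Tendsto (fun y : ℝ => f y - y * r y) (𝓝[>] 0) (𝓝 (f x - x * r x)) := by
    refine tendsto_const_nhds.congr' ?_
    filter_upwards [self_mem_nhdsWithin] with y hy using hc y hy
  have := tendsto_nhds_unique hconst hlim
  simp at this
  linear_combination this

/-- A primitive of `x ^ (-1 - γ) w` is `x ^ (-γ)` times a smooth function, up to a logarithm which
is present only if `γ` is a natural number. -/
theorem exists_primitive_cpow_mul (n : ℕ) : ∀ {γ : ℂ}, γ.re + 1 < n → ∀ {w : ℝ → ℂ},
    ContDiffOn ℝ ∞ w (Ici 0) → ∃ (s : ℝ → ℂ) (b : ℂ), ContDiffOn ℝ ∞ s (Ici 0) ∧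
      (b ≠ 0 → ∃ m : ℕ, γ = m) ∧ ∀ x > (0 : ℝ),
      HasDerivAt (fun x : ℝ => (x : ℂ) ^ (-γ) * s x + b * (Real.log x : ℂ))
        ((x : ℂ) ^ (-1 - γ) * w x) x := by
  induction n with
  | zero =>
    intro γ hγ w hw
    obtain ⟨r, hr, hd⟩ := exists_smooth_mul_deriv_add (c := -γ)
      (by simp at hγ ⊢; linarith) hw
    refine ⟨r, 0, hr, by simp, fun x hx => ?_⟩
    have hx0 : (x : ℂ) ≠ 0 := by exact_mod_cast (ne_of_gt hx)
    have e : (fun x : ℝ => (x : ℂ) ^ (-γ) * r x + 0 * (Real.log x : ℂ))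
      = fun x : ℝ => (x : ℂ) ^ (-γ) * r x := by ext; simp
    rw [e]
    refine ((hasDerivAt_cpow_of_pos (-γ) hx).mul (hd x hx)).congr_deriv ?_
    rw [show -1 - γ = -γ - 1 by ring, Complex.cpow_sub _ _ hx0, Complex.cpow_one]
    field_simp
    ring
  | succ n ih =>
    intro γ hγ w hw
    -- write `w = w 0 + x w1`; the constant gives a power, or a logarithm if `γ = 0`, and `x w1` is
    -- the case `γ - 1`
    obtain ⟨w1, hw1, he⟩ := exists_eq_add_mul hw
    obtain ⟨s, b, hs, hb, hd⟩ := ih (γ := γ - 1) (by push_cast at hγ; simp; linarith) hw1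
    by_cases h0 : γ = 0
    · have hb0 : b = 0 := by
        by_contra h
        obtain ⟨m, hm⟩ := hb h
        have : ((0 : ℝ) - 1) = m := by
          have := congrArg Complex.re hm
          simpa [h0] using this
        have h2 : (0 : ℝ) ≤ m := m.cast_nonneg
        linarith
      refine ⟨fun x : ℝ => x * s x, w 0, contDiffOn_ofReal.mul hs, fun _ => ⟨0, by simp [h0]⟩,
        fun x hx => ?_⟩
      have hx0 : (x : ℂ) ≠ 0 := by exact_mod_cast (ne_of_gt hx)
      have h1 := (hd x hx).add (((Real.hasDerivAt_log hx.ne').ofReal_comp).const_mul (w 0))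
      refine (h1.congr_of_eventuallyEq ?_).congr_deriv ?_
      · filter_upwards [Ioi_mem_nhds hx] with y hy
        simp [h0, hb0]
      · rw [he x hx.le]
        simp [h0]
        rw [Complex.cpow_neg_one]
        field_simp
        ring
    · refine ⟨fun x : ℝ => x * s x - w 0 / γ, b, (contDiffOn_ofReal.mul hs).sub contDiffOn_const,
        fun h => ?_, fun x hx => ?_⟩
      · obtain ⟨m, hm⟩ := hb h
        exact ⟨m + 1, by push_cast; linear_combination hm⟩
      have hx0 : (x : ℂ) ≠ 0 := by exact_mod_cast (ne_of_gt hx)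
      have h1 := (hd x hx).sub ((hasDerivAt_cpow_of_pos (-γ) hx).mul_const (w 0 / γ))
      refine (h1.congr_of_eventuallyEq ?_).congr_deriv ?_
      · filter_upwards [Ioi_mem_nhds hx] with y hy
        have hy0 : (y : ℂ) ≠ 0 := by exact_mod_cast (ne_of_gt (show (0 : ℝ) < y from hy))
        simp only [Pi.sub_apply]
        rw [show -(γ - 1) = -γ + 1 by ring, Complex.cpow_add _ _ hy0, Complex.cpow_one]
        ring
      · rw [he x hx.le, show -1 - (γ - 1) = (-γ - 1) + 1 by ring, Complex.cpow_add _ _ hx0,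
          Complex.cpow_one, show -1 - γ = -γ - 1 by ring]
        field_simp
        ring

/-- A function that is smooth on `[0, ε)` agrees near `0` with one that is smooth on `[0, ∞)`. -/
theorem exists_contDiffOn_Ici_eq {f : ℝ → ℂ} {ε : ℝ} (hε : 0 < ε)
    (hf : ContDiffOn ℝ ∞ f (Ico 0 ε)) :
    ∃ g : ℝ → ℂ, ContDiffOn ℝ ∞ g (Ici 0) ∧ (∀ x ∈ Icc 0 (ε / 3), g x = f x) ∧
      ∀ x ≥ ε, g x = 0 := by
  let χ : ℝ → ℝ := fun x => Real.smoothTransition (2 - 3 * x / ε)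
  have hχ : ContDiff ℝ ∞ χ := Real.smoothTransition.contDiff.comp (by fun_prop)
  have hzero : ∀ y, 2 / 3 * ε < y → (χ y : ℂ) * f y = 0 := fun y hy => by
    have : χ y = 0 := Real.smoothTransition.zero_of_nonpos (by
      have : 2 ≤ 3 * y / ε := by
        rw [le_div_iff₀ hε]
        linarith
      linarith)
    simp [this]
  refine ⟨fun x => (χ x : ℂ) * f x, ?_, fun x hx => ?_, fun x hx => hzero x ?_⟩
  · intro x hx
    rcases lt_or_ge x ε with h | h
    · have h1 : ContDiffOn ℝ ∞ (fun x => (χ x : ℂ) * f x) (Ico 0 ε) :=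
        (Complex.ofRealCLM.contDiff.comp hχ).contDiffOn.mul hf
      refine (h1 x ⟨hx, h⟩).mono_of_mem_nhdsWithin ?_
      exact inter_mem_nhdsWithin _ (Iio_mem_nhds h)
    · have h2 : ∀ᶠ y in 𝓝 x, (χ y : ℂ) * f y = 0 := by
        filter_upwards [Ioi_mem_nhds (show 2 / 3 * ε < x by linarith)] with y hy using hzero y hy
      have h3 : ContDiffAt ℝ ∞ (fun y => (χ y : ℂ) * f y) x :=
        (contDiffAt_const (c := (0 : ℂ))).congr_of_eventuallyEq h2
      exact h3.contDiffWithinAt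
  · have : χ x = 1 := Real.smoothTransition.one_of_one_le (by
      have : 3 * x / ε ≤ 1 := by
        rw [div_le_one hε]
        linarith [hx.2]
      linarith)
    simp [this]
  · linarith [show ε ≤ x from hx]

/-! ### Volterra equations -/

/-- The bound that makes Volterra operators contractions for an exponentially weighted norm. -/
theorem norm_integral_zero_le_exp {f : ℝ → ℂ} {x M D : ℝ} (hD : 0 ≤ D) (hx : 0 ≤ x)
    (h : ∀ y ∈ Ioc 0 x, ‖f y‖ ≤ M * D * Real.exp (M * y)) :
    ‖∫ y in (0 : ℝ)..x, f y‖ ≤ D * Real.exp (M * x) := by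
  have h1 : ‖∫ y in (0 : ℝ)..x, f y‖ ≤ ∫ y in (0 : ℝ)..x, M * D * Real.exp (M * y) :=
    intervalIntegral.norm_integral_le_of_norm_le hx
      (Eventually.of_forall fun y hy => h y hy)
      ((by fun_prop : Continuous fun y => M * D * Real.exp (M * y)).intervalIntegrable _ _)
  have h2 : ∫ y in (0 : ℝ)..x, M * D * Real.exp (M * y)
      = D * Real.exp (M * x) - D * Real.exp (M * 0) := by
    refine intervalIntegral.integral_eq_sub_of_hasDerivAt (f := fun y => D * Real.exp (M * y))
      (fun y _ => ?_)
      ((by fun_prop : Continuous fun y => M * D * Real.exp (M * y)).intervalIntegrable _ _)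
    refine ((((hasDerivAt_id y).const_mul M).exp).const_mul D).congr_deriv ?_
    simp
    ring
  rw [h2] at h1
  have : 0 ≤ D * Real.exp (M * 0) := by positivity
  linarith

/-- The equation `f = 1 + K f` is solvable if `K` is linear and contracts an exponentially weighted
supremum norm, as Volterra operators do. -/
theorem exists_continuousOn_eq_one_add (K : (ℝ → ℂ) → ℝ → ℂ) {M : ℝ} (hM : 0 ≤ M)
    (hcont : ∀ f, ContinuousOn f (Ici 0) → ContinuousOn (K f) (Ici 0))
    (hsub : ∀ f g, ContinuousOn f (Ici 0) → ContinuousOn g (Ici 0) → ∀ x ≥ (0 : ℝ),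
      K (fun y => f y - g y) x = K f x - K g x)
    (hb : ∀ f D, 0 ≤ D → ContinuousOn f (Ici 0) →
      (∀ y ≥ (0 : ℝ), ‖f y‖ ≤ D * Real.exp (M * y)) →
      ∀ x ≥ (0 : ℝ), ‖K f x‖ ≤ D / 2 * Real.exp (M * x)) :
    ∃ f, ContinuousOn f (Ici 0) ∧ ∀ x ≥ (0 : ℝ), f x = 1 + K f x := by
  -- Picard iteration: the differences decay like `2 ^ (-n)` in the weighted norm
  let s : ℕ → ℝ → ℂ := fun n => (fun f x => 1 + K f x)^[n] 0
  have hs : ∀ n x, s (n + 1) x = 1 + K (s n) x := fun n x => by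
    simp only [s, Function.iterate_succ_apply']
  have hc : ∀ n, ContinuousOn (s n) (Ici 0) := by
    intro n
    induction n with
    | zero => exact continuousOn_const
    | succ n ih => exact (continuousOn_const.add (hcont _ ih)).congr fun x _ => hs n x
  have hd : ∀ n, ∀ x ≥ (0 : ℝ), ‖s (n + 1) x - s n x‖ ≤ (1 / 2) ^ n * Real.exp (M * x) := by
    intro n
    induction n with
    | zero =>
      intro x hx
      have h0 : K 0 x = 0 := by
        have := hsub 0 0 continuousOn_const continuousOn_const x hx
        rw [sub_self, show (fun y => (0 : ℝ → ℂ) y - (0 : ℝ → ℂ) y) = 0 by ext; simp] at this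
        exact this
      rw [hs]
      simp only [s, Function.iterate_zero, id, h0]
      simpa using mul_nonneg hM hx
    | succ n ih =>
      intro x hx
      have := hb (fun y => s (n + 1) y - s n y) _ (by positivity) ((hc _).sub (hc _)) ih x hx
      rw [hsub _ _ (hc _) (hc _) x hx] at this
      rw [hs (n + 1), hs n, add_sub_add_left_eq_sub]
      refine this.trans (le_of_eq ?_)
      ring
  have hgeo : ∀ x ≥ (0 : ℝ), ∀ n, dist (s n x) (s (n + 1) x) ≤ Real.exp (M * x) * (1 / 2) ^ n :=
    fun x hx n => by
      rw [dist_comm, dist_eq_norm, mul_comm]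
      exact hd n x hx
  have hlim : ∀ x, ∃ z, 0 ≤ x → Tendsto (fun n => s n x) atTop (𝓝 z) := fun x => by
    by_cases hx : 0 ≤ x
    · obtain ⟨z, hz⟩ := cauchySeq_tendsto_of_complete
        (cauchySeq_of_le_geometric _ _ (by norm_num) (hgeo x hx))
      exact ⟨z, fun _ => hz⟩
    · exact ⟨0, fun h => absurd h hx⟩
  choose f hf using hlim
  have hest : ∀ n, ∀ x ≥ (0 : ℝ), ‖f x - s n x‖ ≤ 2 * (1 / 2) ^ n * Real.exp (M * x) := by
    intro n x hx
    have := dist_le_of_le_geometric_of_tendsto _ _ (by norm_num) (hgeo x hx) (hf x hx) n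
    rw [dist_comm, dist_eq_norm] at this
    refine this.trans (le_of_eq ?_)
    ring
  have hgeo0 : ∀ x : ℝ, Tendsto (fun n : ℕ => 2 * (1 / 2 : ℝ) ^ n * Real.exp (M * x)) atTop (𝓝 0) :=
    fun x => by
      simpa using ((tendsto_pow_atTop_nhds_zero_of_lt_one (r := (1 / 2 : ℝ)) (by norm_num)
        (by norm_num)).const_mul 2).mul_const (Real.exp (M * x))
  have hfc : ContinuousOn f (Ici 0) := by
    refine TendstoLocallyUniformlyOn.continuousOn (F := s) (p := atTop) ?_
      (Frequently.of_forall hc)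
    rw [Metric.tendstoLocallyUniformlyOn_iff]
    intro ε hε x _
    refine ⟨Iio (x + 1) ∩ Ici 0, inter_mem (mem_nhdsWithin_of_mem_nhds (Iio_mem_nhds (by linarith)))
      self_mem_nhdsWithin, ?_⟩
    filter_upwards [(hgeo0 (x + 1)).eventually_lt_const hε] with n hn y hy
    rw [dist_eq_norm]
    refine (hest n y hy.2).trans_lt (lt_of_le_of_lt ?_ hn)
    have : M * y ≤ M * (x + 1) := mul_le_mul_of_nonneg_left hy.1.le hM
    gcongr
  refine ⟨f, hfc, fun x hx => ?_⟩
  have h1 : Tendsto (fun n => s (n + 1) x) atTop (𝓝 (f x)) :=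
    (hf x hx).comp (tendsto_add_atTop_nat 1)
  have h2 : Tendsto (fun n => s (n + 1) x) atTop (𝓝 (1 + K f x)) := by
    rw [tendsto_iff_norm_sub_tendsto_zero]
    refine squeeze_zero (fun _ => norm_nonneg _) (fun n => ?_) (hgeo0 x)
    have := hb (fun y => f y - s n y) _ (by positivity) (hfc.sub (hc n)) (hest n) x hx
    rw [hsub _ _ hfc (hc n) x hx] at this
    rw [hs, add_sub_add_left_eq_sub, norm_sub_rev]
    refine this.trans ?_
    have : 0 ≤ (1 / 2 : ℝ) ^ n * Real.exp (M * x) := by positivity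
    linarith
  exact tendsto_nhds_unique h1 h2

theorem contDiffOn_of_hasDerivAt_system {v P a b : ℝ → ℂ} (ha : ContDiffOn ℝ ∞ a (Ioi 0))
    (hb : ContDiffOn ℝ ∞ b (Ioi 0)) (hv : ∀ x > 0, HasDerivAt v (P x) x)
    (hP : ∀ x > 0, HasDerivAt P (a x * v x + b x * P x) x) :
    ContDiffOn ℝ ∞ v (Ioi 0) ∧ ContDiffOn ℝ ∞ P (Ioi 0) := by
  have h : ∀ n : ℕ, ContDiffOn ℝ n v (Ioi 0) ∧ ContDiffOn ℝ n P (Ioi 0) := by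
    intro n
    induction n with
    | zero =>
      rw [Nat.cast_zero, contDiffOn_zero, contDiffOn_zero]
      exact ⟨fun x hx => (hv x hx).continuousAt.continuousWithinAt,
        fun x hx => (hP x hx).continuousAt.continuousWithinAt⟩
    | succ n ih =>
      have hn : (n : WithTop ℕ∞) ≤ ∞ := by exact_mod_cast le_top
      rw [Nat.cast_succ, contDiffOn_succ_iff_deriv_of_isOpen isOpen_Ioi,
        contDiffOn_succ_iff_deriv_of_isOpen isOpen_Ioi]
      exact ⟨⟨fun x hx => (hv x hx).differentiableAt.differentiableWithinAt, by simp,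
        ih.2.congr fun x hx => (hv x hx).deriv⟩,
        ⟨fun x hx => (hP x hx).differentiableAt.differentiableWithinAt, by simp,
        (((ha.of_le hn).mul ih.1).add ((hb.of_le hn).mul ih.2)).congr fun x hx => (hP x hx).deriv⟩⟩
  exact ⟨contDiffOn_infty.2 fun n => (h n).1, contDiffOn_infty.2 fun n => (h n).2⟩

theorem radialMean_sub {c : ℂ} (hc : 1 ≤ c.re) {f g : ℝ → ℂ} (hf : ContinuousOn f (Ici 0))
    (hg : ContinuousOn g (Ici 0)) {x : ℝ} (hx : 0 ≤ x) :
    radialMean c (fun y => f y - g y) x = radialMean c f x - radialMean c g x := by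
  have hi : ∀ {f : ℝ → ℂ}, ContinuousOn f (Ici 0) →
      IntervalIntegrable (fun y : ℝ => (y : ℂ) ^ (c - 1) * f y) MeasureTheory.volume 0 x :=
    fun {f} hf => intervalIntegrable_of_locally_bounded
      ((continuousOn_cpow_Ioi _).mul (hf.mono Ioi_subset_Ici_self)) (fun X _ => by
      obtain ⟨C, hC⟩ := exists_bound_Ioc_of_continuousOn hf X
      exact ⟨_, fun y hy => norm_cpow_mul_le hc hy (hC y (Ioc_subset_Icc_self hy))⟩) hx
  simp only [radialMean]
  rw [← mul_sub, ← intervalIntegral.integral_sub (hi hf) (hi hg)]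
  simp only [mul_sub]

theorem continuousOn_Ici_integral {f : ℝ → ℂ} (hf : ContinuousOn f (Ioi 0))
    (hb : ∀ X > (0 : ℝ), ∃ C, ∀ y ∈ Ioc 0 X, ‖f y‖ ≤ C) :
    ContinuousOn (fun x => ∫ y in (0 : ℝ)..x, f y) (Ici 0) := by
  intro x hx
  rcases eq_or_lt_of_le (show (0 : ℝ) ≤ x from hx) with rfl | h
  · obtain ⟨C, hC⟩ := hb 1 one_pos
    rw [ContinuousWithinAt, intervalIntegral.integral_same, tendsto_zero_iff_norm_tendsto_zero]
    have h0 : Tendsto (fun x : ℝ => C * x) (𝓝[≥] 0) (𝓝 0) := by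
      have : Tendsto (fun x : ℝ => C * x) (𝓝 0) (𝓝 (C * 0)) := (continuous_const.mul
          continuous_id).tendsto 0
      rw [mul_zero] at this
      exact this.mono_left inf_le_left
    refine squeeze_zero' (Eventually.of_forall fun _ => norm_nonneg _) ?_ h0
    filter_upwards [Icc_mem_nhdsGE one_pos] with y hy
    exact norm_integral_zero_le hy.1 fun z hz => hC z ⟨hz.1, hz.2.trans hy.2⟩
  · exact (hasDerivAt_integral_of_locally_bounded hf hb h).continuousAt.continuousWithinAt

/-- The regular solution of `x v'' + c v' = B v` at the singular point `0`. -/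
theorem exists_regular_solution {c : ℂ} (hc : 1 ≤ c.re) {B : ℝ → ℂ}
    (hB : ContDiffOn ℝ ∞ B (Ici 0)) {M : ℝ} (hM : 0 < M) (hBM : ∀ x ≥ (0 : ℝ), ‖B x‖ ≤ M) :
    ∃ v P : ℝ → ℂ, ContDiffOn ℝ ∞ v (Ici 0) ∧ v 0 = 1 ∧ (∀ x > 0, HasDerivAt v (P x) x) ∧
      (∀ x > 0, HasDerivAt P ((B x * v x - c * P x) / x) x) ∧
      P =O[𝓝[>] 0] (fun _ => (1 : ℝ)) := by
  have hBf : ∀ {f : ℝ → ℂ}, ContinuousOn f (Ici 0) → ContinuousOn (fun y => B y * f y) (Ici 0) :=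
    fun hf => hB.continuousOn.mul hf
  have hbf : ∀ {f : ℝ → ℂ}, ContinuousOn f (Ici 0) → ∀ X > (0 : ℝ), ∃ C, ∀ y ∈ Ioc 0 X,
      ‖radialMean c (fun y => B y * f y) y‖ ≤ C := fun {f} hf X _ => by
    obtain ⟨C, hC⟩ := exists_bound_Ioc_of_continuousOn (hBf hf) X
    exact ⟨C, fun y hy => norm_radialMean_le hc hy.1 fun z hz => hC z ⟨hz.1.le, hz.2.trans hy.2⟩⟩
  -- integrated twice, the equation reads `v = 1 + ∫₀ˣ P` with `P` the radial mean of `B v`; the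
  -- weight with exponent `2 M` halves the norm
  obtain ⟨v, hv, hfix⟩ := exists_continuousOn_eq_one_add
    (fun f x => ∫ y in (0 : ℝ)..x, radialMean c (fun y => B y * f y) y) (M := 2 * M) (by positivity)
    (fun f hf => continuousOn_Ici_integral
      (continuousOn_radialMean hc (hBf hf)) (hbf hf))
    (fun f g hf hg x hx => by
      simp only
      rw [← intervalIntegral.integral_sub
        (intervalIntegrable_of_locally_bounded
          (continuousOn_radialMean hc (hBf hf)) (hbf hf) hx)
        (intervalIntegrable_of_locally_bounded
          (continuousOn_radialMean hc (hBf hg)) (hbf hg) hx)]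
      refine intervalIntegral.integral_congr fun y hy => ?_
      rw [uIcc_of_le hx] at hy
      rw [← radialMean_sub hc (hBf hf) (hBf hg) hy.1]
      simp only [mul_sub])
    (fun f D hD hf hfD x hx => by
      refine norm_integral_zero_le_exp (by positivity) hx fun y hy => ?_
      refine (norm_radialMean_le hc hy.1 (C := M * (D * Real.exp (2 * M * y))) fun z hz => ?_).trans
        (le_of_eq (by ring))
      rw [norm_mul]
      refine mul_le_mul (hBM z hz.1.le) ((hfD z hz.1.le).trans ?_) (norm_nonneg _) hM.le
      have := hz.2
      gcongr)
  have hBv := hBf hv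
  set P := radialMean c (fun y => B y * v y) with hPdef
  have hP : ∀ x > 0, HasDerivAt P ((B x * v x - c * P x) / x) x :=
    fun x hx => hasDerivAt_radialMean hc hBv hx
  have hv' : ∀ x > 0, HasDerivAt v (P x) x := fun x hx => by
    refine ((hasDerivAt_integral_of_locally_bounded (continuousOn_radialMean hc hBv)
      (hbf hv) hx).const_add 1).congr_of_eventuallyEq ?_
    filter_upwards [Ioi_mem_nhds hx] with y hy using hfix y (le_of_lt hy)
  have hinv : ContDiffOn ℝ ∞ (fun x : ℝ => (x : ℂ)⁻¹) (Ioi 0) := contDiffOn_ofReal.inv fun x hx =>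
    by exact_mod_cast (ne_of_gt (show (0 : ℝ) < x from hx))
  obtain ⟨hvs, hPs⟩ := contDiffOn_of_hasDerivAt_system
    (a := fun x : ℝ => B x * (x : ℂ)⁻¹) (b := fun x : ℝ => -c * (x : ℂ)⁻¹)
    ((hB.mono Ioi_subset_Ici_self).mul hinv) (contDiffOn_const.mul hinv) hv'
    (fun x hx => (hP x hx).congr_deriv (by ring))
  have hv0 : Tendsto v (𝓝[>] 0) (𝓝 (v 0)) :=
    (hv 0 self_mem_Ici).mono_left (nhdsWithin_mono _ Ioi_subset_Ici_self)
  -- `x P' + c P = B v` with `P = v'`: bounds for `k` derivatives of `v` give one more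
  have hk : ∀ k, ∀ j ≤ k, iteratedDeriv j v =O[𝓝[>] 0] (fun _ => (1 : ℝ)) := by
    intro k
    induction k with
    | zero =>
      intro j hj
      obtain rfl : j = 0 := by omega
      simpa using hv0.isBigO_one ℝ
    | succ k ih =>
      intro j hj
      rcases Nat.lt_or_ge j (k + 1) with h | h
      · exact ih j (by omega)
      obtain rfl : j = k + 1 := by omega
      rw [iteratedDeriv_succ']
      refine iteratedDeriv_isBigO_congr (f := P) (fun x hx => (hv' x hx).deriv.symm) k ?_
      refine iteratedDeriv_isBigO_of_mul_deriv_add (c := c) (w := fun x => B x * v x) (by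
          linarith) hPs
        (fun x hx => ?_) (isBigO_one_mul_tendsto_zero (tendsto_cpow_zero (by linarith))
        (radialMean_isBigO hc hBv)) k fun i hi => ?_
      · have hx0 : (x : ℂ) ≠ 0 := by exact_mod_cast (ne_of_gt hx)
        rw [(hP x hx).deriv]
        field_simp
        ring
      · simpa using iteratedDeriv_mul_isBigO hB hvs (w := fun _ => 1) (k := i)
          fun n hn => by simpa using ih n (hn.trans hi)
  obtain ⟨V, hV, he⟩ := exists_contDiffOn_Ici hvs fun k => hk k k le_rfl
  refine ⟨V, P, hV, ?_, fun x hx => ?_, fun x hx => ?_, radialMean_isBigO hc hBv⟩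
  · have h1 : Tendsto V (𝓝[>] 0) (𝓝 (V 0)) :=
      (hV.continuousOn 0 self_mem_Ici).mono_left (nhdsWithin_mono _ Ioi_subset_Ici_self)
    have h2 : Tendsto V (𝓝[>] 0) (𝓝 (v 0)) := hv0.congr' (by
      filter_upwards [self_mem_nhdsWithin] with x hx using (he x hx).symm)
    rw [tendsto_nhds_unique h1 h2, hfix 0 le_rfl]
    simp
  · refine (hv' x hx).congr_of_eventuallyEq ?_
    filter_upwards [Ioi_mem_nhds hx] with y hy using he y hy
  · rw [he x hx]
    exact hP x hx

/-! ### The model operator near `0` -/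

/-- The potential `U` in the form `Q'' = U Q` of the model equation. -/
noncomputable def modelPotential (ς : ℝ) (κ : ℤ) (α : ℂ) (Ψ : ℝ → ℂ) (l : ℝ) : ℂ :=
  (ς : ℂ) * (l : ℂ) ^ κ + (α ^ 2 - 1 / 4) / (l : ℂ) ^ 2 + Ψ l / (l : ℂ) ^ 2

section
variable {ς : ℝ} {κ : ℤ} {α : ℂ} {Ψ : ℝ → ℂ} {Q : ℝ → ℂ}

theorem hasDerivAt_of_mem_modelKernel (hQ : Q ∈ modelKernel ς κ α Ψ) {l : ℝ} (hl : 0 < l) :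
    HasDerivAt Q (deriv Q l) l :=
  hasDerivAt_of_contDiffOn_Ioi hQ.1 hl

theorem hasDerivAt_deriv_of_mem_modelKernel (hQ : Q ∈ modelKernel ς κ α Ψ) {l : ℝ} (hl : 0 < l) :
    HasDerivAt (deriv Q) (modelPotential ς κ α Ψ l * Q l) l := by
  have h := hasDerivAt_of_contDiffOn_Ioi
    ((contDiffOn_infty_iff_deriv_of_isOpen isOpen_Ioi).1 hQ.1).2 hl
  convert h using 1
  have := hQ.2 l hl
  rw [modelPotential]
  linear_combination this

theorem contDiffOn_modelPotential (hΨ : ContDiffOn ℝ ∞ Ψ (Ici 0)) :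
    ContDiffOn ℝ ∞ (modelPotential ς κ α Ψ) (Ioi 0) := by
  have hne : ∀ x ∈ Ioi (0 : ℝ), (x : ℂ) ≠ 0 := fun x hx => by exact_mod_cast (ne_of_gt hx)
  have hz : ContDiffOn ℝ ∞ (fun x : ℝ => (x : ℂ) ^ κ) (Ioi 0) :=
    (contDiffOn_cpow_Ioi (κ : ℂ)).congr fun x _ => (Complex.cpow_intCast _ _).symm
  have hi : ContDiffOn ℝ ∞ (fun x : ℝ => ((x : ℂ) ^ 2)⁻¹) (Ioi 0) :=
    (contDiffOn_ofReal.pow 2).inv fun x hx => pow_ne_zero 2 (hne x hx)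
  refine (((contDiffOn_const (c := (ς : ℂ))).mul hz).add
    (((contDiffOn_const (c := α ^ 2 - 1 / 4)).mul hi).add
      ((hΨ.mono Ioi_subset_Ici_self).mul hi))).congr fun x _ => ?_
  simp only [modelPotential, div_eq_mul_inv]
  ring

theorem mem_modelKernel_of_hasDerivAt {P : ℝ → ℂ} (hΨ : ContDiffOn ℝ ∞ Ψ (Ici 0))
    (h1 : ∀ l > (0 : ℝ), HasDerivAt Q (P l) l)
    (h2 : ∀ l > (0 : ℝ), HasDerivAt P (modelPotential ς κ α Ψ l * Q l) l) :
    Q ∈ modelKernel ς κ α Ψ := by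
  have hs := contDiffOn_of_hasDerivAt_system (a := modelPotential ς κ α Ψ) (b := fun _ => 0)
    (contDiffOn_modelPotential hΨ) contDiffOn_const h1
    fun l hl => (h2 l hl).congr_deriv (by ring)
  refine ⟨hs.1, fun l hl => ?_⟩
  have e : deriv (deriv Q) l = deriv P l := by
    refine Filter.EventuallyEq.deriv_eq ?_
    filter_upwards [Ioi_mem_nhds hl] with y hy using (h1 y hy).deriv
  rw [e, (h2 l hl).deriv, modelPotential]
  ring

/-- The Wronskian of two solutions of `Q'' = U Q`, given with their derivatives, is constant. -/
theorem wronskian_const {I : Set ℝ} (hI : IsOpen I) (hI' : Convex ℝ I) {f f' g g' U : ℝ → ℂ}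
    (hf : ∀ x ∈ I, HasDerivAt f (f' x) x) (hf' : ∀ x ∈ I, HasDerivAt f' (U x * f x) x)
    (hg : ∀ x ∈ I, HasDerivAt g (g' x) x) (hg' : ∀ x ∈ I, HasDerivAt g' (U x * g x) x)
    {x y : ℝ} (hx : x ∈ I) (hy : y ∈ I) :
    f x * g' x - f' x * g x = f y * g' y - f' y * g y := by
  have := eq_of_hasDerivAt_eq hI hI' (f := fun x => f x * g' x - f' x * g x) (g := fun _ => 0)
    (f' := fun _ => 0) (fun z hz => ?_) (fun z _ => hasDerivAt_const z 0) hx hy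
  · simpa using this
  · refine (((hf z hz).mul (hg' z hz)).sub ((hf' z hz).mul (hg z hz))).congr_deriv ?_
    ring

/-- A solution with vanishing Cauchy data is zero. -/
theorem eq_zero_of_cauchy_data (hΨ : ContDiffOn ℝ ∞ Ψ (Ici 0)) (hQ : Q ∈ modelKernel ς κ α Ψ)
    {l₀ : ℝ} (hl₀ : 0 < l₀) (h0 : Q l₀ = 0) (h1 : deriv Q l₀ = 0) : ∀ l > (0 : ℝ), Q l = 0 := by
  intro l hl
  set a := min l l₀ / 2
  set b := max l l₀ + 1
  have ha : 0 < a := by positivity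
  have hU : ContinuousOn (modelPotential ς κ α Ψ) (Icc a b) :=
    (contDiffOn_modelPotential hΨ).continuousOn.mono fun x hx => ha.trans_le hx.1
  obtain ⟨C, hC⟩ := isCompact_Icc.exists_bound_of_continuousOn hU
  have hmem : ∀ x, x = l ∨ x = l₀ → x ∈ Ioo a b := by
    have h1 : min l l₀ ≤ l := min_le_left _ _
    have h2 : min l l₀ ≤ l₀ := min_le_right _ _
    have h3 : l ≤ max l l₀ := le_max_left _ _
    have h4 : l₀ ≤ max l l₀ := le_max_right _ _
    have h5 : 0 < min l l₀ := lt_min hl hl₀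
    rintro x (rfl | rfl) <;> constructor <;> simp only [a, b] <;> linarith
  have := ODE_solution_unique_of_mem_Ioo (E := ℂ × ℂ) (a := a) (b := b) (t₀ := l₀)
    (v := fun t p => (p.2, modelPotential ς κ α Ψ t * p.1)) (s := fun _ => univ)
    (K := max 1 (Real.toNNReal C)) (f := fun t => (Q t, deriv Q t)) (g := fun _ => 0)
    (fun t ht => by
      refine LipschitzWith.lipschitzOnWith (LipschitzWith.of_dist_le_mul fun p q => ?_)
      have hC' := hC t (Ioo_subset_Icc_self ht)
      have hC0 : 0 ≤ C := (norm_nonneg _).trans hC'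
      rw [Prod.dist_eq, dist_eq_norm, dist_eq_norm, ← mul_sub, norm_mul]
      simp only [NNReal.coe_max, NNReal.coe_one, Real.coe_toNNReal _ hC0]
      have e1 : ‖p.2 - q.2‖ ≤ dist p q := by
        rw [Prod.dist_eq, ← dist_eq_norm]; exact le_max_right _ _
      have e2 : ‖p.1 - q.1‖ ≤ dist p q := by
        rw [Prod.dist_eq, ← dist_eq_norm]; exact le_max_left _ _
      refine max_le ?_ ?_
      · refine e1.trans ?_
        have := mul_le_mul_of_nonneg_right (le_max_left 1 C) (dist_nonneg (x := p) (y := q))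
        linarith
      · exact mul_le_mul (hC'.trans (le_max_right _ _)) e2 (norm_nonneg _) (by positivity))
    (hmem l₀ (Or.inr rfl))
    (fun t ht => ⟨(hasDerivAt_of_mem_modelKernel hQ (ha.trans ht.1)).prodMk
      (hasDerivAt_deriv_of_mem_modelKernel hQ (ha.trans ht.1)), mem_univ _⟩)
    (fun t ht => ⟨by
      simpa only [Prod.snd_zero, Prod.fst_zero, mul_zero, Prod.mk_zero_zero] using
        hasDerivAt_const t (0 : ℂ × ℂ), mem_univ _⟩)
    (by simp [h0, h1]) (hmem l (Or.inl rfl))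
  simpa using congrArg Prod.fst this

/-- The solution `l ^ (1/2 + α) v` near `0` with the exponent of larger real part. -/
theorem exists_local_solution (hκ : -1 ≤ κ) (hα : 0 ≤ α.re) (hΨ : IsAdmissible κ Ψ) :
    ∃ ε > 0, ∃ v P : ℝ → ℂ, ContDiffOn ℝ ∞ v (Ici 0) ∧ v 0 = 1 ∧ (∀ x ∈ Ico 0 ε, v x ≠ 0) ∧
      P =O[𝓝[>] 0] (fun _ => (1 : ℝ)) ∧
      (∀ x ∈ Ioo 0 ε, HasDerivAt (fun l : ℝ => (l : ℂ) ^ (1 / 2 + α) * v l)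
        ((x : ℂ) ^ (-1 / 2 + α) * ((1 / 2 + α) * v x + x * P x)) x) ∧
      ∀ x ∈ Ioo 0 ε, HasDerivAt
        (fun x : ℝ => (x : ℂ) ^ (-1 / 2 + α) * ((1 / 2 + α) * v x + x * P x))
        (modelPotential ς κ α Ψ x * ((x : ℂ) ^ (1 / 2 + α) * v x)) x := by
  -- `l ^ 2` times the potential, without its constant part, is `l * B l`; this uses `Ψ 0 = 0` and
  -- `l ^ (κ + 2) = l * l ^ n`. Only the values of `B` near `0` matter, so `B` may be cut off
  obtain ⟨n, hn⟩ : ∃ n : ℕ, κ + 1 = n := ⟨(κ + 1).toNat, by omega⟩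
  obtain ⟨B₀, hB₀, hBe⟩ := exists_eq_add_mul hΨ.1
  rw [hΨ.2.1] at hBe
  obtain ⟨B, hB, hBB, hBz⟩ := exists_contDiffOn_Ici_eq (f := fun x : ℝ => B₀ x + ς * (x : ℂ) ^ n)
    one_pos ((hB₀.add (contDiffOn_const.mul (contDiffOn_ofReal.pow n))).mono Ico_subset_Ici_self)
  obtain ⟨M, hM⟩ := exists_bound_Ioc_of_continuousOn hB.continuousOn 1
  obtain ⟨v, P, hv, hv0, hvP, hP, hPO⟩ := exists_regular_solution (c := 1 + 2 * α) (by
      simp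
      linarith) hB (M := |M| + 1) (by positivity) (fun x hx => by
    rcases le_total x 1 with h | h
    · exact (hM x ⟨hx, h⟩).trans (by linarith [le_abs_self M])
    · rw [hBz x h]
      simp
      positivity)
  have hne : ∀ᶠ x in 𝓝[≥] (0 : ℝ), v x ≠ 0 := by
    exact (hv.continuousOn 0 self_mem_Ici).eventually_ne (b₂ := 0) (by simp [hv0])
  obtain ⟨ε, hε, hεv⟩ := mem_nhdsGE_iff_exists_Ico_subset.1 hne
  have hε : (0 : ℝ) < ε := hε
  refine ⟨min ε (1 / 3), by positivity, v, P, hv, hv0, fun x hx =>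
    hεv ⟨hx.1, hx.2.trans_le (min_le_left _ _)⟩, hPO, fun x hx => ?_, fun x hx => ?_⟩
  · have hx0 : (x : ℂ) ≠ 0 := by exact_mod_cast hx.1.ne'
    refine ((hasDerivAt_cpow_of_pos (1 / 2 + α) hx.1).mul (hvP x hx.1)).congr_deriv ?_
    rw [show 1 / 2 + α - 1 = -1 / 2 + α by ring, show 1 / 2 + α = -1 / 2 + α + 1 by ring,
      Complex.cpow_add (-1 / 2 + α) 1 hx0, Complex.cpow_one]
    ring
  · have hx0 : (x : ℂ) ≠ 0 := by exact_mod_cast hx.1.ne'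
    have h := (hasDerivAt_cpow_of_pos (-1 / 2 + α) hx.1).mul
      (((hvP x hx.1).const_mul (1 / 2 + α)).add
        ((hasDerivAt_id x).ofReal_comp.mul (hP x hx.1)))
    refine h.congr_deriv ?_
    have hx3 : x ∈ Icc 0 (1 / 3 : ℝ) := ⟨hx.1.le, hx.2.le.trans (min_le_right _ _)⟩
    have hκe : (x : ℂ) ^ κ = (x : ℂ) ^ n / x := by
      rw [show κ = (n : ℤ) - 1 by omega, zpow_sub₀ hx0, zpow_natCast, zpow_one]
    rw [hBB x hx3, modelPotential, hBe x hx.1.le, hκe,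
      show 1 / 2 + α = -1 / 2 + α - 1 + 1 + 1 by ring,
      Complex.cpow_add (-1 / 2 + α - 1 + 1) 1 hx0, Complex.cpow_add (-1 / 2 + α - 1) 1 hx0,
      Complex.cpow_one]
    have e : (x : ℂ) ^ (-1 / 2 + α) = (x : ℂ) ^ (-1 / 2 + α - 1) * x := by
      rw [Complex.cpow_sub _ 1 hx0, Complex.cpow_one, div_mul_cancel₀ _ hx0]
    rw [e]
    simp only [id, Complex.ofReal_one, Pi.add_apply, Pi.mul_apply]
    field_simp
    ring
end

section
variable {ς : ℝ} {κ : ℤ} {α : ℂ} {Ψ : ℝ → ℂ} {Q : ℝ → ℂ}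

/-- Reduction of order: near `0` every solution is the regular one times
`C - W ∫ (l ^ (1/2 + α) v) ^ (-2)`, where `W` is the Wronskian. -/
theorem exists_local_form (hκ : -1 ≤ κ) (hα : 0 ≤ α.re) (hΨ : IsAdmissible κ Ψ)
    (hQ : Q ∈ modelKernel ς κ α Ψ) :
    ∃ ε > 0, ∃ (v P s : ℝ → ℂ) (C W b : ℂ), ContDiffOn ℝ ∞ v (Ici 0) ∧ v 0 = 1 ∧
      P =O[𝓝[>] 0] (fun _ => (1 : ℝ)) ∧ ContDiffOn ℝ ∞ s (Ici 0) ∧ (b ≠ 0 → ∃ m : ℕ, 2 * α = m) ∧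
      (∀ x ∈ Ioo 0 ε, Q x = (x : ℂ) ^ (1 / 2 + α) * v x *
        (C - W * ((x : ℂ) ^ (-(2 * α)) * s x + b * (Real.log x : ℂ)))) ∧
      ∀ x ∈ Ioo 0 ε, W = Q x * ((x : ℂ) ^ (-1 / 2 + α) * ((1 / 2 + α) * v x + x * P x))
        - deriv Q x * ((x : ℂ) ^ (1 / 2 + α) * v x) := by
  obtain ⟨ε₀, hε₀, v, P, hv, hv0, hvne, hPO, hd1, hd2⟩ := exists_local_solution (ς := ς) hκ hα hΨ
  obtain ⟨w, hw, hwe, -⟩ := exists_contDiffOn_Ici_eq (f := fun x => (v x ^ 2)⁻¹) hε₀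
    (((hv.mono Ico_subset_Ici_self).pow 2).inv fun x hx => pow_ne_zero 2 (hvne x hx))
  obtain ⟨N, hN⟩ := exists_nat_gt ((2 * α).re + 1)
  obtain ⟨s, b, hs, hb, hH⟩ := exists_primitive_cpow_mul N hN hw
  set ε := ε₀ / 3 with hεdef
  have hε : 0 < ε := by positivity
  have hlt : ∀ x ∈ Ioo 0 ε, x ∈ Ioo 0 ε₀ := fun x hx => ⟨hx.1, hx.2.trans (by linarith)⟩
  have hx₁ : ε / 2 ∈ Ioo 0 ε := ⟨by positivity, by linarith⟩
  set q : ℝ → ℂ := fun x => (x : ℂ) ^ (1 / 2 + α) * v x with hq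
  set q' : ℝ → ℂ := fun x => (x : ℂ) ^ (-1 / 2 + α) * ((1 / 2 + α) * v x + x * P x) with hq'
  set W := Q (ε / 2) * q' (ε / 2) - deriv Q (ε / 2) * q (ε / 2) with hW
  -- `(Q / q)' = -W / q ^ 2`, and `q ^ (-2) = x ^ (-1 - 2 α) w`
  have hWc : ∀ x ∈ Ioo 0 ε, Q x * q' x - deriv Q x * q x = W := fun x hx =>
    wronskian_const isOpen_Ioo (convex_Ioo 0 ε) (U := modelPotential ς κ α Ψ)
      (fun y hy => hasDerivAt_of_mem_modelKernel hQ hy.1)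
      (fun y hy => hasDerivAt_deriv_of_mem_modelKernel hQ hy.1)
      (fun y hy => hd1 y (hlt y hy)) (fun y hy => hd2 y (hlt y hy)) hx hx₁
  have hqne : ∀ x ∈ Ioo 0 ε, q x ≠ 0 := fun x hx => by
    have hx0 : (x : ℂ) ≠ 0 := by exact_mod_cast hx.1.ne'
    exact mul_ne_zero (by simp [Complex.cpow_eq_zero_iff, hx0])
      (hvne x ⟨hx.1.le, (hlt x hx).2⟩)
  set H : ℝ → ℂ := fun x => (x : ℂ) ^ (-(2 * α)) * s x + b * (Real.log x : ℂ) with hHdef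
  have hratio : ∀ x ∈ Ioo 0 ε, HasDerivAt (fun y => Q y / q y)
      (-W * ((x : ℂ) ^ (-1 - 2 * α) * w x)) x := by
    intro x hx
    have hx0 : (x : ℂ) ≠ 0 := by exact_mod_cast hx.1.ne'
    refine ((hasDerivAt_of_mem_modelKernel hQ hx.1).div
      (show HasDerivAt q (q' x) x from hd1 x (hlt x hx)) (hqne x hx)).congr_deriv ?_
    have hvx := hvne x ⟨hx.1.le, (hlt x hx).2⟩
    have e : (x : ℂ) ^ (-1 - 2 * α) * w x = (q x ^ 2)⁻¹ := by
      rw [hwe x ⟨hx.1.le, hx.2.le⟩, hq]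
      simp only [mul_pow, mul_inv]
      congr 1
      rw [← Complex.cpow_nat_mul, ← Complex.cpow_neg]
      congr 1
      push_cast
      ring
    rw [e, ← hWc x hx]
    have := hqne x hx
    field_simp
    ring
  have hHd : ∀ x ∈ Ioo 0 ε, HasDerivAt (fun y => -W * H y)
      (-W * ((x : ℂ) ^ (-1 - 2 * α) * w x)) x := fun x hx => (hH x hx.1).const_mul _
  refine ⟨ε, hε, v, P, s, Q (ε / 2) / q (ε / 2) + W * H (ε / 2), W, b, hv, hv0, hPO, hs, hb,
    fun x hx => ?_, fun x hx => (hWc x hx).symm⟩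
  have h := eq_of_hasDerivAt_eq isOpen_Ioo (convex_Ioo 0 ε) hratio hHd hx hx₁
  have h2 : Q x / q x = Q (ε / 2) / q (ε / 2) + W * H (ε / 2) - W * H x := by
    linear_combination h
  change Q x = q x * _
  rw [← h2]
  have := hqne x hx
  field_simp

/-- Every solution is, near `0`, a combination of `x ^ (1/2 - α)`, `x ^ (1/2 + α)` and, if `2 α` is
an integer, `x ^ (1/2 + α) log x`, with smooth coefficients. -/
theorem exists_local_terms (hκ : -1 ≤ κ) (hα : 0 ≤ α.re) (hΨ : IsAdmissible κ Ψ)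
    (hQ : Q ∈ modelKernel ς κ α Ψ) :
    ∃ ε > 0, ∃ S₁ S₂ S₃ : ℝ → ℂ, ContDiffOn ℝ ∞ S₁ (Ici 0) ∧ ContDiffOn ℝ ∞ S₂ (Ici 0) ∧
      ContDiffOn ℝ ∞ S₃ (Ici 0) ∧ ((¬ ∃ m : ℤ, 2 * α = m) → S₃ = 0) ∧
      ∀ x ∈ Ioo 0 ε, Q x = (x : ℂ) ^ (1 / 2 - α) * S₁ x + (x : ℂ) ^ (1 / 2 + α) * S₂ x
        + (x : ℂ) ^ (1 / 2 + α) * (Real.log x : ℂ) * S₃ x := by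
  obtain ⟨ε, hε, v, P, s, C, W, b, hv, -, -, hs, hb, h, -⟩ := exists_local_form hκ hα hΨ hQ
  refine ⟨ε, hε, fun x => -W * (v x * s x), fun x => C * v x, fun x => -W * b * v x,
    contDiffOn_const.mul (hv.mul hs), contDiffOn_const.mul hv, contDiffOn_const.mul hv,
    fun hm => ?_, fun x hx => ?_⟩
  · have : b = 0 := by
      by_contra hb'
      obtain ⟨m, hm'⟩ := hb hb'
      exact hm ⟨m, by exact_mod_cast hm'⟩
    ext
    simp [this]
  · have hx0 : (x : ℂ) ≠ 0 := by exact_mod_cast hx.1.ne'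
    have e : (x : ℂ) ^ (1 / 2 - α) = (x : ℂ) ^ (1 / 2 + α) * (x : ℂ) ^ (-(2 * α)) := by
      rw [← Complex.cpow_add _ _ hx0]
      congr 1
      ring
    rw [h x hx, e]
    ring

/-- A solution that vanishes to infinite order at `0`, with its derivative, is zero. -/
theorem eq_zero_of_isBigO_pow (hκ : -1 ≤ κ) (hα : 0 ≤ α.re) (hΨ : IsAdmissible κ Ψ)
    (hQ : Q ∈ modelKernel ς κ α Ψ) (h0 : ∀ n : ℕ, Q =O[𝓝[>] 0] (fun x : ℝ => x ^ n))
    (h1 : ∀ n : ℕ, deriv Q =O[𝓝[>] 0] (fun x : ℝ => x ^ n)) : ∀ l > (0 : ℝ), Q l = 0 := by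
  obtain ⟨ε, hε, v, P, s, C, W, b, hv, hv0, hP, hs, hb, h, hW⟩ := exists_local_form hκ hα hΨ hQ
  have hvlim : Tendsto v (𝓝[>] 0) (𝓝 1) := by
    rw [← hv0]
    exact (hv.continuousOn 0 self_mem_Ici).mono_left (nhdsWithin_mono _ Ioi_subset_Ici_self)
  have hvO : v =O[𝓝[>] 0] (fun _ => (1 : ℝ)) := hvlim.isBigO_one ℝ
  have hxO : (fun x : ℝ => (x : ℂ)) =O[𝓝[>] 0] (fun _ => (1 : ℝ)) := by
    have : Tendsto (fun x : ℝ => (x : ℂ)) (𝓝[>] 0) (𝓝 ((0 : ℝ) : ℂ)) :=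
      (Complex.continuous_ofReal.tendsto 0).mono_left inf_le_left
    exact this.isBigO_one ℝ
  have hxP : (fun x : ℝ => (x : ℂ) * P x) =O[𝓝[>] 0] (fun _ => (1 : ℝ)) := by
    simpa only [mul_one] using hxO.mul hP
  have key : ∀ (c : ℂ) (f : ℝ → ℂ), (∀ n : ℕ, f =O[𝓝[>] 0] (fun x : ℝ => x ^ n)) →
      Tendsto (fun x : ℝ => (x : ℂ) ^ c * f x) (𝓝[>] 0) (𝓝 0) := by
    intro c f hf
    obtain ⟨n, hn⟩ := exists_nat_gt (-c.re)
    have h2 : (fun x : ℝ => (x : ℂ) ^ (-(n : ℂ)) * f x) =O[𝓝[>] 0] (fun _ => (1 : ℝ)) := by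
      refine ((Asymptotics.isBigO_refl (fun x : ℝ => (x : ℂ) ^ (-(n : ℂ))) _).norm_right.mul
        (hf n)).trans (Asymptotics.IsBigO.of_bound 1 ?_)
      filter_upwards [self_mem_nhdsWithin] with x hx
      have hx : (0 : ℝ) < x := hx
      rw [norm_mul, Complex.norm_cpow_eq_rpow_re_of_pos hx]
      simp [Real.rpow_neg hx.le, abs_of_pos hx, hx.ne']
    refine (isBigO_one_mul_tendsto_zero (tendsto_cpow_zero (c := c + n)
      (by simp; linarith)) h2).congr' ?_
    filter_upwards [self_mem_nhdsWithin] with x hx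
    have hx0 : (x : ℂ) ≠ 0 := by exact_mod_cast (ne_of_gt hx)
    rw [← mul_assoc, ← Complex.cpow_add _ _ hx0]
    congr 2
    ring
  have hev : ∀ᶠ x in 𝓝[>] (0 : ℝ), x ∈ Ioo 0 ε := Ioo_mem_nhdsGT hε
  -- the Wronskian with the regular solution tends to `0`, and it is constant
  have hW0 : W = 0 := by
    have t1 := isBigO_one_mul_tendsto_zero (key (-1 / 2 + α) Q h0)
      ((hvO.const_mul_left (1 / 2 + α)).add hxP)
    have t2 := isBigO_one_mul_tendsto_zero (key (1 / 2 + α) (deriv Q) h1) hvO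
    have t3 := t1.sub t2
    rw [sub_zero] at t3
    refine tendsto_nhds_unique (tendsto_const_nhds.congr' ?_) t3
    filter_upwards [hev] with x hx
    rw [hW x hx]
    ring
  have hC0 : C = 0 := by
    have t1 := key (-(1 / 2 + α)) Q h0
    have t2 : Tendsto (fun x => C * v x) (𝓝[>] 0) (𝓝 (C * 1)) := hvlim.const_mul C
    rw [mul_one] at t2
    refine tendsto_nhds_unique t2 (t1.congr' ?_)
    filter_upwards [hev] with x hx
    have hx0 : (x : ℂ) ≠ 0 := by exact_mod_cast hx.1.ne'
    have hc : (x : ℂ) ^ (1 / 2 + α) ≠ 0 := by simp [Complex.cpow_eq_zero_iff, hx0]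
    rw [h x hx, hW0, Complex.cpow_neg]
    generalize (x : ℂ) ^ (1 / 2 + α) = y at hc ⊢
    field_simp
    ring
  have hz : ∀ x ∈ Ioo 0 ε, Q x = 0 := fun x hx => by rw [h x hx, hW0, hC0]; simp
  have hm : ε / 2 ∈ Ioo 0 ε := ⟨by positivity, by linarith⟩
  refine eq_zero_of_cauchy_data hΨ.1 hQ hm.1 (hz _ hm) ?_
  have : Q =ᶠ[𝓝 (ε / 2)] fun _ => 0 := by
    filter_upwards [isOpen_Ioo.mem_nhds hm] with x hx using hz x hx
  rw [this.deriv_eq, deriv_const]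

/-- Two solutions with vanishing Wronskian are proportional. -/
theorem eq_const_mul_of_wronskian_eq_zero (hΨ : ContDiffOn ℝ ∞ Ψ (Ici 0))
    (hQ : Q ∈ modelKernel ς κ α Ψ) {R : ℝ → ℂ} (hR : R ∈ modelKernel ς κ α Ψ) {l₀ : ℝ}
    (hl₀ : 0 < l₀) (hR0 : R l₀ ≠ 0) (hW : Q l₀ * deriv R l₀ - deriv Q l₀ * R l₀ = 0) :
    ∃ c : ℂ, ∀ l > (0 : ℝ), Q l = c * R l := by
  set c := Q l₀ / R l₀
  have hd : ∀ l > (0 : ℝ), HasDerivAt (fun l => Q l - c * R l) (deriv Q l - c * deriv R l) l :=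
    fun l hl => (hasDerivAt_of_mem_modelKernel hQ hl).sub
      ((hasDerivAt_of_mem_modelKernel hR hl).const_mul c)
  have hmem : (fun l => Q l - c * R l) ∈ modelKernel ς κ α Ψ :=
    mem_modelKernel_of_hasDerivAt hΨ hd fun l hl =>
      ((hasDerivAt_deriv_of_mem_modelKernel hQ hl).sub
        ((hasDerivAt_deriv_of_mem_modelKernel hR hl).const_mul c)).congr_deriv (by ring)
  refine ⟨c, fun l hl => sub_eq_zero.1 (eq_zero_of_cauchy_data hΨ hmem hl₀ ?_ ?_ l hl)⟩
  · simp only [c]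
    field_simp
    ring
  · rw [(hd l₀ hl₀).deriv]
    simp only [c]
    field_simp
    linear_combination -hW
end

/-! ### An irregular singular equation of second order -/

theorem hasDerivAt_cexp_div (τ : ℂ) {y : ℝ} (hy : 0 < y) :
    HasDerivAt (fun y : ℝ => Complex.exp (2 * τ / y))
      (Complex.exp (2 * τ / y) * (-(2 * τ) / (y : ℂ) ^ 2)) y := by
  have hy0 : (y : ℂ) ≠ 0 := by exact_mod_cast hy.ne'
  have h : HasDerivAt (fun y : ℝ => 2 * τ / (y : ℂ)) (-(2 * τ) / (y : ℂ) ^ 2) y := by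
    refine (((hasDerivAt_id y).ofReal_comp.inv hy0).const_mul (2 * τ)).congr_deriv ?_
    simp
    field_simp
  exact h.cexp

theorem norm_cexp_div (τ : ℂ) (y : ℝ) :
    ‖Complex.exp (2 * τ / y)‖ = Real.exp (2 * τ.re / y) := by
  rw [Complex.norm_exp]
  congr 1
  rw [Complex.div_ofReal_re]
  simp

section
variable {P P' h : ℝ → ℂ} {τ : ℂ} {m : ℕ}

/-- The factor `y ^ m exp (2 τ / y)` turns `y ^ 2 P' + ((m + 2) y - 2 τ) P` into a derivative. -/
theorem hasDerivAt_integrating_factor {y : ℝ} (hy : 0 < y) (hP : HasDerivAt P (P' y) y)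
    (hE : (y : ℂ) ^ 2 * P' y + ((m + 2) * y - 2 * τ) * P y = h y) :
    HasDerivAt (fun y : ℝ => (y : ℂ) ^ (m + 2) * Complex.exp (2 * τ / y) * P y)
      ((y : ℂ) ^ m * Complex.exp (2 * τ / y) * h y) y := by
  have hy0 : (y : ℂ) ≠ 0 := by exact_mod_cast hy.ne'
  have h1 : HasDerivAt (fun y : ℝ => (y : ℂ) ^ (m + 2)) ((m + 2) * (y : ℂ) ^ (m + 1)) y := by
    refine ((hasDerivAt_id y).ofReal_comp.pow (m + 2)).congr_deriv ?_
    simp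
  refine ((h1.mul (hasDerivAt_cexp_div τ hy)).mul hP).congr_deriv ?_
  rw [← hE]
  simp only [Pi.mul_apply]
  field_simp
  ring

/-- For `Re τ ≤ 0`, the solution of `x ^ 2 P' + (c x - 2 τ) P = h` that is `o(x ^ (-c))` at `0` is
smaller than `h / x`. -/
theorem mul_isBigO_of_re_nonpos (hτ : τ.re ≤ 0) (hP : ∀ y > (0 : ℝ), HasDerivAt P (P' y) y)
    (hE : ∀ y > (0 : ℝ), (y : ℂ) ^ 2 * P' y + ((m + 2) * y - 2 * τ) * P y = h y)
    (h0 : Tendsto (fun y : ℝ => (y : ℂ) ^ (m + 2) * P y) (𝓝[>] 0) (𝓝 0)) (n : ℕ)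
    (hh : h =O[𝓝[>] 0] (fun x : ℝ => x ^ n)) :
    (fun x : ℝ => (x : ℂ) * P x) =O[𝓝[>] 0] (fun x : ℝ => x ^ n) := by
  obtain ⟨M, hM⟩ := hh.bound
  refine Asymptotics.IsBigO.of_bound |M| ?_
  filter_upwards [eventually_forall_Ioc hM, self_mem_nhdsWithin] with x hx hx0
  have hx0 : (0 : ℝ) < x := hx0
  -- `exp (2 Re τ / y)` increases with `y`, so that its value at `x` bounds it on `(0, x]` and
  -- cancels in the end
  set A := Real.exp (2 * τ.re / x) with hA
  have hexp : ∀ y ∈ Ioc 0 x, Real.exp (2 * τ.re / y) ≤ A := fun y hy => by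
    refine Real.exp_le_exp.2 ?_
    rw [div_le_div_iff₀ hy.1 hx0]
    nlinarith [hy.2]
  have key := norm_le_of_norm_deriv_le_of_tendsto_zero hx0
    (fun y hy => hasDerivAt_integrating_factor hy.1 (hP y hy.1) (hE y hy.1))
    (B := fun y => A * |M| * y ^ (m + n + 1)) (B' := fun y => A * |M| * ((m + n + 1 : ℕ) * y ^ (m
        + n)))
    (fun y hy => by simpa using (hasDerivAt_pow (m + n + 1) y).const_mul (A * |M|))
    (fun y hy => by have := hy.1; positivity)
    (fun y hy => by
      have hy1 := hy.1
      have h3 : ‖h y‖ ≤ |M| * y ^ n := by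
        refine (hx y hy).trans ?_
        rw [Real.norm_of_nonneg (by positivity)]
        exact mul_le_mul_of_nonneg_right (le_abs_self M) (by positivity)
      rw [norm_mul, norm_mul, norm_cexp_div, norm_pow, Complex.norm_of_nonneg hy.1.le]
      calc y ^ m * Real.exp (2 * τ.re / y) * ‖h y‖ ≤ y ^ m * A * (|M| * y ^ n) := by
            have := hexp y hy
            gcongr
        _ = A * |M| * (1 * y ^ (m + n)) := by ring
        _ ≤ A * |M| * ((m + n + 1 : ℕ) * y ^ (m + n)) := by
            gcongr
            exact_mod_cast Nat.le_add_left 1 (m + n))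
    (by
      rw [tendsto_zero_iff_norm_tendsto_zero] at h0 ⊢
      refine squeeze_zero' (Eventually.of_forall fun _ => norm_nonneg _) ?_ h0
      filter_upwards [self_mem_nhdsWithin] with y hy
      have hy : (0 : ℝ) < y := hy
      have : Real.exp (2 * τ.re / y) ≤ 1 := Real.exp_le_one_iff.2
        (div_nonpos_of_nonpos_of_nonneg (by linarith) hy.le)
      rw [norm_mul, norm_mul, norm_mul, norm_cexp_div]
      refine mul_le_mul_of_nonneg_right ?_ (norm_nonneg _)
      exact mul_le_of_le_one_right (norm_nonneg _) this)
  rw [norm_mul, norm_mul, norm_cexp_div, ← hA, norm_pow, Complex.norm_of_nonneg hx0.le] at key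
  rw [norm_mul, Complex.norm_of_nonneg hx0.le, Real.norm_of_nonneg (by positivity)]
  have hpos : 0 < A * x ^ (m + 1) := by positivity
  refine le_of_mul_le_mul_left ?_ hpos
  calc A * x ^ (m + 1) * (x * ‖P x‖) = x ^ (m + 2) * A * ‖P x‖ := by ring
    _ ≤ _ := key
    _ = _ := by ring

/-- For `τ > 0`, solutions of `x ^ 2 P' + (c x - 2 τ) P = h` stay bounded on the way to `0`. -/
theorem norm_le_of_pos {t : ℝ} (ht : 0 < t) {x x₀ M : ℝ} (hx : 0 < x) (hxx : x ≤ x₀)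
    (hx₀ : (m + 2) * x₀ ≤ t) (hP : ∀ y ∈ Icc x x₀, HasDerivAt P (P' y) y)
    (hE : ∀ y ∈ Icc x x₀, (y : ℂ) ^ 2 * P' y + ((m + 2) * y - 2 * (t : ℂ)) * P y = h y)
    (hM : ∀ y ∈ Icc x x₀, ‖h y‖ ≤ M) : ‖P x‖ ≤ M / t + ‖P x₀‖ := by
  have hM0 : 0 ≤ M := (norm_nonneg _).trans (hM x ⟨le_rfl, hxx⟩)
  -- comparison with `K` times the integrating factor, which decreases on `(0, x₀]`
  set K := M / t + ‖P x₀‖ with hK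
  have hKM : M ≤ K * t := by
    rw [hK, add_mul, div_mul_cancel₀ _ ht.ne']
    have : 0 ≤ ‖P x₀‖ * t := by positivity
    linarith
  have hK0 : 0 ≤ K := by positivity
  have key := norm_sub_le_sub_of_norm_deriv_le hxx
    (fun y hy => hasDerivAt_integrating_factor (hx.trans_le hy.1) (hP y hy) (hE y hy))
    (B := fun y => -(K * (y ^ (m + 2) * Real.exp (2 * t / y))))
    (B' := fun y => K * (y ^ m * Real.exp (2 * t / y) * (2 * t - (m + 2) * y)))
    (fun y hy => by
      have hy0 : y ≠ 0 := (hx.trans_le hy.1).ne'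
      have h1 : HasDerivAt (fun y : ℝ => 2 * t / y) (-(2 * t) / y ^ 2) y := by
        refine ((hasDerivAt_inv hy0).const_mul (2 * t)).congr_deriv ?_
        field_simp
      refine ((((hasDerivAt_pow (m + 2) y).mul h1.exp).const_mul K).neg).congr_deriv ?_
      push_cast
      field_simp
      ring_nf)
    (fun y hy => by
      have hy0 : 0 < y := hx.trans_le hy.1
      have h1 : (m + 2) * y ≤ t := (mul_le_mul_of_nonneg_left hy.2 (by positivity)).trans hx₀
      rw [norm_mul, norm_mul, norm_cexp_div, norm_pow, Complex.norm_of_nonneg hy0.le,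
        Complex.ofReal_re]
      calc y ^ m * Real.exp (2 * t / y) * ‖h y‖ ≤ y ^ m * Real.exp (2 * t / y) * (K * t) := by
            have := (hM y hy).trans hKM
            gcongr
        _ = K * (y ^ m * Real.exp (2 * t / y) * t) := by ring
        _ ≤ _ := by
            gcongr
            linarith)
  have hn : ∀ y > (0 : ℝ), ‖(y : ℂ) ^ (m + 2) * Complex.exp (2 * (t : ℂ) / y) * P y‖
      = y ^ (m + 2) * Real.exp (2 * t / y) * ‖P y‖ := fun y hy => by
    rw [norm_mul, norm_mul, norm_cexp_div, norm_pow, Complex.norm_of_nonneg hy.le,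
      Complex.ofReal_re]
  have hx₀0 : 0 < x₀ := hx.trans_le hxx
  have h1 := norm_sub_norm_le ((x : ℂ) ^ (m + 2) * Complex.exp (2 * (t : ℂ) / x) * P x)
    ((x₀ : ℂ) ^ (m + 2) * Complex.exp (2 * (t : ℂ) / x₀) * P x₀)
  rw [norm_sub_rev, hn x hx, hn x₀ hx₀0] at h1
  have h2 : x₀ ^ (m + 2) * Real.exp (2 * t / x₀) * ‖P x₀‖
      ≤ x₀ ^ (m + 2) * Real.exp (2 * t / x₀) * K := by
    have : ‖P x₀‖ ≤ K := by rw [hK]; have : 0 ≤ M / t := by positivity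
                            linarith
    gcongr
  have hpos : 0 < x ^ (m + 2) * Real.exp (2 * t / x) := by positivity
  refine le_of_mul_le_mul_left ?_ hpos
  linarith

end

section
variable {q Γ : ℝ → ℂ} {τ : ℂ}

/-- The differentiated equation. -/
theorem iteratedDeriv_irregular (hq : ContDiffOn ℝ ∞ q (Ioi 0)) (hΓ : ContDiffOn ℝ ∞ Γ (Ioi 0))
    (hE : ∀ x > (0 : ℝ), (x : ℂ) ^ 2 * deriv (deriv q) x + (2 * x - 2 * τ) * deriv q x
      = Γ x * q x) (k : ℕ) : ∀ x > (0 : ℝ), (x : ℂ) ^ 2 * iteratedDeriv (k + 2) q x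
      + (((2 * k : ℕ) + 2) * x - 2 * τ) * iteratedDeriv (k + 1) q x
      = iteratedDeriv k (fun x => Γ x * q x) x - k * (k + 1) * iteratedDeriv k q x := by
  induction k with
  | zero =>
    intro x hx
    have := hE x hx
    simp only [iteratedDeriv_succ, iteratedDeriv_zero]
    simpa using this
  | succ k ih =>
    intro x hx
    have hΓq : ContDiffOn ℝ ∞ (fun x => Γ x * q x) (Ioi 0) := hΓ.mul hq
    have hx1 : HasDerivAt (fun y : ℝ => (y : ℂ)) 1 x := (hasDerivAt_id x).ofReal_comp
    have h1 := ((hx1.pow 2).mul (hasDerivAt_iteratedDeriv hq (k + 2) hx)).add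
      (((hx1.const_mul (((2 * k : ℕ) : ℂ) + 2)).sub_const (2 * τ)).mul
        (hasDerivAt_iteratedDeriv hq (k + 1) hx))
    have h2 := (hasDerivAt_iteratedDeriv hΓq k hx).sub
      ((hasDerivAt_iteratedDeriv hq k hx).const_mul ((k : ℂ) * (k + 1)))
    have h3 := h2.congr_of_eventuallyEq (f₁ := (fun y : ℝ => (y : ℂ)) ^ 2 * iteratedDeriv (k + 2)
        q +
      (fun y : ℝ => (((2 * k : ℕ) : ℂ) + 2) * (y : ℂ) - 2 * τ) * iteratedDeriv (k + 1) q) (by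
        filter_upwards [Ioi_mem_nhds hx] with y hy
        simpa using ih y hy)
    have e := h1.unique h3
    simp only [Pi.pow_apply] at e
    push_cast at e ⊢
    linear_combination e

/-- Smoothness at `0` by induction on the number of bounded derivatives. -/
theorem exists_smooth_of_derivs_isBigO (hq : ContDiffOn ℝ ∞ q (Ioi 0))
    (h0 : q =O[𝓝[>] 0] (fun _ => (1 : ℝ)))
    (hstep : ∀ k, (∀ j ≤ k, iteratedDeriv j q =O[𝓝[>] 0] (fun _ => (1 : ℝ))) →
      iteratedDeriv (k + 1) q =O[𝓝[>] 0] (fun _ => (1 : ℝ))) :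
    ∃ F : ℝ → ℂ, ContDiffOn ℝ ∞ F (Ici 0) ∧ ∀ x > 0, F x = q x := by
  have : ∀ k, ∀ j ≤ k, iteratedDeriv j q =O[𝓝[>] 0] (fun _ => (1 : ℝ)) := by
    intro k
    induction k with
    | zero => intro j hj; obtain rfl : j = 0 := by omega
              simpa using h0
    | succ k ih =>
      intro j hj
      rcases Nat.lt_or_ge j (k + 1) with h | h
      · exact ih j (by omega)
      · obtain rfl : j = k + 1 := by omega
        exact hstep k ih
  exact exists_contDiffOn_Ici hq fun k => this k k le_rfl

/-- The right-hand side of the `k` times differentiated equation only involves derivatives of `q` of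
order at most `k`. -/
theorem iteratedDeriv_rhs_isBigO (hq : ContDiffOn ℝ ∞ q (Ioi 0)) (hΓ : ContDiffOn ℝ ∞ Γ (Ici 0))
    (k : ℕ) (hb : ∀ j ≤ k, iteratedDeriv j q =O[𝓝[>] 0] (fun _ => (1 : ℝ))) :
    (fun x => iteratedDeriv k (fun x => Γ x * q x) x - k * (k + 1) * iteratedDeriv k q x)
      =O[𝓝[>] 0] (fun _ => (1 : ℝ)) := by
  refine Asymptotics.IsBigO.sub ?_ ((hb k le_rfl).const_mul_left _)
  simpa using iteratedDeriv_mul_isBigO hΓ hq (w := fun _ => 1) (k := k) fun n hn => by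
    simpa using hb n hn

/-- For `τ > 0`, every solution is smooth up to the irregular singular point. -/
theorem exists_smooth_of_pos {t : ℝ} (ht : 0 < t) (hq : ContDiffOn ℝ ∞ q (Ioi 0))
    (hΓ : ContDiffOn ℝ ∞ Γ (Ici 0))
    (hE : ∀ x > (0 : ℝ), (x : ℂ) ^ 2 * deriv (deriv q) x + (2 * x - 2 * (t : ℂ)) * deriv q x
      = Γ x * q x) : ∃ F : ℝ → ℂ, ContDiffOn ℝ ∞ F (Ici 0) ∧ ∀ x > 0, F x = q x := by
  have hEk := iteratedDeriv_irregular hq (hΓ.mono Ioi_subset_Ici_self) hE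
  refine exists_smooth_of_derivs_isBigO hq ?_ fun k hk => ?_
  · obtain ⟨M₀, hM₀⟩ := exists_bound_Ioc_of_continuousOn hΓ.continuousOn 1
    -- boundedness of `q`: the bound for `q'` in terms of the maximum of `q` on `[x, x₀]` may be
    -- absorbed, as `x₀` is small and independent of `x`
    set M := |M₀| + 1
    have hMpos : 0 < M := by positivity
    set x₀ := min 1 (min (t / 2) (t / (2 * M))) with hx₀def
    have hx₀ : 0 < x₀ := by positivity
    have hx₀1 : x₀ ≤ 1 := min_le_left _ _
    have hx₀2 : x₀ ≤ t / 2 := (min_le_right _ _).trans (min_le_left _ _)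
    have hx₀3 : x₀ * (M / t) ≤ 1 / 2 := by
      have : x₀ ≤ t / (2 * M) := (min_le_right _ _).trans (min_le_right _ _)
      calc x₀ * (M / t) ≤ t / (2 * M) * (M / t) := by gcongr
        _ = 1 / 2 := by field_simp
    refine Asymptotics.IsBigO.of_bound (2 * (‖q x₀‖ + x₀ * ‖deriv q x₀‖)) ?_
    filter_upwards [Ioo_mem_nhdsGT hx₀] with x hx
    simp only [norm_one, mul_one]
    have hpos : ∀ y ∈ Icc x x₀, 0 < y := fun y hy => hx.1.trans_le hy.1
    obtain ⟨z, hz, hmax⟩ := isCompact_Icc.exists_isMaxOn (nonempty_Icc.2 hx.2.le)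
      ((hq.continuousOn.mono hpos).norm)
    have hmax' : ∀ y ∈ Icc x x₀, ‖q y‖ ≤ ‖q z‖ := fun y hy => hmax hy
    have hPb : ∀ y ∈ Icc x x₀, ‖deriv q y‖ ≤ M * ‖q z‖ / t + ‖deriv q x₀‖ := by
      intro y hy
      refine norm_le_of_pos (m := 0) ht (hpos y hy) hy.2 (by simp; linarith)
        (P' := deriv (deriv q)) (h := fun x => Γ x * q x) (fun w hw => ?_) (fun w hw => ?_)
        (fun w hw => ?_)
      · exact hasDerivAt_of_contDiffOn_Ioi ((contDiffOn_infty_iff_deriv_of_isOpen isOpen_Ioi).1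
            hq).2
          (hpos w ⟨hy.1.trans hw.1, hw.2⟩)
      · simpa using hE w (hpos w ⟨hy.1.trans hw.1, hw.2⟩)
      · have hw' : w ∈ Icc x x₀ := ⟨hy.1.trans hw.1, hw.2⟩
        rw [norm_mul]
        refine mul_le_mul ?_ (hmax' w hw') (norm_nonneg _) hMpos.le
        exact (hM₀ w ⟨(hpos w hw').le, hw.2.trans hx₀1⟩).trans
          ((le_abs_self _).trans (le_add_of_nonneg_right one_pos.le))
    have hmv := Convex.norm_image_sub_le_of_norm_deriv_le (𝕜 := ℝ) (f := q) (x := x₀) (y := z)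
      (fun y hy => (hasDerivAt_of_contDiffOn_Ioi hq (hpos y hy)).differentiableAt) hPb
      (convex_Icc x x₀) ⟨hx.2.le, le_rfl⟩ hz
    have hzd : ‖z - x₀‖ ≤ x₀ := by
      rw [Real.norm_eq_abs, abs_le]
      constructor <;> linarith [hz.1, hz.2, hx.1]
    have h1 : ‖q z‖ ≤ ‖q x₀‖ + ‖q z - q x₀‖ := by
      have := norm_add_le (q x₀) (q z - q x₀)
      simpa using this
    have h2 : ‖q z - q x₀‖ ≤ (M * ‖q z‖ / t + ‖deriv q x₀‖) * x₀ :=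
      hmv.trans (mul_le_mul_of_nonneg_left hzd (by positivity))
    have h3 : (M * ‖q z‖ / t) * x₀ ≤ 1 / 2 * ‖q z‖ := by
      calc (M * ‖q z‖ / t) * x₀ = x₀ * (M / t) * ‖q z‖ := by ring
        _ ≤ _ := by gcongr
    have h4 := hmax' x ⟨le_rfl, hx.2.le⟩
    linarith
  · obtain ⟨M, hM⟩ := (iteratedDeriv_rhs_isBigO hq hΓ k hk).bound
    obtain ⟨ε, hε, hsub⟩ := mem_nhdsGT_iff_exists_Ioo_subset.1 hM
    have hε : (0 : ℝ) < ε := hε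
    have hc : (0 : ℝ) < ((2 * k : ℕ) : ℝ) + 2 := by positivity
    -- the bound for solutions needs `(2 k + 2) x₀ ≤ t`
    set x₀ := min (ε / 2) (t / (((2 * k : ℕ) : ℝ) + 2))
    have hx₀ : 0 < x₀ := by positivity
    have hx₀1 : x₀ < ε := (min_le_left _ _).trans_lt (by linarith)
    refine Asymptotics.IsBigO.of_bound (M / t + ‖iteratedDeriv (k + 1) q x₀‖) ?_
    filter_upwards [Ioo_mem_nhdsGT hx₀] with x hx
    simp only [norm_one, mul_one]
    refine norm_le_of_pos (m := 2 * k) ht hx.1 hx.2.le ?_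
      (fun y hy => hasDerivAt_iteratedDeriv hq (k + 1) (hx.1.trans_le hy.1))
      (fun y hy => hEk k y (hx.1.trans_le hy.1)) fun y hy => ?_
    · have : x₀ ≤ t / (((2 * k : ℕ) : ℝ) + 2) := min_le_right _ _
      rwa [le_div_iff₀ hc, mul_comm] at this
    · simpa using hsub (show y ∈ Ioo 0 ε from ⟨hx.1.trans_le hy.1, hy.2.trans_lt hx₀1⟩)

end

section
variable {q Γ : ℝ → ℂ} {τ : ℂ}

theorem isBigO_ofReal_one : (fun x : ℝ => (x : ℂ)) =O[𝓝[>] 0] (fun _ => (1 : ℝ)) := by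
  have : Tendsto (fun x : ℝ => (x : ℂ)) (𝓝[>] 0) (𝓝 ((0 : ℝ) : ℂ)) :=
    (Complex.continuous_ofReal.tendsto 0).mono_left inf_le_left
  exact this.isBigO_one ℝ

theorem tendsto_ofReal_pow_zero {n : ℕ} (hn : n ≠ 0) :
    Tendsto (fun x : ℝ => (x : ℂ) ^ n) (𝓝[>] 0) (𝓝 0) := by
  have : Tendsto (fun x : ℝ => (x : ℂ) ^ n) (𝓝[>] 0) (𝓝 (((0 : ℝ) : ℂ) ^ n)) :=
    ((Complex.continuous_ofReal.pow n).tendsto 0).mono_left inf_le_left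
  simpa [hn] using this

/-- For `Re τ ≤ 0`, the solutions whose derivative is `O(1 / x)` are smooth up to the irregular
singular point. Subtracting from each derivative the first term of its formal expansion gains the
power of `x` which the direct estimate loses. -/
theorem exists_smooth_of_re_nonpos (hτ : τ.re ≤ 0) (hτ0 : τ ≠ 0) (hq : ContDiffOn ℝ ∞ q (Ioi 0))
    (hΓ : ContDiffOn ℝ ∞ Γ (Ici 0))
    (hE : ∀ x > (0 : ℝ), (x : ℂ) ^ 2 * deriv (deriv q) x + (2 * x - 2 * τ) * deriv q x
      = Γ x * q x) (h0 : q =O[𝓝[>] 0] (fun _ => (1 : ℝ)))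
    (h1 : (fun x : ℝ => (x : ℂ) * deriv q x) =O[𝓝[>] 0] (fun _ => (1 : ℝ))) :
    ∃ F : ℝ → ℂ, ContDiffOn ℝ ∞ F (Ici 0) ∧ ∀ x > 0, F x = q x := by
  have hΓ' := hΓ.mono Ioi_subset_Ici_self
  have hEk := iteratedDeriv_irregular hq hΓ' hE
  have hΓq : ContDiffOn ℝ ∞ (fun x => Γ x * q x) (Ioi 0) := hΓ'.mul hq
  refine exists_smooth_of_derivs_isBigO hq h0 fun k hk => ?_
  have hg := iteratedDeriv_rhs_isBigO hq hΓ k hk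
  set g : ℝ → ℂ := fun x => iteratedDeriv k (fun x => Γ x * q x) x
    - k * (k + 1) * iteratedDeriv k q x with hgdef
  set g' : ℝ → ℂ := fun x => iteratedDeriv (k + 1) (fun x => Γ x * q x) x
    - k * (k + 1) * iteratedDeriv (k + 1) q x with hg'def
  have hgd : ∀ x > (0 : ℝ), HasDerivAt g (g' x) x := fun x hx =>
    (hasDerivAt_iteratedDeriv hΓq k hx).sub ((hasDerivAt_iteratedDeriv hq k hx).const_mul _)
  -- the condition at `0` that singles out the solution; for `k > 0` the equation one order below
  -- gives it
  have hlim : Tendsto (fun y : ℝ => (y : ℂ) ^ (2 * k + 2) * iteratedDeriv (k + 1) q y)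
      (𝓝[>] 0) (𝓝 0) := by
    rcases Nat.eq_zero_or_pos k with rfl | hkpos
    · refine (isBigO_one_mul_tendsto_zero (tendsto_ofReal_pow_zero one_ne_zero) h1).congr
        fun x => ?_
      simp [iteratedDeriv_one]
      ring
    · obtain ⟨i, rfl⟩ : ∃ i, k = i + 1 := ⟨k - 1, by omega⟩
      have hb : (fun x : ℝ => (x : ℂ) ^ 2 * iteratedDeriv (i + 2) q x)
          =O[𝓝[>] 0] (fun _ => (1 : ℝ)) := by
        have hA := iteratedDeriv_rhs_isBigO hq hΓ i fun j hj => hk j (by omega)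
        have hB := (((isBigO_ofReal_one.const_mul_left (((2 * i : ℕ) : ℂ) + 2)).sub
          (Asymptotics.isBigO_const_const (2 * τ) (one_ne_zero (α := ℝ)) (𝓝[>] 0)))).mul
          (hk (i + 1) le_rfl)
        simp only [mul_one] at hB
        refine (hA.sub hB).congr' ?_ EventuallyEq.rfl
        filter_upwards [self_mem_nhdsWithin] with x hx
        rw [← hEk i x hx]
        ring
      refine (isBigO_one_mul_tendsto_zero
        (tendsto_ofReal_pow_zero (n := 2 * (i + 1)) (by omega)) hb).congr fun x => ?_
      ring
  have hPd : ∀ y > (0 : ℝ), HasDerivAt (iteratedDeriv (k + 1) q) (iteratedDeriv (k + 2) q y) y :=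
    fun y hy => hasDerivAt_iteratedDeriv hq (k + 1) hy
  have hxP : (fun x : ℝ => (x : ℂ) * iteratedDeriv (k + 1) q x) =O[𝓝[>] 0] (fun _ => (1 : ℝ)) := by
    simpa using mul_isBigO_of_re_nonpos (m := 2 * k) (h := g) hτ hPd (hEk k) hlim 0 (by simpa
        using hg)
  have hxg' : (fun x : ℝ => (x : ℂ) * g' x) =O[𝓝[>] 0] (fun _ => (1 : ℝ)) := by
    have hA := iteratedDeriv_mul_isBigO hΓ hq (w := fun x => x) (k := k + 1) fun j hj => by
      rcases Nat.lt_or_ge j (k + 1) with h | h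
      · simpa only [mul_one] using isBigO_ofReal_one.mul (hk j (by omega))
      · obtain rfl : j = k + 1 := by omega
        exact hxP
    refine (hA.sub (hxP.const_mul_left ((k : ℂ) * (k + 1)))).congr_left fun x => ?_
    simp only [hg'def]
    ring
  -- to leading order the equation forces the derivative to be `-g / (2 τ)`; the difference `R`
  -- solves an equation with right-hand side `O (x)`, which gains the missing power of `x`
  set R : ℝ → ℂ := fun x => iteratedDeriv (k + 1) q x + (2 * τ)⁻¹ * g x with hR
  have hxR := mul_isBigO_of_re_nonpos (m := 2 * k) (P := R)
    (P' := fun x => iteratedDeriv (k + 2) q x + (2 * τ)⁻¹ * g' x)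
    (h := fun x : ℝ => (x : ℂ) * ((2 * τ)⁻¹ * (x * g' x + ((2 * k : ℕ) + 2) * g x))) hτ
    (fun y hy => (hPd y hy).add ((hgd y hy).const_mul _))
    (fun y hy => by
      have e := hEk k y hy
      change _ = g y at e
      simp only [hR]
      have h2 : (2 * τ)⁻¹ * (2 * τ) = 1 := inv_mul_cancel₀ (by simpa using hτ0)
      linear_combination e - g y * h2)
    (by
      have := hlim.add ((isBigO_one_mul_tendsto_zero
        (tendsto_ofReal_pow_zero (n := 2 * k + 2) (by omega)) hg).const_mul (2 * τ)⁻¹)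
      simp only [mul_zero, add_zero] at this
      refine this.congr fun x => ?_
      simp only [hR]
      ring) 1
    (by
      have hO := ((hxg'.add (hg.const_mul_left (((2 * k : ℕ) : ℂ) + 2))).const_mul_left (2 * τ)⁻¹)
      have hx : (fun x : ℝ => (x : ℂ)) =O[𝓝[>] 0] (fun x : ℝ => x) :=
        Asymptotics.isBigO_of_le _ fun x => by simp
      simpa using hx.mul hO)
  have hRO : R =O[𝓝[>] 0] (fun _ => (1 : ℝ)) := by
    obtain ⟨M, hM⟩ := hxR.bound
    refine Asymptotics.IsBigO.of_bound M ?_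
    filter_upwards [hM, self_mem_nhdsWithin] with x hx hx0
    have hx0 : (0 : ℝ) < x := hx0
    rw [norm_mul, Complex.norm_of_nonneg hx0.le, pow_one, Real.norm_of_nonneg hx0.le, mul_comm M]
      at hx
    simpa using le_of_mul_le_mul_left hx hx0
  refine (hRO.sub (hg.const_mul_left (2 * τ)⁻¹)).congr_left fun x => ?_
  simp [hR]

theorem continuousOn_cexp_div (τ : ℂ) :
    ContinuousOn (fun y : ℝ => Complex.exp (2 * τ / y)) (Ioi 0) :=
  fun _ hy => (hasDerivAt_cexp_div τ hy).continuousAt.continuousWithinAt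

theorem norm_cexp_div_sub_le_one (hτ : τ.re ≤ 0) {x y : ℝ} (hy : y ∈ Ioc 0 x) :
    ‖Complex.exp (-(2 * τ / x)) * Complex.exp (2 * τ / y)‖ ≤ 1 := by
  have hx0 : 0 < x := hy.1.trans_le hy.2
  rw [← Complex.exp_add, Complex.norm_exp, Real.exp_le_one_iff]
  have : (-(2 * τ / x) + 2 * τ / y).re = 2 * τ.re * (1 / y - 1 / x) := by
    rw [Complex.add_re, Complex.neg_re, Complex.div_ofReal_re, Complex.div_ofReal_re]
    simp
    ring
  rw [this]
  refine mul_nonpos_of_nonpos_of_nonneg (by linarith) ?_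
  have := one_div_le_one_div_of_le hy.1 hy.2
  linarith

/-- For `Re τ ≤ 0` there is a solution that is smooth up to the irregular singular point, with
value `1` there. With the variation of constants from the singular point, the equation is of
Volterra type with bounded kernel `(exp (2 τ / y - 2 τ / x) - 1) / (2 τ)`. -/
theorem exists_irregular_solution (hτ : τ.re ≤ 0) (hτ0 : τ ≠ 0) (hΓ : ContDiffOn ℝ ∞ Γ (Ici 0))
    {M : ℝ} (hM : ∀ x ≥ (0 : ℝ), ‖Γ x‖ ≤ M) :
    ∃ q : ℝ → ℂ, ContDiffOn ℝ ∞ q (Ici 0) ∧ q 0 = 1 ∧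
      ∀ x > (0 : ℝ), (x : ℂ) ^ 2 * deriv (deriv q) x + (2 * x - 2 * τ) * deriv q x = Γ x * q x := by
  have hM0 : 0 ≤ M := (norm_nonneg _).trans (hM 0 le_rfl)
  set e : ℝ → ℂ := fun y => Complex.exp (2 * τ / y) with he
  have hec : ContinuousOn e (Ioi 0) := continuousOn_cexp_div τ
  have hen : ∀ y > (0 : ℝ), ‖e y‖ ≤ 1 := fun y hy => by
    rw [he, norm_cexp_div, Real.exp_le_one_iff]
    exact div_nonpos_of_nonpos_of_nonneg (by linarith) hy.le
  have hΓf : ∀ {f : ℝ → ℂ}, ContinuousOn f (Ici 0) → ContinuousOn (fun y => Γ y * f y) (Ioi 0) :=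
    fun hf => (hΓ.continuousOn.mul hf).mono Ioi_subset_Ici_self
  have hef : ∀ {f : ℝ → ℂ}, ContinuousOn f (Ici 0) →
      ContinuousOn (fun y => e y * (Γ y * f y)) (Ioi 0) := fun hf => hec.mul (hΓf hf)
  have hbΓ : ∀ {f : ℝ → ℂ}, ContinuousOn f (Ici 0) → ∀ X > (0 : ℝ), ∃ C, ∀ y ∈ Ioc 0 X,
      ‖Γ y * f y‖ ≤ C := fun {f} hf X _ => by
    obtain ⟨C, hC⟩ := exists_bound_Ioc_of_continuousOn (hΓ.continuousOn.mul hf) X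
    exact ⟨C, fun y hy => hC y (Ioc_subset_Icc_self hy)⟩
  have hbe : ∀ {f : ℝ → ℂ}, ContinuousOn f (Ici 0) → ∀ X > (0 : ℝ), ∃ C, ∀ y ∈ Ioc 0 X,
      ‖e y * (Γ y * f y)‖ ≤ C := fun {f} hf X hX => by
    obtain ⟨C, hC⟩ := hbΓ hf X hX
    refine ⟨C, fun y hy => ?_⟩
    rw [norm_mul]
    exact (mul_le_of_le_one_left (norm_nonneg _) (hen y hy.1)).trans (hC y hy)
  have hiΓ := fun {f : ℝ → ℂ} (hf : ContinuousOn f (Ici 0)) {x : ℝ} (hx : 0 ≤ x) =>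
    intervalIntegrable_of_locally_bounded (hΓf hf) (hbΓ hf) hx
  have hie := fun {f : ℝ → ℂ} (hf : ContinuousOn f (Ici 0)) {x : ℝ} (hx : 0 ≤ x) =>
    intervalIntegrable_of_locally_bounded (hef hf) (hbe hf) hx
  -- the Volterra operator, with the kernel split into two integrals so that it can be
  -- differentiated
  set K : (ℝ → ℂ) → ℝ → ℂ := fun f x => (2 * τ)⁻¹ *
    (Complex.exp (-(2 * τ / x)) * (∫ y in (0 : ℝ)..x, e y * (Γ y * f y))
      - ∫ y in (0 : ℝ)..x, Γ y * f y) with hK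
  have hker : ∀ {f : ℝ → ℂ}, ContinuousOn f (Ici 0) → ∀ x ≥ (0 : ℝ), K f x =
      ∫ y in (0 : ℝ)..x, (2 * τ)⁻¹ * (Complex.exp (-(2 * τ / x)) * e y - 1) * (Γ y * f y) := by
    intro f hf x hx
    simp only [hK]
    rw [← intervalIntegral.integral_const_mul (Complex.exp (-(2 * τ / x))),
      ← intervalIntegral.integral_sub ((hie hf hx).const_mul _) (hiΓ hf hx),
      ← intervalIntegral.integral_const_mul]
    refine intervalIntegral.integral_congr fun y _ => ?_
    ring
  have hkn : ∀ {f : ℝ → ℂ} {x y : ℝ}, y ∈ Ioc 0 x →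
      ‖(2 * τ)⁻¹ * (Complex.exp (-(2 * τ / x)) * e y - 1) * (Γ y * f y)‖
        ≤ ‖τ‖⁻¹ * M * ‖f y‖ := by
    intro f x y hy
    rw [norm_mul, norm_mul, norm_mul, norm_inv, norm_mul]
    have h1 : ‖Complex.exp (-(2 * τ / x)) * e y - 1‖ ≤ 2 := by
      refine (norm_sub_le _ _).trans ?_
      have := norm_cexp_div_sub_le_one hτ hy
      rw [norm_one]
      linarith
    have h2 := hM y hy.1.le
    calc _ ≤ (‖(2 : ℂ)‖ * ‖τ‖)⁻¹ * 2 * (M * ‖f y‖) := by gcongr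
      _ = _ := by
        rw [Complex.norm_ofNat]
        have : ‖τ‖ ≠ 0 := norm_ne_zero_iff.2 hτ0
        field_simp
  have hexpd : ∀ x > (0 : ℝ), HasDerivAt (fun y : ℝ => Complex.exp (-(2 * τ / y)))
      (Complex.exp (-(2 * τ / x)) * ((2 * τ) / (x : ℂ) ^ 2)) x := fun x hx => by
    have := hasDerivAt_cexp_div (-τ) hx
    simp only [mul_neg, neg_neg, neg_div] at this
    exact this
  have hKd : ∀ {f : ℝ → ℂ}, ContinuousOn f (Ici 0) → ∀ x > (0 : ℝ), HasDerivAt (K f)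
      (((x : ℂ) ^ 2)⁻¹ * Complex.exp (-(2 * τ / x)) * ∫ y in (0 : ℝ)..x, e y * (Γ y * f y)) x := by
    intro f hf x hx
    have h1 := hasDerivAt_integral_of_locally_bounded (hef hf) (hbe hf) hx
    have h2 := hasDerivAt_integral_of_locally_bounded (hΓf hf) (hbΓ hf) hx
    refine ((((hexpd x hx).mul h1).sub h2).const_mul (2 * τ)⁻¹).congr_deriv ?_
    have hx0 : (x : ℂ) ≠ 0 := by exact_mod_cast hx.ne'
    have hee : Complex.exp (-(2 * τ / x)) * e x = 1 := by
      rw [he, ← Complex.exp_add, neg_add_cancel, Complex.exp_zero]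
    rw [← mul_assoc _ (e x), hee]
    field_simp
    ring
  obtain ⟨q, hq, hfix⟩ := exists_continuousOn_eq_one_add K (M := 2 * (‖τ‖⁻¹ * M)) (by positivity)
    (fun f hf => by
      intro x hx
      rcases eq_or_lt_of_le (show (0 : ℝ) ≤ x from hx) with rfl | h
      · obtain ⟨C, hC⟩ := exists_bound_Ioc_of_continuousOn hf 1
        rw [ContinuousWithinAt, show K f 0 = 0 by simp [hK], tendsto_zero_iff_norm_tendsto_zero]
        have h0 : Tendsto (fun x : ℝ => ‖τ‖⁻¹ * M * C * x) (𝓝[≥] 0) (𝓝 0) := by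
          have : Tendsto (fun x : ℝ => ‖τ‖⁻¹ * M * C * x) (𝓝 0) (𝓝 (‖τ‖⁻¹ * M * C * 0)) :=
            (continuous_const.mul continuous_id).tendsto 0
          rw [mul_zero] at this
          exact this.mono_left inf_le_left
        refine squeeze_zero' (Eventually.of_forall fun _ => norm_nonneg _) ?_ h0
        filter_upwards [Icc_mem_nhdsGE one_pos] with y hy
        rw [hker hf y hy.1]
        refine norm_integral_zero_le hy.1 fun z hz => (hkn hz).trans ?_
        have := hC z ⟨hz.1.le, hz.2.trans hy.2⟩
        gcongr
      · exact (hKd hf x h).continuousAt.continuousWithinAt)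
    (fun f g hf hg x hx => by
      rw [hker (f := fun y => f y - g y) (hf.sub hg) x hx, hker hf x hx, hker hg x hx,
        ← intervalIntegral.integral_sub]
      · refine intervalIntegral.integral_congr fun y _ => ?_
        ring
      · refine (((hie hf hx).const_mul ((2 * τ)⁻¹ * Complex.exp (-(2 * τ / x)))).sub
          ((hiΓ hf hx).const_mul (2 * τ)⁻¹)).congr fun y _ => ?_
        ring
      · refine (((hie hg hx).const_mul ((2 * τ)⁻¹ * Complex.exp (-(2 * τ / x)))).sub
          ((hiΓ hg hx).const_mul (2 * τ)⁻¹)).congr fun y _ => ?_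
        ring)
    (fun f D hD hf hfD x hx => by
      rw [hker hf x hx]
      refine norm_integral_zero_le_exp (by positivity) hx fun y hy => (hkn hy).trans ?_
      have := hfD y hy.1.le
      calc ‖τ‖⁻¹ * M * ‖f y‖ ≤ ‖τ‖⁻¹ * M * (D * Real.exp (2 * (‖τ‖⁻¹ * M) * y)) := by gcongr
        _ = _ := by ring)
  set H : ℝ → ℂ := fun x => ∫ y in (0 : ℝ)..x, e y * (Γ y * q y) with hH
  set P : ℝ → ℂ := fun x => ((x : ℂ) ^ 2)⁻¹ * Complex.exp (-(2 * τ / x)) * H x with hP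
  have hq' : ∀ x > (0 : ℝ), HasDerivAt q (P x) x := fun x hx => by
    refine ((hKd hq x hx).const_add 1).congr_of_eventuallyEq ?_
    filter_upwards [Ioi_mem_nhds hx] with y hy using hfix y (le_of_lt hy)
  have hP' : ∀ x > (0 : ℝ), HasDerivAt P
      ((Γ x * ((x : ℂ) ^ 2)⁻¹) * q x + ((2 * τ - 2 * x) * ((x : ℂ) ^ 2)⁻¹) * P x) x := by
    intro x hx
    have hx0 : (x : ℂ) ≠ 0 := by exact_mod_cast hx.ne'
    have h1 : HasDerivAt H (e x * (Γ x * q x)) x :=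
      hasDerivAt_integral_of_locally_bounded (hef hq) (hbe hq) hx
    have h2 : HasDerivAt (fun y : ℝ => ((y : ℂ) ^ 2)⁻¹) (-(2 * x) / ((x : ℂ) ^ 2) ^ 2) x := by
      refine (((hasDerivAt_id x).ofReal_comp.pow 2).inv (pow_ne_zero 2 hx0)).congr_deriv ?_
      simp
    refine ((h2.mul (hexpd x hx)).mul h1).congr_deriv ?_
    have hee : Complex.exp (-(2 * τ / x)) * e x = 1 := by
      rw [he, ← Complex.exp_add, neg_add_cancel, Complex.exp_zero]
    simp only [hP, Pi.mul_apply]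
    rw [mul_assoc ((x : ℂ) ^ 2)⁻¹ _ (e x * _), ← mul_assoc _ (e x) (Γ x * q x), hee]
    field_simp
    ring
  have hi2 : ContDiffOn ℝ ∞ (fun x : ℝ => ((x : ℂ) ^ 2)⁻¹) (Ioi 0) :=
    (contDiffOn_ofReal.pow 2).inv fun x hx =>
      pow_ne_zero 2 (by exact_mod_cast (ne_of_gt (show (0 : ℝ) < x from hx)))
  obtain ⟨hqs, -⟩ := contDiffOn_of_hasDerivAt_system
    ((hΓ.mono Ioi_subset_Ici_self).mul hi2)
    (((contDiffOn_const (c := 2 * τ)).sub (contDiffOn_const.mul contDiffOn_ofReal)).mul hi2) hq' hP'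
  have hderiv2 : ∀ x > (0 : ℝ), deriv (deriv q) x =
      (Γ x * ((x : ℂ) ^ 2)⁻¹) * q x + ((2 * τ - 2 * x) * ((x : ℂ) ^ 2)⁻¹) * P x := fun x hx => by
    rw [← (hP' x hx).deriv]
    refine Filter.EventuallyEq.deriv_eq ?_
    filter_upwards [Ioi_mem_nhds hx] with y hy using (hq' y hy).deriv
  have hE : ∀ x > (0 : ℝ), (x : ℂ) ^ 2 * deriv (deriv q) x + (2 * x - 2 * τ) * deriv q x
      = Γ x * q x := fun x hx => by
    have hx0 : (x : ℂ) ≠ 0 := by exact_mod_cast (ne_of_gt hx)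
    rw [hderiv2 x hx, (hq' x hx).deriv]
    field_simp
    ring
  have hq0 : Tendsto q (𝓝[>] 0) (𝓝 (q 0)) :=
    (hq 0 self_mem_Ici).mono_left (nhdsWithin_mono _ Ioi_subset_Ici_self)
  -- `x ^ 2 q'` is an integral over `(0, x]` of a bounded function
  have hxP : (fun x : ℝ => (x : ℂ) * deriv q x) =O[𝓝[>] 0] (fun _ => (1 : ℝ)) := by
    obtain ⟨C, hC⟩ := exists_bound_Ioc_of_continuousOn (hΓ.continuousOn.mul hq) 1
    refine Asymptotics.IsBigO.of_bound C ?_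
    filter_upwards [Ioo_mem_nhdsGT one_pos] with x hx
    have h1 : ‖Complex.exp (-(2 * τ / x)) * H x‖ ≤ C * x := by
      rw [hH, ← intervalIntegral.integral_const_mul]
      refine norm_integral_zero_le hx.1.le fun y hy => ?_
      rw [← mul_assoc, norm_mul]
      exact (mul_le_of_le_one_left (norm_nonneg _) (norm_cexp_div_sub_le_one hτ hy)).trans
        (hC y ⟨hy.1.le, hy.2.trans hx.2.le⟩)
    rw [(hq' x hx.1).deriv, hP]
    simp only [mul_assoc, norm_mul, norm_inv, norm_pow, Complex.norm_of_nonneg hx.1.le,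
      norm_one, mul_one] at h1 ⊢
    have hx0 := hx.1
    calc x * ((x ^ 2)⁻¹ * (‖Complex.exp (-(2 * τ / x))‖ * ‖H x‖)) ≤ x * ((x ^ 2)⁻¹ * (C * x)) := by
          gcongr
      _ = C := by field_simp
  obtain ⟨F, hF, hFe⟩ := exists_smooth_of_re_nonpos hτ hτ0 hqs hΓ hE (hq0.isBigO_one ℝ) hxP
  have hFd : ∀ x > (0 : ℝ), deriv F x = deriv q x := fun x hx =>
    Filter.EventuallyEq.deriv_eq (by filter_upwards [Ioi_mem_nhds hx] with y hy using hFe y hy)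
  have hFdd : ∀ x > (0 : ℝ), deriv (deriv F) x = deriv (deriv q) x := fun x hx =>
    Filter.EventuallyEq.deriv_eq (by filter_upwards [Ioi_mem_nhds hx] with y hy using hFd y hy)
  refine ⟨F, hF, ?_, fun x hx => ?_⟩
  · have h1 : Tendsto F (𝓝[>] 0) (𝓝 (F 0)) :=
      (hF.continuousOn 0 self_mem_Ici).mono_left (nhdsWithin_mono _ Ioi_subset_Ici_self)
    have h2 : Tendsto F (𝓝[>] 0) (𝓝 (q 0)) := hq0.congr' (by
      filter_upwards [self_mem_nhdsWithin] with x hx using (hFe x hx).symm)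
    rw [tendsto_nhds_unique h1 h2, hfix 0 le_rfl]
    simp [hK]
  · rw [hFdd x hx, hFd x hx, hFe x hx]
    exact hE x hx
end

/-! ### The model operator near infinity -/

/-- The coefficient of the equation `ρ ^ 2 q'' + (2 ρ - 2 τ) q' = Γ q`, `τ = 2 σ / (κ + 2)`, that
`N Q = 0` becomes for the amplitude `q` of `Q = exp (σ φ) l ^ (-κ / 4) q (l ^ (-(κ + 2) / 2))`.
Here `Φ t = Ψ (t ^ (-1 / (κ + 2)))`. -/
noncomputable def amplitudeCoeff (κ : ℤ) (α : ℂ) (Φ : ℝ → ℂ) (ρ : ℝ) : ℂ :=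
  4 / ((κ : ℂ) + 2) ^ 2 * (α ^ 2 - 1 / 4 - κ * (κ + 4) / 16 + Φ (ρ ^ 2))

/-- The function `exp (σ φ) l ^ (-κ / 4) q (l ^ (-(κ + 2) / 2))`. -/
noncomputable def wkb (κ : ℤ) (σ : ℂ) (q : ℝ → ℂ) (l : ℝ) : ℂ :=
  Complex.exp (σ * modelPhase κ l) * ((l ^ (-(κ : ℝ) / 4) : ℝ) : ℂ) * q (l ^ (-(((κ : ℝ) + 2) / 2)))

/-- The derivative of `wkb κ σ q`, in terms of the derivative `q₁` of `q`. -/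
noncomputable def wkbDeriv (κ : ℤ) (σ : ℂ) (q q₁ : ℝ → ℂ) (l : ℝ) : ℂ :=
  Complex.exp (σ * modelPhase κ l) * ((l ^ (-(κ : ℝ) / 4) : ℝ) : ℂ) *
    (σ * ((l ^ ((κ : ℝ) / 2) : ℝ) : ℂ) * q (l ^ (-(((κ : ℝ) + 2) / 2)))
      - κ / 4 * q (l ^ (-(((κ : ℝ) + 2) / 2))) / l
      - (κ + 2) / 2 * ((l ^ (-(((κ : ℝ) + 2) / 2)) : ℝ) : ℂ) / l * q₁ (l ^ (-(((κ : ℝ) + 2) / 2))))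

section
variable {κ : ℤ} {σ : ℂ}

theorem hasDerivAt_ofReal_rpow (c : ℝ) {l : ℝ} (hl : 0 < l) :
    HasDerivAt (fun l : ℝ => ((l ^ c : ℝ) : ℂ)) (c * ((l ^ c : ℝ) : ℂ) / l) l := by
  have h := (Real.hasDerivAt_rpow_const (p := c) (Or.inl hl.ne')).ofReal_comp
  refine h.congr_deriv ?_
  rw [Real.rpow_sub_one hl.ne']
  push_cast
  ring

theorem hasDerivAt_modelPhase (hκ : -1 ≤ κ) {l : ℝ} (hl : 0 < l) :
    HasDerivAt (modelPhase κ) (l ^ ((κ : ℝ) / 2)) l := by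
  have hp : (0 : ℝ) < κ + 2 := by
    have : (-1 : ℝ) ≤ κ := by exact_mod_cast hκ
    linarith
  have h := ((Real.hasDerivAt_rpow_const (p := ((κ : ℝ) + 2) / 2) (Or.inl hl.ne')).const_mul
    2).div_const ((κ : ℝ) + 2)
  refine h.congr_deriv ?_
  rw [show ((κ : ℝ) + 2) / 2 - 1 = (κ : ℝ) / 2 by ring]
  field_simp

theorem hasDerivAt_exp_mul_rpow_mul (hκ : -1 ≤ κ) {f f' : ℝ → ℂ} {l : ℝ} (hl : 0 < l)
    (hf : HasDerivAt f (f' l) l) :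
    HasDerivAt (fun l => Complex.exp (σ * modelPhase κ l) * ((l ^ (-(κ : ℝ) / 4) : ℝ) : ℂ) * f l)
      (Complex.exp (σ * modelPhase κ l) * ((l ^ (-(κ : ℝ) / 4) : ℝ) : ℂ) *
        (σ * ((l ^ ((κ : ℝ) / 2) : ℝ) : ℂ) * f l - κ / 4 * f l / l + f' l)) l := by
  have h1 := ((hasDerivAt_modelPhase hκ hl).ofReal_comp.const_mul σ).cexp
  refine ((h1.mul (hasDerivAt_ofReal_rpow (-(κ : ℝ) / 4) hl)).mul hf).congr_deriv ?_
  have hl0 : (l : ℂ) ≠ 0 := by exact_mod_cast hl.ne'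
  simp only [Pi.mul_apply]
  push_cast
  field_simp
  ring

theorem rpow_mul_rpow_mul_self {l : ℝ} (hl : 0 < l) :
    l ^ (-(((κ : ℝ) + 2) / 2)) * l ^ ((κ : ℝ) / 2) * l = 1 := by
  rw [← Real.rpow_add hl]
  nth_rewrite 2 [← Real.rpow_one l]
  rw [← Real.rpow_add hl, show -(((κ : ℝ) + 2) / 2) + (κ : ℝ) / 2 + 1 = 0 by ring, Real.rpow_zero]

theorem rpow_mul_self_mul_rpow {l : ℝ} (hl : 0 < l) :
    l ^ (-(κ : ℝ) / 4) * l ^ (-(κ : ℝ) / 4) * l ^ ((κ : ℝ) / 2) = 1 := by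
  rw [← Real.rpow_add hl, ← Real.rpow_add hl,
    show -(κ : ℝ) / 4 + -(κ : ℝ) / 4 + (κ : ℝ) / 2 = 0 by ring, Real.rpow_zero]

theorem hasDerivAt_comp_rpow {q q₁ : ℝ → ℂ} (hq : ∀ x > (0 : ℝ), HasDerivAt q (q₁ x) x) (c : ℝ)
    {l : ℝ} (hl : 0 < l) :
    HasDerivAt (fun l => q (l ^ c)) (c * ((l ^ c : ℝ) : ℂ) / l * q₁ (l ^ c)) l := by
  have h := (hq (l ^ c) (Real.rpow_pos_of_pos hl c)).scomp l
    (Real.hasDerivAt_rpow_const (p := c) (Or.inl hl.ne'))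
  refine h.congr_deriv ?_
  rw [Real.rpow_sub_one hl.ne', Complex.real_smul]
  push_cast
  ring

theorem hasDerivAt_wkb (hκ : -1 ≤ κ) {q q₁ : ℝ → ℂ} (hq : ∀ x > (0 : ℝ), HasDerivAt q (q₁ x) x)
    {l : ℝ} (hl : 0 < l) : HasDerivAt (wkb κ σ q) (wkbDeriv κ σ q q₁ l) l := by
  refine (hasDerivAt_exp_mul_rpow_mul (f' := fun l => _) hκ hl
    (hasDerivAt_comp_rpow hq (-(((κ : ℝ) + 2) / 2)) hl)).congr_deriv ?_
  rw [wkbDeriv]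
  push_cast
  ring

/-- The model operator acting on `wkb κ σ q`, in terms of the equation for the amplitude. -/
theorem hasDerivAt_wkbDeriv (hκ : -1 ≤ κ) {ς : ℝ} (hσ : σ ^ 2 = ς) {α : ℂ} {Ψ Φ : ℝ → ℂ}
    (hΦ : ∀ t > 0, Φ t = Ψ (t ^ (-(1 / ((κ : ℝ) + 2))))) {q q₁ q₂ : ℝ → ℂ}
    (hq : ∀ x > (0 : ℝ), HasDerivAt q (q₁ x) x) (hq₁ : ∀ x > (0 : ℝ), HasDerivAt q₁ (q₂ x) x)
    {l ρ : ℝ} (hl : 0 < l) (hρ : ρ = l ^ (-(((κ : ℝ) + 2) / 2))) :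
    HasDerivAt (wkbDeriv κ σ q q₁) (modelPotential ς κ α Ψ l * wkb κ σ q l
      + Complex.exp (σ * modelPhase κ l) * ((l ^ (-(κ : ℝ) / 4) : ℝ) : ℂ)
        * ((κ + 2) ^ 2 / 4 / (l : ℂ) ^ 2) * ((ρ : ℂ) ^ 2 * q₂ ρ
        + (2 * ρ - 2 * (2 * σ / (κ + 2))) * q₁ ρ - amplitudeCoeff κ α Φ ρ * q ρ)) l := by
  have hl0 : (l : ℂ) ≠ 0 := by exact_mod_cast hl.ne'
  have hpr : (0 : ℝ) < κ + 2 := by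
    have : (-1 : ℝ) ≤ κ := by exact_mod_cast hκ
    linarith
  have hp : (κ : ℂ) + 2 ≠ 0 := by exact_mod_cast hpr.ne'
  have hinv : HasDerivAt (fun l : ℝ => (l : ℂ)⁻¹) (-1 / (l : ℂ) ^ 2) l := by
    exact ((hasDerivAt_id l).ofReal_comp.inv hl0).congr_deriv (by simp)
  have hqc := hasDerivAt_comp_rpow hq (-(((κ : ℝ) + 2) / 2)) hl
  have hq₁c := hasDerivAt_comp_rpow hq₁ (-(((κ : ℝ) + 2) / 2)) hl
  have hr := hasDerivAt_ofReal_rpow (-(((κ : ℝ) + 2) / 2)) hl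
  have hY := hasDerivAt_ofReal_rpow ((κ : ℝ) / 2) hl
  have hf := (((hY.const_mul σ).mul hqc).sub ((hqc.const_mul ((κ : ℂ) / 4)).mul hinv)).sub
    (((hr.const_mul (((κ : ℂ) + 2) / 2)).mul hinv).mul hq₁c)
  have hmain := hasDerivAt_exp_mul_rpow_mul (σ := σ) (f' := fun l => _) hκ hl hf
  have hΨ : Ψ l = Φ (ρ ^ 2) := by
    have hρ0 : 0 < ρ := hρ ▸ Real.rpow_pos_of_pos hl _
    rw [hΦ _ (by positivity), hρ, ← Real.rpow_natCast, ← Real.rpow_mul hl.le, ← Real.rpow_mul hl.le]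
    congr 1
    rw [show -(((κ : ℝ) + 2) / 2) * ((2 : ℕ) : ℝ) * -(1 / ((κ : ℝ) + 2)) = 1 by
      push_cast; field_simp, Real.rpow_one]
  have hzp : (l : ℂ) ^ κ = ((l ^ ((κ : ℝ) / 2) : ℝ) : ℂ) ^ 2 := by
    rw [← Complex.ofReal_zpow, ← Complex.ofReal_pow, ← Real.rpow_natCast, ← Real.rpow_mul hl.le,
      ← Real.rpow_intCast]
    congr 2
    push_cast
    ring
  have hrel := congrArg (fun x : ℝ => (x : ℂ)) (rpow_mul_rpow_mul_self (κ := κ) hl)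
  push_cast at hrel
  refine (hmain.congr_of_eventuallyEq (f₁ := wkbDeriv κ σ q q₁) ?_).congr_deriv ?_
  · filter_upwards with x
    simp only [wkbDeriv, Pi.sub_apply, Pi.mul_apply]
    ring
  · rw [modelPotential, wkb, amplitudeCoeff, ← hΨ, hzp, ← hσ, ← hρ]
    rw [← hρ] at hrel
    simp only [Pi.sub_apply, Pi.mul_apply, ← hρ]
    push_cast
    generalize ((l ^ ((κ : ℝ) / 2) : ℝ) : ℂ) = Y at *
    generalize ((l ^ (-(κ : ℝ) / 4) : ℝ) : ℂ) = A
    generalize Complex.exp (σ * modelPhase κ l) = E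
    generalize q ρ = a
    generalize q₁ ρ = b
    generalize q₂ ρ = c
    generalize Ψ l = u
    generalize (ρ : ℂ) = r at *
    generalize (κ : ℂ) = k at *
    field_simp
    linear_combination (-1024 * E * A * (k + 2) * σ * b) * hrel

end

section
variable {κ : ℤ} {σ : ℂ} {ς : ℝ} {α : ℂ} {Ψ Φ : ℝ → ℂ}

theorem intCast_add_two_pos (hκ : -1 ≤ κ) : (0 : ℝ) < κ + 2 := by
  have : (-1 : ℝ) ≤ κ := by exact_mod_cast hκ
  linarith

theorem contDiffOn_amplitudeCoeff (hΦ : ContDiffOn ℝ ∞ Φ (Ici 0)) :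
    ContDiffOn ℝ ∞ (amplitudeCoeff κ α Φ) (Ici 0) := by
  have h : ContDiffOn ℝ ∞ (fun ρ : ℝ => Φ (ρ ^ 2)) (Ici 0) :=
    hΦ.comp (g := Φ) (f := fun ρ : ℝ => ρ ^ 2) (by fun_prop) fun x _ => sq_nonneg x
  exact contDiffOn_const.mul (contDiffOn_const.add h)

theorem exists_bound_amplitudeCoeff (hκ : -1 ≤ κ) (hΨ : ContDiffOn ℝ ∞ Ψ (Ici 0))
    (hΦ : ContDiffOn ℝ ∞ Φ (Ici 0)) (h : ∀ t > 0, Φ t = Ψ (t ^ (-(1 / ((κ : ℝ) + 2))))) :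
    ∃ M, ∀ x ≥ (0 : ℝ), ‖amplitudeCoeff κ α Φ x‖ ≤ M := by
  have hp := intCast_add_two_pos hκ
  obtain ⟨M₁, h₁⟩ := exists_bound_Ioc_of_continuousOn hΨ.continuousOn 1
  obtain ⟨M₂, h₂⟩ := exists_bound_Ioc_of_continuousOn hΦ.continuousOn 1
  refine ⟨‖4 / ((κ : ℂ) + 2) ^ 2‖ * (‖α ^ 2 - 1 / 4 - κ * (κ + 4) / 16‖ + max M₁ M₂),
    fun x hx => ?_⟩
  rw [amplitudeCoeff, norm_mul]
  refine mul_le_mul_of_nonneg_left ((norm_add_le _ _).trans ?_) (norm_nonneg _)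
  refine add_le_add_right ?_ _
  rcases le_total (x ^ 2) 1 with hle | hle
  · exact (h₂ _ ⟨by positivity, hle⟩).trans (le_max_right _ _)
  · have h0 : 0 < x ^ 2 := by linarith
    rw [h _ h0]
    refine (h₁ _ ⟨Real.rpow_nonneg h0.le _, ?_⟩).trans (le_max_left _ _)
    exact Real.rpow_le_one_of_one_le_of_nonpos hle (by
      rw [Left.neg_nonpos_iff]
      positivity)

theorem isExpAtInfinity_iff {q Q : ℝ → ℂ} (hκ : -1 ≤ κ) :
    IsExpAtInfinity κ σ q Q ↔ ContDiffOn ℝ ∞ q (Ici 0) ∧ ∀ l > (0 : ℝ), Q l = wkb κ σ q l := by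
  have hp := intCast_add_two_pos hκ
  refine and_congr_right fun _ => forall₂_congr fun l hl => ?_
  rw [wkb, ← Real.rpow_mul (le_of_lt hl),
    show -(((κ : ℝ) + 2) / 2) * ((κ : ℝ) / (2 * κ + 4)) = -(κ : ℝ) / 4 by
      rw [show 2 * (κ : ℝ) + 4 = 2 * (κ + 2) by ring]; field_simp; ring]

theorem hasDerivAt_deriv_of_contDiffOn_Ioi {q : ℝ → ℂ} (hq : ContDiffOn ℝ ∞ q (Ioi 0)) {x : ℝ}
    (hx : 0 < x) : HasDerivAt (deriv q) (deriv (deriv q) x) x :=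
  hasDerivAt_of_contDiffOn_Ioi ((contDiffOn_infty_iff_deriv_of_isOpen isOpen_Ioi).1 hq).2 hx

/-- Solutions of the equation for the amplitude give solutions of the model equation. -/
theorem wkb_mem_modelKernel (hκ : -1 ≤ κ) (hσ : σ ^ 2 = ς) (hΨ : ContDiffOn ℝ ∞ Ψ (Ici 0))
    (hΦ : ∀ t > 0, Φ t = Ψ (t ^ (-(1 / ((κ : ℝ) + 2))))) {q : ℝ → ℂ}
    (hq : ContDiffOn ℝ ∞ q (Ioi 0))
    (hE : ∀ x > (0 : ℝ), (x : ℂ) ^ 2 * deriv (deriv q) x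
      + (2 * x - 2 * (2 * σ / (κ + 2))) * deriv q x = amplitudeCoeff κ α Φ x * q x) :
    wkb κ σ q ∈ modelKernel ς κ α Ψ := by
  refine mem_modelKernel_of_hasDerivAt hΨ
    (fun l hl => hasDerivAt_wkb hκ (fun x hx => hasDerivAt_of_contDiffOn_Ioi hq hx) hl)
    fun l hl => (hasDerivAt_wkbDeriv (α := α) hκ hσ hΦ
      (fun x hx => hasDerivAt_of_contDiffOn_Ioi hq hx)
      (fun x hx => hasDerivAt_deriv_of_contDiffOn_Ioi hq hx) hl rfl).congr_deriv ?_
  rw [hE _ (Real.rpow_pos_of_pos hl _)]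
  ring

/-- For `Re σ ≤ 0` there is a solution of the form `exp (σ φ) l ^ (-κ / 4) q`, with `q` smooth up
to infinity and equal to `1` there. -/
theorem exists_wkb_solution (hκ : -1 ≤ κ) (hσ : σ ^ 2 = ς) (hσ0 : σ ≠ 0) (hσr : σ.re ≤ 0)
    (hΨ : IsAdmissible κ Ψ) :
    ∃ Q ∈ modelKernel ς κ α Ψ, ∃ q, IsExpAtInfinity κ σ q Q ∧ q 0 = 1 := by
  obtain ⟨hΨs, -, Φ, hΦs, hΦ⟩ := hΨ
  have hp := intCast_add_two_pos hκ
  have hpc : (κ : ℂ) + 2 ≠ 0 := by exact_mod_cast hp.ne'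
  obtain ⟨M, hM⟩ := exists_bound_amplitudeCoeff (α := α) hκ hΨs hΦs hΦ
  have hτ : (2 * σ / ((κ : ℂ) + 2)) = ((2 / ((κ : ℝ) + 2) : ℝ) : ℂ) * σ := by
    push_cast
    ring
  obtain ⟨q, hq, hq0, hE⟩ := exists_irregular_solution (τ := 2 * σ / ((κ : ℂ) + 2)) (by
      rw [hτ, Complex.re_ofReal_mul]
      exact mul_nonpos_of_nonneg_of_nonpos (by positivity) hσr)
    (div_ne_zero (mul_ne_zero two_ne_zero hσ0) hpc) (contDiffOn_amplitudeCoeff hΦs) hM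
  exact ⟨wkb κ σ q, wkb_mem_modelKernel hκ hσ hΨs hΦ (hq.mono Ioi_subset_Ici_self) hE, q,
    (isExpAtInfinity_iff hκ).2 ⟨hq, fun _ _ => rfl⟩, hq0⟩

theorem rpow_inv_rpow {c ρ : ℝ} (hc : c ≠ 0) (hρ : 0 < ρ) : (ρ ^ c⁻¹) ^ c = ρ := by
  rw [← Real.rpow_mul hρ.le, inv_mul_cancel₀ hc, Real.rpow_one]

/-- Every solution has the form `exp (φ) l ^ (-κ / 4) q` if `ς = 1`, with `q` smooth up to
infinity. -/
theorem exists_growing_form (hκ : -1 ≤ κ) (hΨ : IsAdmissible κ Ψ) {Q : ℝ → ℂ}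
    (hQ : Q ∈ modelKernel 1 κ α Ψ) : ∃ q, IsExpAtInfinity κ 1 q Q := by
  obtain ⟨hΨs, -, Φ, hΦs, hΦ⟩ := hΨ
  have hp := intCast_add_two_pos hκ
  have hpc : (κ : ℂ) + 2 ≠ 0 := by exact_mod_cast hp.ne'
  set c : ℝ := -(((κ : ℝ) + 2) / 2) with hc
  have hc0 : c ≠ 0 := by
    have : 0 < ((κ : ℝ) + 2) / 2 := by positivity
    rw [hc]
    linarith
  set a : ℝ → ℂ := fun l => Complex.exp (1 * modelPhase κ l) * ((l ^ (-(κ : ℝ) / 4) : ℝ) : ℂ)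
      with ha
  have hane : ∀ l > (0 : ℝ), a l ≠ 0 := fun l hl => mul_ne_zero (Complex.exp_ne_zero _)
    (by exact_mod_cast (Real.rpow_pos_of_pos hl _).ne')
  have has : ContDiffOn ℝ ∞ a (Ioi 0) := by
    refine contDiffOn_of_hasDerivAt_linear (b := fun _ => 0)
      (a := fun l : ℝ => (l : ℂ) ^ ((κ : ℂ) / 2) - (κ : ℂ) / 4 * (l : ℂ) ^ (-1 : ℂ))
      ((contDiffOn_cpow_Ioi _).sub (contDiffOn_const.mul (contDiffOn_cpow_Ioi _)))
      contDiffOn_const fun l hl => ?_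
    have := hasDerivAt_exp_mul_rpow_mul (σ := 1) (f := fun _ => 1) (f' := fun _ => 0) hκ hl
      (hasDerivAt_const l 1)
    simp only [mul_one, add_zero] at this
    refine this.congr_deriv ?_
    have hr : ((l ^ ((κ : ℝ) / 2) : ℝ) : ℂ) = (l : ℂ) ^ ((κ : ℂ) / 2) := by
      rw [Complex.ofReal_cpow (le_of_lt hl)]
      push_cast
      rfl
    rw [Complex.cpow_neg_one, hr]
    simp only [ha]
    ring
  have hrp : ContDiffOn ℝ ∞ (fun ρ : ℝ => ρ ^ c⁻¹) (Ioi 0) := fun x hx =>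
    (Real.contDiffAt_rpow_const_of_ne (ne_of_gt hx)).contDiffWithinAt
  -- `q` is defined by `Q = wkb κ 1 q`; the equation for `q` is read off from the one for `Q`
  set q : ℝ → ℂ := fun ρ => Q (ρ ^ c⁻¹) * (a (ρ ^ c⁻¹))⁻¹ with hq
  have hmaps : MapsTo (fun ρ : ℝ => ρ ^ c⁻¹) (Ioi 0) (Ioi 0) := fun x hx => Real.rpow_pos_of_pos
      hx _
  have hqs : ContDiffOn ℝ ∞ q (Ioi 0) :=
    (hQ.1.comp hrp hmaps).mul ((has.inv hane).comp hrp hmaps)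
  have hQq : ∀ l > (0 : ℝ), Q l = wkb κ 1 q l := fun l hl => by
    have : (l ^ c) ^ c⁻¹ = l := by rw [← Real.rpow_mul (le_of_lt hl), mul_inv_cancel₀ hc0,
        Real.rpow_one]
    rw [wkb, hq]
    simp only [← hc, this]
    change Q l = a l * (Q l * (a l)⁻¹)
    have := hane l hl
    field_simp
  have hE : ∀ x > (0 : ℝ), (x : ℂ) ^ 2 * deriv (deriv q) x
      + (2 * x - 2 * (2 * (1 : ℂ) / (κ + 2))) * deriv q x = amplitudeCoeff κ α Φ x * q x := by
    intro x hx
    have hl : 0 < x ^ c⁻¹ := Real.rpow_pos_of_pos hx _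
    set l := x ^ c⁻¹ with hldef
    have hxl : x = l ^ c := (rpow_inv_rpow hc0 hx).symm
    have h1 := hasDerivAt_wkbDeriv (σ := 1) (ς := 1) (α := α) hκ (by simp) hΦ
      (fun x hx => hasDerivAt_of_contDiffOn_Ioi hqs hx)
      (fun x hx => hasDerivAt_deriv_of_contDiffOn_Ioi hqs hx) hl hxl
    have h2 := hasDerivAt_deriv_of_mem_modelKernel hQ hl
    have h3 : HasDerivAt (wkbDeriv κ 1 q (deriv q)) (modelPotential 1 κ α Ψ l * Q l) l := by
      refine h2.congr_of_eventuallyEq ?_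
      filter_upwards [Ioi_mem_nhds hl] with y hy
      have h4 := hasDerivAt_wkb (σ := 1) hκ (fun x hx => hasDerivAt_of_contDiffOn_Ioi hqs hx) hy
      have h5 : HasDerivAt Q (wkbDeriv κ 1 q (deriv q) y) y := by
        refine h4.congr_of_eventuallyEq ?_
        filter_upwards [Ioi_mem_nhds hy] with z hz using hQq z hz
      exact h5.deriv.symm
    have h4 := h1.unique h3
    rw [← hQq l hl] at h4
    have h5 := add_eq_left.1 h4
    have hl0 : (l : ℂ) ≠ 0 := by exact_mod_cast hl.ne'
    have h6 : a l * (((κ : ℂ) + 2) ^ 2 / 4 / (l : ℂ) ^ 2) ≠ 0 :=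
      mul_ne_zero (hane l hl) (div_ne_zero (div_ne_zero (pow_ne_zero 2 hpc) (by norm_num))
        (pow_ne_zero 2 hl0))
    exact sub_eq_zero.1 ((mul_eq_zero.1 h5).resolve_left h6)
  obtain ⟨F, hF, hFe⟩ := exists_smooth_of_pos (t := 2 / ((κ : ℝ) + 2)) (by positivity) hqs
    (contDiffOn_amplitudeCoeff hΦs) (fun x hx => by
      rw [← hE x hx]
      push_cast
      ring)
  refine ⟨F, (isExpAtInfinity_iff hκ).2 ⟨hF, fun l hl => ?_⟩⟩
  rw [hQq l hl, wkb, wkb, hFe _ (Real.rpow_pos_of_pos hl _)]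

/-- The Wronskian of two solutions with opposite exponentials is read off at infinity. -/
theorem wronskian_eq (hκ : -1 ≤ κ) {Q R q k : ℝ → ℂ} (hQ : Q ∈ modelKernel ς κ α Ψ)
    (hR : R ∈ modelKernel ς κ α Ψ) (hq : IsExpAtInfinity κ σ q Q)
    (hk : IsExpAtInfinity κ (-σ) k R) {l : ℝ} (hl : 0 < l) :
    Q l * deriv R l - deriv Q l * R l = -2 * σ * q 0 * k 0 := by
  rw [isExpAtInfinity_iff hκ] at hq hk
  have hp := intCast_add_two_pos hκ
  set c : ℝ := -(((κ : ℝ) + 2) / 2) with hc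
  have hc0 : c ≠ 0 := by
    have : 0 < ((κ : ℝ) + 2) / 2 := by positivity
    rw [hc]
    linarith
  have hqs := hq.1.mono Ioi_subset_Ici_self
  have hks := hk.1.mono Ioi_subset_Ici_self
  have hd : ∀ {σ : ℂ} {Q q : ℝ → ℂ}, ContDiffOn ℝ ∞ q (Ioi 0) → (∀ l > (0 : ℝ), Q l = wkb κ σ q l) →
      ∀ l > (0 : ℝ), deriv Q l = wkbDeriv κ σ q (deriv q) l := fun {σ Q q} hqs hQ l hl => by
    refine HasDerivAt.deriv ((hasDerivAt_wkb hκ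
      (fun x hx => hasDerivAt_of_contDiffOn_Ioi hqs hx) hl).congr_of_eventuallyEq ?_)
    filter_upwards [Ioi_mem_nhds hl] with y hy using hQ y hy
  -- the Wronskian in terms of the amplitudes at `ρ`; the second term vanishes as `ρ → 0`
  have hform : ∀ ρ > (0 : ℝ), Q l * deriv R l - deriv Q l * R l = -2 * σ * q ρ * k ρ
      + (κ + 2) / 2 * ((ρ : ℂ) ^ 2 * (deriv q ρ * k ρ - q ρ * deriv k ρ)) := by
    intro ρ hρ
    have hm : 0 < ρ ^ c⁻¹ := Real.rpow_pos_of_pos hρ _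
    set m := ρ ^ c⁻¹ with hmdef
    have hρm : m ^ c = ρ := rpow_inv_rpow hc0 hρ
    rw [wronskian_const isOpen_Ioi (convex_Ioi 0) (U := modelPotential ς κ α Ψ)
      (fun y hy => hasDerivAt_of_mem_modelKernel hQ hy)
      (fun y hy => hasDerivAt_deriv_of_mem_modelKernel hQ hy)
      (fun y hy => hasDerivAt_of_mem_modelKernel hR hy)
      (fun y hy => hasDerivAt_deriv_of_mem_modelKernel hR hy) (show l ∈ Ioi 0 from hl)
      (show m ∈ Ioi 0 from hm), hd hqs hq.2 m hm, hd hks hk.2 m hm, hq.2 m hm, hk.2 m hm]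
    simp only [wkb, wkbDeriv, ← hc, hρm]
    have hrel := congrArg (fun x : ℝ => (x : ℂ)) (rpow_mul_rpow_mul_self (κ := κ) hm)
    have hrel2 := congrArg (fun x : ℝ => (x : ℂ)) (rpow_mul_self_mul_rpow (κ := κ) hm)
    rw [← hc, hρm] at hrel
    push_cast at hrel hrel2
    have hexp : Complex.exp (σ * modelPhase κ m) * Complex.exp (-σ * modelPhase κ m) = 1 := by
      rw [← Complex.exp_add, neg_mul, add_neg_cancel, Complex.exp_zero]
    have hm0 : (m : ℂ) ≠ 0 := by exact_mod_cast hm.ne'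
    generalize ((m ^ ((κ : ℝ) / 2) : ℝ) : ℂ) = Y at *
    generalize ((m ^ (-(κ : ℝ) / 4) : ℝ) : ℂ) = A at *
    generalize Complex.exp (σ * modelPhase κ m) = E at *
    generalize Complex.exp (-σ * modelPhase κ m) = E' at *
    have hY : (ρ : ℂ) = A * A / m := by
      rw [eq_div_iff hm0]
      linear_combination A * A * hrel - ρ * m * hrel2
    have h3 : A * A * ρ / m = (ρ : ℂ) ^ 2 := by rw [sq]; nth_rewrite 2 [hY]; ring
    rw [← h3]
    linear_combination (A * A * (-2 * σ * Y * q ρ * k ρ + ((κ : ℂ) + 2) / 2 * (ρ / m)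
      * (deriv q ρ * k ρ - q ρ * deriv k ρ))) * hexp + (-2 * σ * q ρ * k ρ) * hrel2
  have hlim : Tendsto (fun ρ : ℝ => -2 * σ * q ρ * k ρ
      + ((κ : ℂ) + 2) / 2 * ((ρ : ℂ) ^ 2 * (deriv q ρ * k ρ - q ρ * deriv k ρ))) (𝓝[>] 0)
      (𝓝 (-2 * σ * q 0 * k 0 + ((κ : ℂ) + 2) / 2 * 0)) := by
    have hq0 : Tendsto q (𝓝[>] 0) (𝓝 (q 0)) :=
      (hq.1.continuousOn 0 self_mem_Ici).mono_left (nhdsWithin_mono _ Ioi_subset_Ici_self)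
    have hk0 : Tendsto k (𝓝[>] 0) (𝓝 (k 0)) :=
      (hk.1.continuousOn 0 self_mem_Ici).mono_left (nhdsWithin_mono _ Ioi_subset_Ici_self)
    have hq1 := iteratedDeriv_isBigO_one_of_contDiffOn_Ici hq.1 1
    have hk1 := iteratedDeriv_isBigO_one_of_contDiffOn_Ici hk.1 1
    rw [iteratedDeriv_one] at hq1 hk1
    have hb := (hq1.mul (hk0.isBigO_one ℝ)).sub ((hq0.isBigO_one ℝ).mul hk1)
    simp only [mul_one] at hb
    exact ((tendsto_const_nhds.mul hq0).mul hk0).add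
      ((isBigO_one_mul_tendsto_zero (tendsto_ofReal_pow_zero two_ne_zero) hb).const_mul _)
  rw [mul_zero, add_zero] at hlim
  refine tendsto_nhds_unique (tendsto_const_nhds.congr' ?_) hlim
  filter_upwards [self_mem_nhdsWithin] with ρ hρ using hform ρ hρ

end

section
variable {κ : ℤ} {σ : ℂ} {ς : ℝ} {α : ℂ} {Ψ : ℝ → ℂ}

theorem tendsto_rpow_neg_half_atTop (hκ : -1 ≤ κ) :
    Tendsto (fun l : ℝ => l ^ (-(((κ : ℝ) + 2) / 2))) atTop (𝓝[>] 0) := by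
  have hp := intCast_add_two_pos hκ
  refine tendsto_nhdsWithin_iff.2 ⟨tendsto_rpow_neg_atTop (by positivity), ?_⟩
  filter_upwards [eventually_gt_atTop 0] with l hl using Real.rpow_pos_of_pos hl _

/-- The leading amplitude at infinity as a limit. -/
theorem tendsto_amplitude (hκ : -1 ≤ κ) {Q q : ℝ → ℂ} (hq : IsExpAtInfinity κ σ q Q) :
    Tendsto (fun l : ℝ => ((l ^ ((κ : ℝ) / 4) : ℝ) : ℂ)
      * Complex.exp (-(σ * modelPhase κ l)) * Q l) atTop (𝓝 (q 0)) := by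
  rw [isExpAtInfinity_iff hκ] at hq
  have hq0 : Tendsto q (𝓝[>] 0) (𝓝 (q 0)) :=
    (hq.1.continuousOn 0 self_mem_Ici).mono_left (nhdsWithin_mono _ Ioi_subset_Ici_self)
  refine (hq0.comp (tendsto_rpow_neg_half_atTop hκ)).congr' ?_
  filter_upwards [eventually_gt_atTop 0] with l hl
  have h1 : Complex.exp (-(σ * modelPhase κ l)) * Complex.exp (σ * modelPhase κ l) = 1 := by
    rw [← Complex.exp_add, neg_add_cancel, Complex.exp_zero]
  have h2 : ((l ^ ((κ : ℝ) / 4) : ℝ) : ℂ) * ((l ^ (-(κ : ℝ) / 4) : ℝ) : ℂ) = 1 := by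
    rw [← Complex.ofReal_mul, ← Real.rpow_add hl,
      show (κ : ℝ) / 4 + -(κ : ℝ) / 4 = 0 by ring, Real.rpow_zero, Complex.ofReal_one]
  rw [hq.2 l hl, wkb, Function.comp]
  linear_combination (-q (l ^ (-(((κ : ℝ) + 2) / 2)))) * h1 -
    (Complex.exp (-(σ * modelPhase κ l)) * Complex.exp (σ * modelPhase κ l)
      * q (l ^ (-(((κ : ℝ) + 2) / 2)))) * h2

theorem exists_ne_zero_of_isExpAtInfinity (hκ : -1 ≤ κ) {Q q : ℝ → ℂ}
    (hq : IsExpAtInfinity κ σ q Q) (hq0 : q 0 ≠ 0) : ∃ l > (0 : ℝ), Q l ≠ 0 := by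
  by_contra! h
  refine hq0 (tendsto_nhds_unique (tendsto_amplitude hκ hq) (tendsto_const_nhds.congr' ?_))
  filter_upwards [eventually_gt_atTop 0] with l hl
  rw [h l hl, mul_zero]

/-- A solution whose growing amplitude vanishes at infinity is a multiple of the decaying one. -/
theorem eq_const_mul_of_amplitude_eq_zero (hκ : -1 ≤ κ) (hΨ : IsAdmissible κ Ψ) {Q R q k : ℝ → ℂ}
    (hQ : Q ∈ modelKernel ς κ α Ψ) (hR : R ∈ modelKernel ς κ α Ψ) (hq : IsExpAtInfinity κ σ q Q)
    (hk : IsExpAtInfinity κ (-σ) k R) (hk0 : k 0 ≠ 0) (hq0 : q 0 = 0) :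
    ∃ c : ℂ, ∀ l > (0 : ℝ), Q l = c * R l := by
  obtain ⟨l₀, hl₀, hne⟩ := exists_ne_zero_of_isExpAtInfinity hκ hk hk0
  refine eq_const_mul_of_wronskian_eq_zero hΨ.1 hQ hR hl₀ hne ?_
  rw [wronskian_eq hκ hQ hR hq hk hl₀, hq0]
  ring

/-- The decaying solution for `ς = 1`, and its characterization among all solutions. -/
theorem forbidden_case (hκ : -1 ≤ κ) (hΨ : IsAdmissible κ Ψ) :
    ∃ Qinf ∈ modelKernel 1 κ α Ψ,
      (∃ q, IsExpAtInfinity κ (-1) q Qinf ∧ q 0 ≠ 0) ∧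
      ∀ Q ∈ modelKernel 1 κ α Ψ,
        Tendsto (fun l : ℝ => ((l ^ ((κ : ℝ) / 4) : ℝ) : ℂ)
          * Complex.exp (-(modelPhase κ l : ℂ)) * Q l) atTop (𝓝 0) →
        ∃ c : ℂ, ∀ l > (0 : ℝ), Q l = c * Qinf l := by
  obtain ⟨Qinf, hQinf, k, hk, hk0⟩ := exists_wkb_solution (σ := -1) (ς := 1) (α := α) hκ (by simp)
    (by simp) (by simp) hΨ
  have hk1 : k 0 ≠ 0 := by rw [hk0]; exact one_ne_zero
  refine ⟨Qinf, hQinf, ⟨k, hk, hk1⟩, fun Q hQ hlim => ?_⟩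
  obtain ⟨q, hq⟩ := exists_growing_form hκ hΨ hQ
  have hq0 := tendsto_amplitude hκ hq
  simp only [one_mul] at hq0
  exact eq_const_mul_of_amplitude_eq_zero hκ hΨ hQ hQinf hq hk hk1 (tendsto_nhds_unique hq0 hlim)

/-- The two oscillating solutions for `ς = -1` span the solution space: their Wronskian is not
zero, and the coefficients of a third solution are quotients of Wronskians. -/
theorem allowed_case (hκ : -1 ≤ κ) (hΨ : IsAdmissible κ Ψ) :
    ∃ Qp ∈ modelKernel (-1) κ α Ψ, ∃ Qm ∈ modelKernel (-1) κ α Ψ,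
      (∃ q, IsExpAtInfinity κ Complex.I q Qp ∧ q 0 ≠ 0) ∧
      (∃ q, IsExpAtInfinity κ (-Complex.I) q Qm ∧ q 0 ≠ 0) ∧
      ∀ Q ∈ modelKernel (-1) κ α Ψ, ∃ c d : ℂ, ∀ l > (0 : ℝ), Q l = c * Qp l + d * Qm l := by
  obtain ⟨Qp, hQp, q, hq, hq0⟩ := exists_wkb_solution (σ := Complex.I) (ς := -1) (α := α) hκ
    (by simp) (by simp) (by simp) hΨ
  obtain ⟨Qm, hQm, k, hk, hk0⟩ := exists_wkb_solution (σ := -Complex.I) (ς := -1) (α := α) hκ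
    (by simp) (by simp) (by simp) hΨ
  refine ⟨Qp, hQp, Qm, hQm, ⟨q, hq, by simp [hq0]⟩, ⟨k, hk, by simp [hk0]⟩, fun Q hQ => ?_⟩
  have hW : ∀ {A B : ℝ → ℂ}, A ∈ modelKernel (-1) κ α Ψ → B ∈ modelKernel (-1) κ α Ψ →
      ∀ l > (0 : ℝ), A l * deriv B l - deriv A l * B l = A 1 * deriv B 1 - deriv A 1 * B 1 :=
    fun {A B} hA hB l hl => wronskian_const isOpen_Ioi (convex_Ioi 0)
      (U := modelPotential (-1) κ α Ψ)
      (fun y hy => hasDerivAt_of_mem_modelKernel hA hy)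
      (fun y hy => hasDerivAt_deriv_of_mem_modelKernel hA hy)
      (fun y hy => hasDerivAt_of_mem_modelKernel hB hy)
      (fun y hy => hasDerivAt_deriv_of_mem_modelKernel hB hy) (show l ∈ Ioi 0 from hl)
      (by simp : (1 : ℝ) ∈ Ioi 0)
  refine ⟨(Q 1 * deriv Qm 1 - deriv Q 1 * Qm 1) / (-2 * Complex.I),
    (Qp 1 * deriv Q 1 - deriv Qp 1 * Q 1) / (-2 * Complex.I), fun l hl => ?_⟩
  rw [← hW hQ hQm l hl, ← hW hQp hQ l hl]
  have h := wronskian_eq hκ hQp hQm hq hk hl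
  rw [hq0, hk0, mul_one, mul_one] at h
  have hI : -2 * Complex.I ≠ 0 := mul_ne_zero (by norm_num) Complex.I_ne_zero
  rw [← h] at hI ⊢
  rw [div_mul_eq_mul_div, div_mul_eq_mul_div, ← add_div, eq_div_iff hI]
  ring

end

/-! ### Expansions in one variable -/

theorem bDeriv_congr {U : Set ℝ} (hU : IsOpen U) {f g : ℝ → ℂ} (h : EqOn f g U) :
    EqOn (bDeriv f) (bDeriv g) U := fun x hx => by
  rw [bDeriv, bDeriv, (h.eventuallyEq_of_mem (hU.mem_nhds hx)).deriv_eq]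

theorem bDeriv_iterate_congr {U : Set ℝ} (hU : IsOpen U) {f g : ℝ → ℂ} (h : EqOn f g U) (m : ℕ) :
    EqOn (bDeriv^[m] f) (bDeriv^[m] g) U := by
  induction m generalizing f g with
  | zero => exact h
  | succ m ih => exact ih (bDeriv_congr hU h)

theorem logMonomial_zero (x : ℝ) : logMonomial (0, 0) x = 1 := by simp [logMonomial]

theorem abs_log_pow_mul_rpow_le {a b : ℝ} (hab : a < b) (k : ℕ) :
    ∃ C : ℝ, ∀ x ∈ Ioo (0 : ℝ) 1, |Real.log x| ^ k * x ^ b ≤ C * x ^ a := by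
  set t := (b - a) / (k + 1) with ht
  have ht0 : 0 < t := div_pos (by linarith) (by positivity)
  refine ⟨(1 / t) ^ k, fun x hx => ?_⟩
  have h1 := (Real.abs_log_mul_self_rpow_lt x t hx.1 hx.2.le ht0).le
  rw [abs_mul, abs_of_pos (Real.rpow_pos_of_pos hx.1 t)] at h1
  have h2 : x ^ b = (x ^ t) ^ k * x ^ (t + a) := by
    rw [← Real.rpow_natCast, ← Real.rpow_mul hx.1.le, ← Real.rpow_add hx.1]
    congr 1
    rw [ht]
    field_simp
    ring
  rw [h2, ← mul_assoc, ← mul_pow]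
  have h3 : x ^ (t + a) ≤ x ^ a :=
    Real.rpow_le_rpow_of_exponent_ge hx.1 hx.2.le (by linarith)
  have := Real.rpow_nonneg hx.1.le t
  exact mul_le_mul (pow_le_pow_left₀ (by positivity) h1 k) h3 (Real.rpow_nonneg hx.1.le _)
    (by positivity)

/-- Finite sums of functions `x ^ j (log x) ^ k S (x ^ (1 / d))` with `Re j > a` and `S` smooth up
to `0`. All of them are conormal of order `a`, and the class is closed under `x ∂ₓ`. -/
inductive IsTermSum (d : ℕ) (a : ℝ) : (ℝ → ℂ) → Prop
  | term (j : ℂ) (k : ℕ) (S : ℝ → ℂ) (hj : a < j.re) (hS : ContDiffOn ℝ ∞ S (Ici 0)) :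
      IsTermSum d a fun x => (x : ℂ) ^ j * (Real.log x : ℂ) ^ k * S (x ^ (1 / (d : ℝ)))
  | add (f g : ℝ → ℂ) (hf : IsTermSum d a f) (hg : IsTermSum d a g) :
      IsTermSum d a fun x => f x + g x

section
variable {d : ℕ} {a : ℝ} {f g : ℝ → ℂ}

theorem contDiffOn_term (d : ℕ) (j : ℂ) (k : ℕ) {S : ℝ → ℂ} (hS : ContDiffOn ℝ ∞ S (Ioi 0)) :
    ContDiffOn ℝ ∞ (fun x : ℝ => (x : ℂ) ^ j * (Real.log x : ℂ) ^ k * S (x ^ (1 / (d : ℝ))))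
      (Ioi 0) := by
  have hlog : ContDiffOn ℝ ∞ (fun x : ℝ => (Real.log x : ℂ)) (Ioi 0) :=
    Complex.ofRealCLM.contDiff.comp_contDiffOn
      (Real.contDiffOn_log.mono fun x hx => ne_of_gt (show (0 : ℝ) < x from hx))
  have hpow : ContDiffOn ℝ ∞ (fun x : ℝ => x ^ (1 / (d : ℝ))) (Ioi 0) := fun x hx =>
    (Real.contDiffAt_rpow_const_of_ne (ne_of_gt hx)).contDiffWithinAt
  exact ((contDiffOn_cpow_Ioi j).mul (hlog.pow k)).mul
    (hS.comp hpow fun x hx => Real.rpow_pos_of_pos hx _)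

theorem IsTermSum.contDiffOn (h : IsTermSum d a f) : ContDiffOn ℝ ∞ f (Ioi 0) := by
  induction h with
  | term j k S hj hS => exact contDiffOn_term d j k (hS.mono Ioi_subset_Ici_self)
  | add f g hf hg ihf ihg => exact ihf.add ihg

theorem hasDerivAt_term (d : ℕ) (j : ℂ) (k : ℕ) {S : ℝ → ℂ} (hS : ContDiffOn ℝ ∞ S (Ici 0)) {x : ℝ}
    (hx : 0 < x) :
    HasDerivAt (fun x : ℝ => (x : ℂ) ^ j * (Real.log x : ℂ) ^ k * S (x ^ (1 / (d : ℝ))))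
      ((j * ((x : ℂ) ^ j * (Real.log x : ℂ) ^ k * S (x ^ (1 / (d : ℝ))))
        + k * ((x : ℂ) ^ j * (Real.log x : ℂ) ^ (k - 1) * S (x ^ (1 / (d : ℝ))))
        + (x : ℂ) ^ j * (Real.log x : ℂ) ^ k * ((1 / (d : ℝ) : ℝ) * ((x ^ (1 / (d : ℝ)) : ℝ) : ℂ)
          * derivWithin S (Ici 0) (x ^ (1 / (d : ℝ))))) / x) x := by
  have hx0 : (x : ℂ) ≠ 0 := by exact_mod_cast hx.ne'
  have h1 := (hasDerivAt_cpow_of_pos j hx).mul ((Real.hasDerivAt_log hx.ne').ofReal_comp.pow k)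
  have h2 := hasDerivAt_comp_rpow (q := S) (q₁ := derivWithin S (Ici 0))
    (fun y hy => hasDerivAt_of_contDiffOn_Ici hS hy) (1 / (d : ℝ)) hx
  refine (h1.mul h2).congr_deriv ?_
  rw [Complex.cpow_sub _ _ hx0, Complex.cpow_one]
  simp only [Pi.mul_apply, Pi.pow_apply]
  push_cast
  field_simp

theorem IsTermSum.exists_bDeriv (h : IsTermSum d a f) :
    ∃ f', IsTermSum d a f' ∧ ∀ x > (0 : ℝ), bDeriv f x = f' x := by
  induction h with
  | term j k S hj hS =>
    refine ⟨_, .add _ _ (.add _ _ (.term j k (fun t => j * S t) hj (contDiffOn_const.mul hS))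
      (.term j (k - 1) (fun t => k * S t) hj (contDiffOn_const.mul hS)))
      (.term j k (fun t => (1 / (d : ℝ) : ℝ) * (t : ℂ) * derivWithin S (Ici 0) t) hj
        ((contDiffOn_const.mul contDiffOn_ofReal).mul (contDiffOn_derivWithin_Ici hS))),
      fun x hx => ?_⟩
    have hx0 : (x : ℂ) ≠ 0 := by exact_mod_cast (ne_of_gt hx)
    rw [bDeriv, (hasDerivAt_term d j k hS hx).deriv]
    field_simp
  | add f g hf hg ihf ihg =>
    obtain ⟨f', hf', hff'⟩ := ihf
    obtain ⟨g', hg', hgg'⟩ := ihg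
    refine ⟨_, .add _ _ hf' hg', fun x hx => ?_⟩
    rw [← hff' x hx, ← hgg' x hx, bDeriv, bDeriv, bDeriv, ((hasDerivAt_of_contDiffOn_Ioi
      hf.contDiffOn hx).fun_add (hasDerivAt_of_contDiffOn_Ioi hg.contDiffOn hx)).deriv]
    ring

theorem IsTermSum.exists_bound (h : IsTermSum d a f) :
    ∃ C : ℝ, ∀ x ∈ Ioo (0 : ℝ) 1, ‖f x‖ ≤ C * x ^ a := by
  induction h with
  | term j k S hj hS =>
    obtain ⟨M, hM⟩ := exists_bound_Ioc_of_continuousOn hS.continuousOn 1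
    obtain ⟨C, hC⟩ := abs_log_pow_mul_rpow_le hj k
    refine ⟨C * M, fun x hx => ?_⟩
    have h1 := hM (x ^ (1 / (d : ℝ))) ⟨Real.rpow_nonneg hx.1.le _,
      Real.rpow_le_one hx.1.le hx.2.le (by positivity)⟩
    rw [norm_mul, norm_mul, norm_pow, Complex.norm_cpow_eq_rpow_re_of_pos hx.1, Complex.norm_real,
      Real.norm_eq_abs, mul_comm (x ^ j.re)]
    calc _ ≤ C * x ^ a * M := mul_le_mul (hC x hx) h1 (norm_nonneg _) ((mul_nonneg (by positivity)
            (Real.rpow_nonneg hx.1.le _)).trans (hC x hx))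
      _ = _ := by ring
  | add f g hf hg ihf ihg =>
    obtain ⟨C, hC⟩ := ihf
    obtain ⟨D, hD⟩ := ihg
    refine ⟨C + D, fun x hx => (norm_add_le _ _).trans ?_⟩
    linarith [hC x hx, hD x hx]

theorem IsTermSum.conormal (h : IsTermSum d a f) (m : ℕ) :
    ∃ C : ℝ, ∀ x ∈ Ioo (0 : ℝ) 1, ‖(bDeriv^[m] f) x‖ ≤ C * x ^ a := by
  induction m generalizing f with
  | zero => exact h.exists_bound
  | succ m ih =>
    obtain ⟨f', hf', hff'⟩ := h.exists_bDeriv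
    obtain ⟨C, hC⟩ := ih hf'
    refine ⟨C, fun x hx => ?_⟩
    rw [Function.iterate_succ_apply, bDeriv_iterate_congr isOpen_Ioi (fun x hx => hff' x hx) m
      (show x ∈ Ioi (0 : ℝ) from hx.1)]
    exact hC x hx

theorem IsTermSum.sum {ι : Type*} (T : Finset ι) (F : ι → ℝ → ℂ)
    (h : ∀ i ∈ T, IsTermSum d a (F i)) : IsTermSum d a fun x => ∑ i ∈ T, F i x := by
  classical
  induction T using Finset.induction_on with
  | empty =>
    have := IsTermSum.term (d := d) (a := a) ((a + 1 : ℝ) : ℂ) 0 (fun _ => 0) (by simp)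
      contDiffOn_const
    simpa using this
  | insert i T hi ih =>
    simp only [Finset.sum_insert hi]
    exact .add _ _ (h i (Finset.mem_insert_self i T))
      (ih fun j hj => h j (Finset.mem_insert_of_mem hj))

theorem isTermSum_logMonomial {e : ℂ × ℕ} (he : a < e.1.re) (c : ℂ) :
    IsTermSum d a fun x => c * logMonomial e x := by
  have := IsTermSum.term (d := d) (a := a) e.1 e.2 (fun _ => c) he contDiffOn_const
  refine (congrArg (IsTermSum d a) (funext fun x => ?_)).mp this
  rw [logMonomial]
  ring

end

section
variable {E E' : IndexSet} {c c' : ℂ × ℕ → ℂ} {ε : ℝ} {f g : ℝ → ℂ}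

theorem IndexSet.mem_upTo {a : ℝ} {e : ℂ × ℕ} :
    e ∈ E.upTo a ↔ e ∈ E.carrier ∧ e.1.re ≤ a := by
  simp [IndexSet.upTo]

/-- For an expansion it is enough to find, for each order `a`, a finite part of the index set
containing all exponents up to `a` with nonzero coefficients such that the remainder is a sum of
terms of orders above `a`. -/
theorem hasExpansion_of_isTermSum (d : ℕ) (hε : ε ≤ 1) (hg : ContDiffOn ℝ ∞ g (Ioo 0 ε))
    (h : ∀ a : ℝ, ∃ T : Finset (ℂ × ℕ), (∀ e ∈ T, e ∈ E.carrier) ∧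
      (∀ e ∈ E.carrier, e.1.re ≤ a → e ∉ T → c e = 0) ∧
      ∃ R, IsTermSum d a R ∧ ∀ x ∈ Ioo 0 ε, g x = ∑ e ∈ T, c e * logMonomial e x + R x) :
    HasExpansion E c ε g := by
  classical
  refine ⟨hg, fun a m => ?_⟩
  obtain ⟨T, hTE, hT, R, hR, hgR⟩ := h a
  obtain ⟨C, hC⟩ := (IsTermSum.add _ _ (IsTermSum.sum (d := d) (a := a)
    (T.filter fun e => ¬ e.1.re ≤ a) (fun e x => c e * logMonomial e x) fun e he =>
      isTermSum_logMonomial (not_le.1 (Finset.mem_filter.1 he).2) _) hR).conormal m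
  refine ⟨C, fun x hx => ?_⟩
  rw [bDeriv_iterate_congr isOpen_Ioo (fun y hy => ?_) m hx]
  · exact hC x ⟨hx.1, hx.2.trans_le hε⟩
  · have h1 : ∑ e ∈ E.upTo a, c e * logMonomial e y
        = ∑ e ∈ T.filter (fun e => e.1.re ≤ a), c e * logMonomial e y := by
      refine (Finset.sum_subset (fun e he => ?_) fun e he hne => ?_).symm
      · rw [Finset.mem_filter] at he
        exact IndexSet.mem_upTo.2 ⟨hTE e he.1, he.2⟩
      · rw [IndexSet.mem_upTo] at he
        rw [hT e he.1 he.2 (fun h => hne (Finset.mem_filter.2 ⟨h, he.2⟩)), zero_mul]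
    rw [hgR y hy, h1, ← Finset.sum_filter_add_sum_filter_not T (fun e => e.1.re ≤ a)]
    ring

theorem HasExpansion.congr (h : HasExpansion E c ε f) (hfg : ∀ x ∈ Ioo 0 ε, g x = f x) :
    HasExpansion E c ε g := by
  refine ⟨h.1.congr hfg, fun a m => ?_⟩
  obtain ⟨C, hC⟩ := h.2 a m
  refine ⟨C, fun x hx => ?_⟩
  rw [bDeriv_iterate_congr isOpen_Ioo (fun y hy => ?_) m hx]
  · exact hC x hx
  · simp only [hfg y hy]

theorem HasExpansion.mono_right {δ : ℝ} (h : HasExpansion E c ε f) (hδ : δ ≤ ε) :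
    HasExpansion E c δ f :=
  ⟨h.1.mono (Ioo_subset_Ioo_right hδ), fun a m => (h.2 a m).imp fun _ hC x hx =>
    hC x ⟨hx.1, hx.2.trans_le hδ⟩⟩

theorem contDiffOn_logMonomial (e : ℂ × ℕ) : ContDiffOn ℝ ∞ (logMonomial e) (Ioi 0) := by
  simpa using! contDiffOn_term 1 e.1 e.2 (S := fun _ => 1) contDiffOn_const

theorem contDiffOn_remainder (hf : ContDiffOn ℝ ∞ f (Ioo 0 ε)) (T : Finset (ℂ × ℕ))
    (c : ℂ × ℕ → ℂ) :
    ContDiffOn ℝ ∞ (fun t => f t - ∑ e ∈ T, c e * logMonomial e t) (Ioo 0 ε) :=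
  hf.sub (ContDiffOn.sum fun e _ => contDiffOn_const.mul
    ((contDiffOn_logMonomial e).mono Ioo_subset_Ioi_self))

theorem contDiffOn_bDeriv {U : Set ℝ} (hU : IsOpen U) (hf : ContDiffOn ℝ ∞ f U) :
    ContDiffOn ℝ ∞ (bDeriv f) U :=
  contDiffOn_ofReal.mul ((contDiffOn_infty_iff_deriv_of_isOpen hU).1 hf).2

theorem bDeriv_iterate_add {U : Set ℝ} (hU : IsOpen U) (hf : ContDiffOn ℝ ∞ f U)
    (hg : ContDiffOn ℝ ∞ g U) (m : ℕ) :
    EqOn (bDeriv^[m] fun x => f x + g x) (fun x => (bDeriv^[m] f) x + (bDeriv^[m] g) x) U := by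
  induction m generalizing f g with
  | zero => exact fun _ _ => rfl
  | succ m ih =>
    intro x hx
    simp only [Function.iterate_succ_apply]
    refine Eq.trans ?_ (ih (contDiffOn_bDeriv hU hf) (contDiffOn_bDeriv hU hg) hx)
    refine bDeriv_iterate_congr hU (fun y hy => ?_) m hx
    have hd : ∀ {f : ℝ → ℂ}, ContDiffOn ℝ ∞ f U → HasDerivAt f (deriv f y) y := fun hf =>
      ((hf.differentiableOn (by simp) y hy).differentiableAt (hU.mem_nhds hy)).hasDerivAt
    rw [bDeriv, bDeriv, bDeriv, ((hd hf).fun_add (hd hg)).deriv]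
    ring

theorem HasExpansion.add (hf : HasExpansion E c ε f) (hg : HasExpansion E c' ε g) :
    HasExpansion E (fun e => c e + c' e) ε fun x => f x + g x := by
  refine ⟨hf.1.add hg.1, fun a m => ?_⟩
  obtain ⟨C, hC⟩ := hf.2 a m
  obtain ⟨D, hD⟩ := hg.2 a m
  refine ⟨C + D, fun x hx => ?_⟩
  have h : ∀ t, (f t + g t - ∑ e ∈ E.upTo a, (c e + c' e) * logMonomial e t)
      = (f t - ∑ e ∈ E.upTo a, c e * logMonomial e t)
        + (g t - ∑ e ∈ E.upTo a, c' e * logMonomial e t) := fun t => by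
    simp only [add_mul, Finset.sum_add_distrib]
    ring
  simp only [h]
  rw [bDeriv_iterate_add isOpen_Ioo (contDiffOn_remainder hf.1 _ _)
    (contDiffOn_remainder hg.1 _ _) m hx, add_mul]
  exact (norm_add_le _ _).trans (add_le_add (hC x hx) (hD x hx))

/-- The Taylor coefficients and remainders of a function smooth up to `0`. -/
theorem exists_taylor_remainders {S : ℝ → ℂ} (hS : ContDiffOn ℝ ∞ S (Ici 0)) :
    ∃ T : ℕ → ℝ → ℂ, T 0 = S ∧ (∀ n, ContDiffOn ℝ ∞ (T n) (Ici 0)) ∧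
      ∀ N : ℕ, ∀ x ≥ (0 : ℝ), S x = ∑ n ∈ Finset.range N, T n 0 * (x : ℂ) ^ n + x ^ N * T N x := by
  choose! H hH hHe using fun f : ℝ → ℂ => exists_eq_add_mul (f := f)
  have hT : ∀ n, ContDiffOn ℝ ∞ (H^[n] S) (Ici 0) := fun n => by
    induction n with
    | zero => exact hS
    | succ n ih =>
      rw [Function.iterate_succ_apply']
      exact hH _ ih
  refine ⟨fun n => H^[n] S, rfl, hT, fun N x hx => ?_⟩
  induction N with
  | zero => simp
  | succ N ih =>
    beta_reduce at ih ⊢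
    rw [ih, Finset.sum_range_succ, hHe _ (hT N) x hx, Function.iterate_succ_apply']
    ring

theorem cpow_add_div_mul (j : ℂ) {d : ℕ} (n : ℕ) {x : ℝ} (hx : 0 < x) :
    (x : ℂ) ^ (j + n / d) = (x : ℂ) ^ j * ((x ^ (1 / (d : ℝ)) : ℝ) : ℂ) ^ n := by
  have hx0 : (x : ℂ) ≠ 0 := by exact_mod_cast hx.ne'
  rw [Complex.cpow_add _ _ hx0, ← Complex.ofReal_pow, ← Real.rpow_natCast, ← Real.rpow_mul hx.le,
    Complex.ofReal_cpow hx.le]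
  congr 2
  push_cast
  ring

/-- The expansion of `x ^ j (log x) ^ k S (x ^ (1 / d))` for `S` smooth up to `0`. -/
theorem exists_hasExpansion_term {d : ℕ} (hd : 0 < d) {j : ℂ} {k : ℕ} {S : ℝ → ℂ}
    (hS : ContDiffOn ℝ ∞ S (Ici 0)) (hE : ∀ n : ℕ, (j + n / d, k) ∈ E.carrier) :
    ∃ c, c (j, k) = S 0 ∧ HasExpansion E c 1
      fun x : ℝ => (x : ℂ) ^ j * (Real.log x : ℂ) ^ k * S (x ^ (1 / (d : ℝ))) := by
  obtain ⟨T, hT0, hT, hTS⟩ := exists_taylor_remainders hS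
  set φ : ℕ → ℂ × ℕ := fun n => (j + n / d, k) with hφ
  have hdc : (d : ℂ) ≠ 0 := by exact_mod_cast hd.ne'
  have hφi : Function.Injective φ := fun n m h => by
    have := (Prod.ext_iff.1 h).1
    simp only [hφ, add_right_inj, div_left_inj' hdc] at this
    exact_mod_cast this
  set c : ℂ × ℕ → ℂ := Function.extend φ (fun n => T n 0) 0 with hc
  have hcφ : ∀ n, c (φ n) = T n 0 := fun n => hφi.extend_apply _ _ n
  have hre : ∀ n : ℕ, (j + n / d : ℂ).re = j.re + n / d := fun n => by
    rw [Complex.add_re, ← Complex.ofReal_natCast, ← Complex.ofReal_natCast, ← Complex.ofReal_div,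
      Complex.ofReal_re]
  have hdr : (0 : ℝ) < d := by exact_mod_cast hd
  refine ⟨c, ?_, hasExpansion_of_isTermSum d le_rfl
    ((contDiffOn_term d j k (hS.mono Ioi_subset_Ici_self)).mono Ioo_subset_Ioi_self) fun a => ?_⟩
  · have := hcφ 0
    simpa [hφ, hT0] using this
  · obtain ⟨N, hN⟩ := exists_nat_gt (d * (a - j.re))
    have hNa : ∀ n : ℕ, N ≤ n → a < j.re + n / d := fun n hn => by
      have h1 : (N : ℝ) ≤ n := by exact_mod_cast hn
      have h2 : a - j.re < n / d := by
        rw [lt_div_iff₀ hdr, mul_comm]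
        linarith
      linarith
    refine ⟨(Finset.range N).map ⟨φ, hφi⟩, fun e he => ?_, fun e _ hea heT => ?_,
      fun x => (x : ℂ) ^ (j + N / d) * (Real.log x : ℂ) ^ k * T N (x ^ (1 / (d : ℝ))),
      .term _ _ _ (by rw [hre]; exact hNa N le_rfl) (hT N), fun x hx => ?_⟩
    · obtain ⟨n, -, rfl⟩ := Finset.mem_map.1 he
      exact hE n
    · refine Function.extend_apply' _ _ _ ?_
      rintro ⟨n, rfl⟩
      have hn : N ≤ n := by
        by_contra h
        exact heT (Finset.mem_map.2 ⟨n, Finset.mem_range.2 (not_le.1 h), rfl⟩)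
      have := hNa n hn
      rw [← hre] at this
      exact absurd hea (not_le.2 this)
    · beta_reduce
      rw [Finset.sum_map, hTS N _ (Real.rpow_nonneg hx.1.le _), mul_add, Finset.mul_sum,
        cpow_add_div_mul (d := d) j N hx.1]
      congr 1
      · refine Finset.sum_congr rfl fun n _ => ?_
        simp only [Function.Embedding.coeFn_mk, hcφ]
        simp only [hφ, logMonomial, cpow_add_div_mul j n hx.1]
        ring
      · ring

end

/-! ### The expansion at zero -/

theorem exists_hasExpansion_of_mem_modelKernel {κ : ℤ} {ς : ℝ} {α : ℂ} {Ψ Q : ℝ → ℂ} (hκ : -1 ≤ κ)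
    (hα : 0 ≤ α.re) (hΨ : IsAdmissible κ Ψ) (hQ : Q ∈ modelKernel ς κ α Ψ) :
    ∃ ε > 0, ε ≤ 1 ∧ ∃ c, HasExpansion (rootIndexSet α) c ε Q := by
  obtain ⟨ε, hε, S₁, S₂, S₃, h₁, h₂, h₃, h0, h⟩ := exists_local_terms hκ hα hΨ hQ
  obtain ⟨c₁, -, hc₁⟩ := exists_hasExpansion_term (E := rootIndexSet α) (d := 1) (j := 1 / 2 - α)
    (k := 0) one_pos h₁ fun n => Or.inl ⟨⟨n, by simp⟩, le_rfl⟩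
  obtain ⟨c₂, -, hc₂⟩ := exists_hasExpansion_term (E := rootIndexSet α) (d := 1) (j := 1 / 2 + α)
    (k := 0) one_pos h₂ fun n => Or.inr ⟨⟨n, by simp⟩, Nat.zero_le _⟩
  have h₁₂ := hc₁.add hc₂
  refine ⟨min ε 1, lt_min hε one_pos, min_le_right _ _, ?_⟩
  have hle : ∀ x ∈ Ioo 0 (min ε 1), x ∈ Ioo 0 ε := fun x hx => ⟨hx.1, hx.2.trans_le (min_le_left
      _ _)⟩
  by_cases hm : ∃ m : ℤ, 2 * α = m
  · obtain ⟨c₃, -, hc₃⟩ := exists_hasExpansion_term (E := rootIndexSet α) (d := 1) (j := 1 / 2 + α)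
      (k := 1) one_pos h₃ fun n => Or.inr ⟨⟨n, by simp⟩, by simp [hm]⟩
    refine ⟨_, ((h₁₂.add hc₃).mono_right (min_le_right _ _)).congr fun x hx => ?_⟩
    simp [h x (hle x hx)]
  · refine ⟨_, (h₁₂.mono_right (min_le_right _ _)).congr fun x hx => ?_⟩
    simp [h x (hle x hx), h0 hm]

/-! ### Expansions at a boundary hypersurface -/

section
variable {I J : Set ℝ} {f g : ℝ → ℝ → ℂ}

theorem bDerivFst_congr (hI : IsOpen I) (h : ∀ x ∈ I, ∀ y ∈ J, f x y = g x y) :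
    ∀ x ∈ I, ∀ y ∈ J, bDerivFst f x y = bDerivFst g x y := fun x hx y hy => by
  rw [bDerivFst, bDerivFst, (EqOn.eventuallyEq_of_mem (s := I) (f := fun t => f t y)
    (g := fun t => g t y) (fun t ht => h t ht y hy) (hI.mem_nhds hx)).deriv_eq]

theorem derivSnd_congr (hJ : IsOpen J) (h : ∀ x ∈ I, ∀ y ∈ J, f x y = g x y) :
    ∀ x ∈ I, ∀ y ∈ J, derivSnd f x y = derivSnd g x y := fun x hx y hy => by
  rw [derivSnd, derivSnd, (EqOn.eventuallyEq_of_mem (s := J) (f := f x) (g := g x)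
    (fun t ht => h x hx t ht) (hJ.mem_nhds hy)).deriv_eq]

theorem bDerivSnd_congr (hJ : IsOpen J) (h : ∀ x ∈ I, ∀ y ∈ J, f x y = g x y) :
    ∀ x ∈ I, ∀ y ∈ J, bDerivSnd f x y = bDerivSnd g x y := fun x hx y hy =>
  congrArg (fun w : ℂ => (y : ℂ) * w) (derivSnd_congr hJ h x hx y hy)

theorem iterate_congr {D : (ℝ → ℝ → ℂ) → ℝ → ℝ → ℂ} (hD : ∀ f g : ℝ → ℝ → ℂ,
    (∀ x ∈ I, ∀ y ∈ J, f x y = g x y) → ∀ x ∈ I, ∀ y ∈ J, D f x y = D g x y)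
    (h : ∀ x ∈ I, ∀ y ∈ J, f x y = g x y) (m : ℕ) :
    ∀ x ∈ I, ∀ y ∈ J, (D^[m] f) x y = (D^[m] g) x y := by
  induction m generalizing f g with
  | zero => exact h
  | succ m ih => exact ih (hD _ _ h)

theorem bDerivFst_derivSnd_congr (hI : IsOpen I) (hJ : IsOpen J)
    (h : ∀ x ∈ I, ∀ y ∈ J, f x y = g x y) (m n : ℕ) :
    ∀ x ∈ I, ∀ y ∈ J, (bDerivFst^[m] (derivSnd^[n] f)) x y = (bDerivFst^[m] (derivSnd^[n] g)) x y :=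
  iterate_congr (fun _ _ => bDerivFst_congr hI)
    (iterate_congr (fun _ _ => derivSnd_congr hJ) h n) m

theorem bDerivFst_bDerivSnd_congr (hI : IsOpen I) (hJ : IsOpen J)
    (h : ∀ x ∈ I, ∀ y ∈ J, f x y = g x y) (m n : ℕ) :
    ∀ x ∈ I, ∀ y ∈ J,
      (bDerivFst^[m] (bDerivSnd^[n] f)) x y = (bDerivFst^[m] (bDerivSnd^[n] g)) x y :=
  iterate_congr (fun _ _ => bDerivFst_congr hI)
    (iterate_congr (fun _ _ => bDerivSnd_congr hJ) h n) m

/-- A class of functions that are `O (x ^ r)` and that is closed under `x ∂ₓ` and `∂_y` consists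
of conormal functions of order `r`. -/
theorem exists_bound_of_closed (hI : IsOpen I) (hJ : IsOpen J) (hI0 : I ⊆ Ioi 0) {r : ℝ}
    (P : (ℝ → ℝ → ℂ) → Prop)
    (h0 : ∀ g, P g → ∃ C : ℝ, ∀ x ∈ I, ∀ y ∈ J, ‖g x y‖ ≤ C * x ^ r)
    (h1 : ∀ g, P g → ∃ g', P g' ∧ ∀ x ∈ I, ∀ y ∈ J, HasDerivAt (fun t => g t y) (g' x y / x) x)
    (h2 : ∀ g, P g → ∃ g', P g' ∧ ∀ x ∈ I, ∀ y ∈ J, HasDerivAt (g x) (g' x y) y)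
    (hg : P g) (m n : ℕ) :
    ∃ C : ℝ, ∀ x ∈ I, ∀ y ∈ J, ‖(bDerivFst^[m] (derivSnd^[n] g)) x y‖ ≤ C * x ^ r := by
  have hn : ∃ g', P g' ∧ ∀ x ∈ I, ∀ y ∈ J, (derivSnd^[n] g) x y = g' x y := by
    induction n with
    | zero => exact ⟨g, hg, fun _ _ _ _ => rfl⟩
    | succ n ih =>
      obtain ⟨g', hg', h⟩ := ih
      obtain ⟨g'', hg'', h'⟩ := h2 g' hg'
      refine ⟨g'', hg'', fun x hx y hy => ?_⟩
      rw [Function.iterate_succ_apply', derivSnd_congr hJ h x hx y hy]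
      exact (h' x hx y hy).deriv
  have hm : ∃ g', P g' ∧ ∀ x ∈ I, ∀ y ∈ J, (bDerivFst^[m] (derivSnd^[n] g)) x y = g' x y := by
    induction m with
    | zero => exact hn
    | succ m ih =>
      obtain ⟨g', hg', h⟩ := ih
      obtain ⟨g'', hg'', h'⟩ := h1 g' hg'
      refine ⟨g'', hg'', fun x hx y hy => ?_⟩
      have hx0 : (x : ℂ) ≠ 0 := by exact_mod_cast (ne_of_gt (hI0 hx))
      rw [Function.iterate_succ_apply', bDerivFst_congr hI h x hx y hy, bDerivFst,
        (h' x hx y hy).deriv, mul_div_cancel₀ _ hx0]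
  obtain ⟨g', hg', h⟩ := hm
  obtain ⟨C, hC⟩ := h0 g' hg'
  exact ⟨C, fun x hx y hy => (h x hx y hy) ▸ hC x hx y hy⟩

end

theorem IsPolyhomogeneousAtFace.congr {E : IndexSet} {y₀ δ : ℝ} {f g : ℝ → ℝ → ℂ}
    (h : IsPolyhomogeneousAtFace E y₀ f) (hδ : 0 < δ)
    (hfg : ∀ x ∈ Ioo 0 δ, ∀ y ∈ Ioo (y₀ - δ) (y₀ + δ), g x y = f x y) :
    IsPolyhomogeneousAtFace E y₀ g := by
  obtain ⟨ε, hε, a, hf, ha, hr⟩ := h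
  have hI : Ioo 0 (min ε δ) ⊆ Ioo 0 ε := Ioo_subset_Ioo_right (min_le_left _ _)
  have hJ : Ioo (y₀ - min ε δ) (y₀ + min ε δ) ⊆ Ioo (y₀ - ε) (y₀ + ε) :=
    Ioo_subset_Ioo (by linarith [min_le_left ε δ]) (by linarith [min_le_left ε δ])
  have hfg' : ∀ x ∈ Ioo 0 (min ε δ), ∀ y ∈ Ioo (y₀ - min ε δ) (y₀ + min ε δ), g x y = f x y :=
    fun x hx y hy => hfg x ⟨hx.1, hx.2.trans_le (min_le_right _ _)⟩ y
      ⟨by linarith [hy.1, min_le_right ε δ], by linarith [hy.2, min_le_right ε δ]⟩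
  refine ⟨min ε δ, lt_min hε hδ, a, (hf.mono (prod_mono hI hJ)).congr fun q hq =>
    hfg' q.1 hq.1 q.2 hq.2, fun e he => (ha e he).mono hJ, fun r m n => ?_⟩
  obtain ⟨C, hC⟩ := hr r m n
  refine ⟨C, fun x hx y hy => ?_⟩
  rw [bDerivFst_derivSnd_congr isOpen_Ioo isOpen_Ioo (fun s hs t ht => ?_) m n x hx y hy]
  · exact hC x (hI hx) y (hJ hy)
  · rw [hfg' s hs t ht]

/-- Sums of functions `w y * R (x y ^ β)` with `w` smooth and `R` conormal of order `r` on
`(0, ε)`. -/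
inductive IsScaledConormal (ε r β : ℝ) : (ℝ → ℝ → ℂ) → Prop
  | mk (w R : ℝ → ℂ) (hw : ContDiffOn ℝ ∞ w (Ioi 0)) (hR : ContDiffOn ℝ ∞ R (Ioo 0 ε))
      (hb : ∀ m : ℕ, ∃ C : ℝ, ∀ x ∈ Ioo 0 ε, ‖(bDeriv^[m] R) x‖ ≤ C * x ^ r) :
      IsScaledConormal ε r β fun x y => w y * R (x * y ^ β)
  | add (f g : ℝ → ℝ → ℂ) (hf : IsScaledConormal ε r β f) (hg : IsScaledConormal ε r β g) :
      IsScaledConormal ε r β fun x y => f x y + g x y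

section
variable {ε r β : ℝ} {g : ℝ → ℝ → ℂ} {I J : Set ℝ}

theorem IsScaledConormal.hasDerivAt_fst (h : IsScaledConormal ε r β g)
    (hbox : ∀ x ∈ I, ∀ y ∈ J, 0 < x ∧ 0 < y ∧ x * y ^ β < ε) :
    ∃ g', IsScaledConormal ε r β g' ∧
      ∀ x ∈ I, ∀ y ∈ J, HasDerivAt (fun t => g t y) (g' x y / x) x := by
  induction h with
  | mk w R hw hR hb =>
    refine ⟨_, .mk w (bDeriv R) hw (contDiffOn_bDeriv isOpen_Ioo hR) fun m => hb (m + 1),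
      fun x hx y hy => ?_⟩
    obtain ⟨hx0, hy0, hε⟩ := hbox x hx y hy
    have hpos := mul_pos hx0 (Real.rpow_pos_of_pos hy0 β)
    have hd := ((hR.differentiableOn (by simp) _ ⟨hpos, hε⟩).differentiableAt
      (Ioo_mem_nhds hpos hε)).hasDerivAt
    have hd' := (hd.scomp x ((hasDerivAt_id x).mul_const (y ^ β))).const_mul (w y)
    refine hd'.congr_deriv ?_
    have hxc : (x : ℂ) ≠ 0 := by exact_mod_cast hx0.ne'
    rw [bDeriv, Complex.real_smul]
    push_cast
    field_simp
  | add f g hf hg ihf ihg =>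
    obtain ⟨f', hf', hff'⟩ := ihf
    obtain ⟨g', hg', hgg'⟩ := ihg
    refine ⟨_, .add _ _ hf' hg', fun x hx y hy => ?_⟩
    exact ((hff' x hx y hy).fun_add (hgg' x hx y hy)).congr_deriv (add_div _ _ _).symm

theorem IsScaledConormal.hasDerivAt_snd (h : IsScaledConormal ε r β g)
    (hbox : ∀ x ∈ I, ∀ y ∈ J, 0 < x ∧ 0 < y ∧ x * y ^ β < ε) :
    ∃ g', IsScaledConormal ε r β g' ∧ ∀ x ∈ I, ∀ y ∈ J, HasDerivAt (g x) (g' x y) y := by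
  induction h with
  | mk w R hw hR hb =>
    refine ⟨_, .add _ _ (.mk (deriv w) R ((contDiffOn_infty_iff_deriv_of_isOpen isOpen_Ioi).1 hw).2
      hR hb) (.mk (fun y => β * w y * ((y : ℂ) ^ (-1 : ℂ))) (bDeriv R)
      ((contDiffOn_const.mul hw).mul (contDiffOn_cpow_Ioi _))
      (contDiffOn_bDeriv isOpen_Ioo hR) fun m => hb (m + 1)), fun x hx y hy => ?_⟩
    obtain ⟨hx0, hy0, hε⟩ := hbox x hx y hy
    have hpos := mul_pos hx0 (Real.rpow_pos_of_pos hy0 β)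
    have hd := ((hR.differentiableOn (by simp) _ ⟨hpos, hε⟩).differentiableAt
      (Ioo_mem_nhds hpos hε)).hasDerivAt
    have hd' := (hasDerivAt_of_contDiffOn_Ioi hw hy0).mul (hd.scomp y
      ((Real.hasDerivAt_rpow_const (p := β) (Or.inl hy0.ne')).const_mul x))
    refine hd'.congr_deriv ?_
    have hyc : (y : ℂ) ≠ 0 := by exact_mod_cast hy0.ne'
    rw [bDeriv, Complex.real_smul, Complex.cpow_neg_one, Real.rpow_sub_one hy0.ne']
    simp only [Function.comp]
    push_cast
    field_simp
  | add f g hf hg ihf ihg =>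
    obtain ⟨f', hf', hff'⟩ := ihf
    obtain ⟨g', hg', hgg'⟩ := ihg
    exact ⟨_, .add _ _ hf' hg', fun x hx y hy => (hff' x hx y hy).add (hgg' x hx y hy)⟩

theorem exists_bound_of_subset_Icc {w : ℝ → ℂ} (hw : ContDiffOn ℝ ∞ w (Ioi 0)) {p q : ℝ}
    (hp : 0 < p) (hJ : J ⊆ Icc p q) : ∃ C, ∀ y ∈ J, ‖w y‖ ≤ C := by
  obtain ⟨C, hC⟩ := (isCompact_Icc (a := p) (b := q)).exists_bound_of_continuousOn
    (hw.continuousOn.mono fun y hy => lt_of_lt_of_le hp hy.1)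
  exact ⟨C, fun y hy => hC y (hJ hy)⟩

theorem IsScaledConormal.exists_bound (h : IsScaledConormal ε r β g)
    (hbox : ∀ x ∈ I, ∀ y ∈ J, 0 < x ∧ 0 < y ∧ x * y ^ β < ε) {p q : ℝ} (hp : 0 < p)
    (hJ : J ⊆ Icc p q) : ∃ C : ℝ, ∀ x ∈ I, ∀ y ∈ J, ‖g x y‖ ≤ C * x ^ r := by
  induction h with
  | mk w R hw hR hb =>
    obtain ⟨M, hM⟩ := exists_bound_of_subset_Icc
      (hw.mul (contDiffOn_cpow_Ioi ((β * r : ℝ) : ℂ))) hp hJ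
    obtain ⟨C, hC⟩ := hb 0
    refine ⟨|C| * M, fun x hx y hy => ?_⟩
    obtain ⟨hx0, hy0, hε⟩ := hbox x hx y hy
    have h1 := hC (x * y ^ β) ⟨mul_pos hx0 (Real.rpow_pos_of_pos hy0 β), hε⟩
    have h2 := hM y hy
    rw [norm_mul, Complex.norm_cpow_eq_rpow_re_of_pos hy0, Complex.ofReal_re] at h2
    rw [Function.iterate_zero_apply, Real.mul_rpow hx0.le (Real.rpow_nonneg hy0.le _),
      ← Real.rpow_mul hy0.le] at h1
    have hxr := Real.rpow_nonneg hx0.le r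
    have hyr := Real.rpow_nonneg hy0.le (β * r)
    rw [norm_mul]
    calc ‖w y‖ * ‖R (x * y ^ β)‖ ≤ ‖w y‖ * (|C| * (x ^ r * y ^ (β * r))) := by
          refine mul_le_mul_of_nonneg_left (h1.trans ?_) (norm_nonneg _)
          exact mul_le_mul_of_nonneg_right (le_abs_self C) (mul_nonneg hxr hyr)
      _ = |C| * (‖w y‖ * y ^ (β * r)) * x ^ r := by ring
      _ ≤ |C| * M * x ^ r := by gcongr
  | add f g hf hg ihf ihg =>
    obtain ⟨C, hC⟩ := ihf
    obtain ⟨D, hD⟩ := ihg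
    refine ⟨C + D, fun x hx y hy => (norm_add_le _ _).trans ?_⟩
    linarith [hC x hx y hy, hD x hx y hy]

end

section
variable {E : IndexSet} {c : ℂ × ℕ → ℂ} {ε : ℝ} {F : ℝ → ℂ}

open Classical in
/-- The coefficient of `x ^ j (log x) ^ i`, `(j, i) = e`, in the expansion of `F (x y ^ β)`, where
`c` are the coefficients of the expansion of `F`. -/
noncomputable def scaledCoeff (E : IndexSet) (c : ℂ × ℕ → ℂ) (β : ℝ) (e : ℂ × ℕ) (y : ℝ) : ℂ :=
  ∑ f ∈ E.upTo e.1.re, if f.1 = e.1 ∧ e.2 ≤ f.2 then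
    c f * (f.2.choose e.2) * ((y : ℂ) ^ ((β : ℂ) * e.1) * ((β : ℂ) * Real.log y) ^ (f.2 - e.2))
        else 0

theorem contDiffOn_scaledCoeff (β : ℝ) (e : ℂ × ℕ) :
    ContDiffOn ℝ ∞ (scaledCoeff E c β e) (Ioi 0) := by
  refine ContDiffOn.sum fun f _ => ?_
  split_ifs
  · have hlog : ContDiffOn ℝ ∞ (fun x : ℝ => (Real.log x : ℂ)) (Ioi 0) :=
      Complex.ofRealCLM.contDiff.comp_contDiffOn
        (Real.contDiffOn_log.mono fun x hx => ne_of_gt (show (0 : ℝ) < x from hx))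
    exact contDiffOn_const.mul ((contDiffOn_cpow_Ioi _).mul ((contDiffOn_const.mul hlog).pow _))
  · exact contDiffOn_const

theorem logMonomial_mul_rpow (e : ℂ × ℕ) (β : ℝ) {x y : ℝ} (hx : 0 < x) (hy : 0 < y) :
    logMonomial e (x * y ^ β) = ∑ i ∈ Finset.range (e.2 + 1), (e.2.choose i) *
      ((y : ℂ) ^ ((β : ℂ) * e.1) * ((β : ℂ) * Real.log y) ^ (e.2 - i)) * logMonomial (e.1, i) x
          := by
  have hyβ := Real.rpow_pos_of_pos hy β
  have hy0 : (y : ℂ) ≠ 0 := by exact_mod_cast hy.ne'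
  simp only [logMonomial]
  rw [Real.log_mul hx.ne' hyβ.ne', Real.log_rpow hy, Complex.ofReal_mul,
    Complex.mul_cpow_ofReal_nonneg hx.le hyβ.le]
  have h1 : ((y ^ β : ℝ) : ℂ) ^ e.1 = (y : ℂ) ^ ((β : ℂ) * e.1) := by
    rw [Complex.ofReal_cpow hy.le, Complex.cpow_mul]
    · rw [← Complex.ofReal_log hy.le, ← Complex.ofReal_mul, Complex.ofReal_im]
      exact neg_lt_zero.2 Real.pi_pos
    · rw [← Complex.ofReal_log hy.le, ← Complex.ofReal_mul, Complex.ofReal_im]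
      exact Real.pi_pos.le
  rw [h1]
  push_cast
  rw [add_pow, Finset.mul_sum]
  exact Finset.sum_congr rfl fun i _ => by ring

theorem sum_logMonomial_mul_rpow (c : ℂ × ℕ → ℂ) (β r : ℝ) {x y : ℝ} (hx : 0 < x) (hy : 0 < y) :
    ∑ e ∈ E.upTo r, c e * logMonomial e (x * y ^ β)
      = ∑ e ∈ E.upTo r, scaledCoeff E c β e y * logMonomial e x := by
  classical
  have h1 : ∀ e ∈ E.upTo r, scaledCoeff E c β e y * logMonomial e x
      = ∑ f ∈ E.upTo r, if f.1 = e.1 ∧ e.2 ≤ f.2 then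
        c f * ((f.2.choose e.2) * ((y : ℂ) ^ ((β : ℂ) * f.1)
          * ((β : ℂ) * Real.log y) ^ (f.2 - e.2)) * logMonomial (f.1, e.2) x) else 0 := by
    intro e he
    rw [scaledCoeff, Finset.sum_mul]
    refine Finset.sum_subset_zero_on_sdiff (fun f hf => ?_) (fun f hf => ?_) fun f _ => ?_
    · rw [IndexSet.mem_upTo] at he hf ⊢
      exact ⟨hf.1, hf.2.trans he.2⟩
    · rw [Finset.mem_sdiff, IndexSet.mem_upTo, IndexSet.mem_upTo] at hf
      refine if_neg fun h => hf.2 ⟨hf.1.1, ?_⟩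
      rw [h.1]
    · split_ifs with h
      · rw [h.1]
        ring
      · rw [zero_mul]
  rw [Finset.sum_congr rfl h1, Finset.sum_comm]
  refine Finset.sum_congr rfl fun f hf => ?_
  rw [logMonomial_mul_rpow f β hx hy, Finset.mul_sum, ← Finset.sum_filter]
  have hmem : ∀ i ≤ f.2, (f.1, i) ∈ E.carrier := by
    intro i hi
    have hf' := (IndexSet.mem_upTo.1 hf).1
    obtain ⟨n, hn⟩ := Nat.exists_eq_add_of_le hi
    obtain ⟨j, k⟩ := f
    simp only at hn hf' ⊢
    subst hn
    clear hi hf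
    induction n with
    | zero => exact hf'
    | succ n ih => exact ih (E.log_down _ _ hf')
  refine Finset.sum_bij (fun i _ => (f.1, i)) (fun i hi => ?_) (fun i _ i' _ h => (Prod.ext_iff.1
      h).2)
    (fun e he => ?_) fun i _ => rfl
  · have hi' := Nat.lt_succ_iff.1 (Finset.mem_range.1 hi)
    exact Finset.mem_filter.2 ⟨IndexSet.mem_upTo.2 ⟨hmem i hi', (IndexSet.mem_upTo.1 hf).2⟩, rfl,
        hi'⟩
  · obtain ⟨-, h, h'⟩ := Finset.mem_filter.1 he
    exact ⟨e.2, Finset.mem_range.2 (Nat.lt_succ_of_le h'), Prod.ext h rfl⟩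

/-- A box around `(0, y₀)` on which `A x y ^ β` stays small. -/
theorem exists_box (A β : ℝ) {y₀ ε : ℝ} (hy₀ : 0 < y₀) (hε : 0 < ε) : ∃ δ > 0, δ < y₀ / 2 ∧ δ ≤ 1 ∧
    ∀ x ∈ Icc 0 δ, ∀ y ∈ Ioo (y₀ - δ) (y₀ + δ), |A * x * y ^ β| < ε := by
  obtain ⟨C, hC⟩ := (isCompact_Icc (a := y₀ / 2) (b := 2 * y₀)).exists_bound_of_continuousOn
    (f := fun y : ℝ => A * y ^ β)
    (continuousOn_const.mul (continuousOn_id.rpow_const fun y hy => Or.inl (ne_of_gt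
      (lt_of_lt_of_le (half_pos hy₀) hy.1))))
  have hC0 : 0 ≤ C := (norm_nonneg _).trans (hC y₀ ⟨by linarith, by linarith⟩)
  have hδ : 0 < ε / (C + 1) := by positivity
  refine ⟨min (min (y₀ / 3) 1) (ε / (C + 1)), by positivity,
    ((min_le_left _ _).trans (min_le_left _ _)).trans_lt (by linarith),
    (min_le_left _ _).trans (min_le_right _ _), fun x hx y hy => ?_⟩
  have h3 : min (min (y₀ / 3) 1) (ε / (C + 1)) ≤ y₀ / 3 := (min_le_left _ _).trans (min_le_left _ _)
  have h1 := hC y ⟨by linarith [hy.1], by linarith [hy.2]⟩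
  rw [Real.norm_eq_abs] at h1
  rw [show A * x * y ^ β = A * y ^ β * x by ring, abs_mul, abs_of_nonneg hx.1]
  calc |A * y ^ β| * x ≤ C * (ε / (C + 1)) :=
        mul_le_mul h1 (hx.2.trans (min_le_right _ _)) hx.1 hC0
    _ < ε := by
      rw [mul_div_assoc', div_lt_iff₀ (by linarith)]
      nlinarith

/-- An expansion of `F` at `0` yields one of `F (x y ^ β)` at `x = 0`. -/
theorem HasExpansion.isPolyhomogeneousAtFace (h : HasExpansion E c ε F) (hε : 0 < ε) (β : ℝ)
    {y₀ : ℝ} (hy₀ : 0 < y₀) : IsPolyhomogeneousAtFace E y₀ fun x y => F (x * y ^ β) := by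
  obtain ⟨δ, hδ, hδy, -, hδε⟩ := exists_box 1 β hy₀ hε
  have hbox : ∀ x ∈ Ioo 0 δ, ∀ y ∈ Ioo (y₀ - δ) (y₀ + δ), 0 < x ∧ 0 < y ∧ x * y ^ β < ε :=
    fun x hx y hy => ⟨hx.1, by linarith [hy.1], by
      have := (le_abs_self _).trans_lt (hδε x (Ioo_subset_Icc_self hx) y hy)
      rwa [one_mul] at this⟩
  have hJ0 : Ioo (y₀ - δ) (y₀ + δ) ⊆ Ioi 0 := fun y hy => by
    have := hy.1
    rw [mem_Ioi]
    linarith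
  refine ⟨δ, hδ, scaledCoeff E c β, ?_, fun e _ => (contDiffOn_scaledCoeff β e).mono hJ0,
    fun r m n => ?_⟩
  · refine h.1.comp (f := fun q : ℝ × ℝ => q.1 * q.2 ^ β) (fun q hq => ?_) fun q hq => ?_
    · exact (contDiffAt_fst.mul ((Real.contDiffAt_rpow_const_of_ne
        (ne_of_gt (hJ0 hq.2))).comp q contDiffAt_snd)).contDiffWithinAt
    · obtain ⟨h1, h2, h3⟩ := hbox q.1 hq.1 q.2 hq.2
      exact ⟨mul_pos h1 (Real.rpow_pos_of_pos h2 _), h3⟩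
  · have hR : IsScaledConormal ε r β fun x y => 1 *
        (fun t => F t - ∑ e ∈ E.upTo r, c e * logMonomial e t) (x * y ^ β) :=
      .mk (fun _ => 1) _ contDiffOn_const (contDiffOn_remainder h.1 _ _) (h.2 r)
    obtain ⟨C, hC⟩ := exists_bound_of_closed (I := Ioo 0 δ) (J := Ioo (y₀ - δ) (y₀ + δ)) isOpen_Ioo
      isOpen_Ioo Ioo_subset_Ioi_self (IsScaledConormal ε r β)
      (fun g hg => hg.exists_bound hbox (half_pos hy₀) (q := y₀ + δ) fun y hy =>
        ⟨by linarith [hy.1], hy.2.le⟩)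
      (fun g hg => hg.hasDerivAt_fst hbox) (fun g hg => hg.hasDerivAt_snd hbox) hR m n
    refine ⟨C, fun x hx y hy => ?_⟩
    rw [bDerivFst_derivSnd_congr isOpen_Ioo isOpen_Ioo (fun s hs t ht => ?_) m n x hx y hy]
    · exact hC x hx y hy
    · obtain ⟨h1, h2, -⟩ := hbox s hs t ht
      rw [← sum_logMonomial_mul_rpow c β r h1 h2, one_mul]

end

/-! ### Taylor expansions at a boundary hypersurface -/

/-- The Taylor polynomial with `N` terms, in powers of `x`, of `F ((A - B x) y ^ β)`. -/
noncomputable def taylorPart (A B β : ℝ) (N : ℕ) (F : ℝ → ℂ) (x y : ℝ) : ℂ :=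
  ∑ k ∈ Finset.range N, iteratedDeriv k F (A * y ^ β) * ((-B * y ^ β : ℝ) : ℂ) ^ k
    / (k.factorial : ℂ) * (x : ℂ) ^ k

/-- The Taylor remainder of `F ((A - B x) y ^ β)` at `x = 0`. -/
noncomputable def taylorRem (A B β : ℝ) (N : ℕ) (F : ℝ → ℂ) (x y : ℝ) : ℂ :=
  F ((A - B * x) * y ^ β) - taylorPart A B β N F x y

section
variable {A B β : ℝ} {F : ℝ → ℂ}

theorem contDiffOn_deriv_Ioi (hF : ContDiffOn ℝ ∞ F (Ioi 0)) : ContDiffOn ℝ ∞ (deriv F) (Ioi 0) :=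
  ((contDiffOn_infty_iff_deriv_of_isOpen isOpen_Ioi).1 hF).2

theorem hasDerivAt_taylorPart_fst (N : ℕ) (x y : ℝ) :
    HasDerivAt (fun t => taylorPart A B β (N + 1) F t y)
      (((-B * y ^ β : ℝ) : ℂ) * taylorPart A B β N (deriv F) x y) x := by
  simp only [taylorPart, Finset.sum_range_succ', Finset.mul_sum]
  refine HasDerivAt.congr_deriv ((HasDerivAt.fun_sum fun k _ =>
    (((hasDerivAt_id x).ofReal_comp.pow (k + 1)).const_mul _)).add
    (((hasDerivAt_id x).ofReal_comp.pow 0).const_mul _)) ?_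
  simp only [Nat.cast_zero, zero_mul, mul_zero, add_zero]
  refine Finset.sum_congr rfl fun k _ => ?_
  rw [iteratedDeriv_succ', Nat.factorial_succ]
  have h1 : ((k : ℂ) + 1) ≠ 0 := by exact_mod_cast Nat.succ_ne_zero k
  have h2 : (k.factorial : ℂ) ≠ 0 := by exact_mod_cast k.factorial_ne_zero
  simp only [id]
  push_cast
  field_simp
  ring

theorem hasDerivAt_taylorRem_fst (hF : ContDiffOn ℝ ∞ F (Ioi 0)) (N : ℕ) {x y : ℝ}
    (h : 0 < (A - B * x) * y ^ β) :
    HasDerivAt (fun t => taylorRem A B β (N + 1) F t y)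
      (((-B * y ^ β : ℝ) : ℂ) * taylorRem A B β N (deriv F) x y) x := by
  have h1 := (hasDerivAt_of_contDiffOn_Ioi hF h).scomp x
    ((((hasDerivAt_id x).const_mul B).const_sub A).mul_const (y ^ β))
  refine (h1.sub (hasDerivAt_taylorPart_fst N x y)).congr_deriv ?_
  rw [taylorRem, Complex.real_smul]
  push_cast
  ring

theorem hasDerivAt_taylorPart_snd (hA : 0 < A) (hF : ContDiffOn ℝ ∞ F (Ioi 0)) (N : ℕ) {x y : ℝ}
    (hy : 0 < y) : HasDerivAt (taylorPart A B β N F x)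
      ((β / y : ℝ) * taylorPart A B β N (bDeriv F) x y) y := by
  have hyβ := Real.rpow_pos_of_pos hy β
  have hy0 : (y : ℂ) ≠ 0 := by exact_mod_cast hy.ne'
  rw [taylorPart, Finset.mul_sum]
  refine HasDerivAt.fun_sum fun k _ => ?_
  have hd := Real.hasDerivAt_rpow_const (p := β) (Or.inl hy.ne')
  have h1 := (hasDerivAt_iteratedDeriv hF k (mul_pos hA hyβ)).scomp y (hd.const_mul A)
  have h2 := ((hd.const_mul (-B)).ofReal_comp).pow k
  refine (((h1.mul h2).div_const (k.factorial : ℂ)).mul_const ((x : ℂ) ^ k)).congr_deriv ?_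
  rw [show iteratedDeriv k (bDeriv F) _ = _ from iteratedDeriv_mul_deriv hF k _ (mul_pos hA hyβ),
    Real.rpow_sub_one hy.ne']
  simp only [Function.comp, Complex.real_smul, Pi.pow_apply]
  cases k with
  | zero =>
    push_cast
    simp
    field_simp
  | succ k =>
    simp only [Nat.add_sub_cancel]
    push_cast
    field_simp
    ring

theorem hasDerivAt_taylorRem_snd (hA : 0 < A) (hF : ContDiffOn ℝ ∞ F (Ioi 0)) (N : ℕ) {x y : ℝ}
    (hy : 0 < y) (h : 0 < (A - B * x) * y ^ β) :
    HasDerivAt (taylorRem A B β N F x) ((β / y : ℝ) * taylorRem A B β N (bDeriv F) x y) y := by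
  have h1 := (hasDerivAt_of_contDiffOn_Ioi hF h).scomp y
    ((Real.hasDerivAt_rpow_const (p := β) (Or.inl hy.ne')).const_mul (A - B * x))
  refine (h1.sub (hasDerivAt_taylorPart_snd hA hF N hy)).congr_deriv ?_
  have hy0 : (y : ℂ) ≠ 0 := by exact_mod_cast hy.ne'
  rw [taylorRem, bDeriv, Complex.real_smul, Real.rpow_sub_one hy.ne']
  push_cast
  field_simp

theorem taylorRem_zero_left (N : ℕ) (y : ℝ) : taylorRem A B β (N + 1) F 0 y = 0 := by
  rw [taylorRem, taylorPart, Finset.sum_range_succ']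
  simp

/-- The Taylor remainder with `N` terms is `O (x ^ N)`, locally uniformly in `y`. -/
theorem exists_bound_taylorRem (hF : ContDiffOn ℝ ∞ F (Ioi 0)) {δ p q : ℝ} {J : Set ℝ} (hp : 0 < p)
    (hbox : ∀ x ∈ Ico 0 δ, ∀ y ∈ J, (A - B * x) * y ^ β ∈ Icc p q ∧ |B * y ^ β| ≤ q) (N : ℕ) :
    ∃ C, ∀ x ∈ Ico 0 δ, ∀ y ∈ J, ‖taylorRem A B β N F x y‖ ≤ C * x ^ N := by
  induction N generalizing F with
  | zero =>
    obtain ⟨C, hC⟩ := exists_bound_of_subset_Icc hF hp (subset_refl (Icc p q))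
    exact ⟨C, fun x hx y hy => by simpa [taylorRem, taylorPart] using hC _ (hbox x hx y hy).1⟩
  | succ N ih =>
    obtain ⟨C, hC⟩ := ih (contDiffOn_deriv_Ioi hF)
    refine ⟨q * |C|, fun x hx y hy => ?_⟩
    have h := norm_sub_le_sub_of_norm_deriv_le (f := fun t => taylorRem A B β (N + 1) F t y)
      (B := fun t => q * |C| * x ^ N * t) (B' := fun _ => q * |C| * x ^ N) hx.1
      (fun t ht => hasDerivAt_taylorRem_fst hF N
        (hp.trans_le (hbox t ⟨ht.1, ht.2.trans_lt hx.2⟩ y hy).1.1))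
      (fun t _ => by simpa using (hasDerivAt_id t).const_mul (q * |C| * x ^ N))
      (fun t ht => ?_)
    · simp only [taylorRem_zero_left, sub_zero, mul_zero] at h
      rw [pow_succ, ← mul_assoc]
      exact h
    · have h1 := hbox t ⟨ht.1, ht.2.trans_lt hx.2⟩ y hy
      have h2 := hC t ⟨ht.1, ht.2.trans_lt hx.2⟩ y hy
      rw [norm_mul, Complex.norm_real, Real.norm_eq_abs, neg_mul, abs_neg, mul_assoc]
      refine mul_le_mul h1.2 (h2.trans ?_) (norm_nonneg _) ((abs_nonneg _).trans h1.2)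
      exact mul_le_mul (le_abs_self C) (pow_le_pow_left₀ ht.1 ht.2 N) (pow_nonneg ht.1 N)
        (abs_nonneg C)

/-- Sums of functions `w y * x ^ i * taylorRem A B β N F x y` with `w`, `F` smooth and
`M ≤ i + N`. -/
inductive IsTaylorRemSum (A B β : ℝ) (M : ℕ) : (ℝ → ℝ → ℂ) → Prop
  | mk (w F : ℝ → ℂ) (i N : ℕ) (hM : M ≤ i + N) (hw : ContDiffOn ℝ ∞ w (Ioi 0))
      (hF : ContDiffOn ℝ ∞ F (Ioi 0)) :
      IsTaylorRemSum A B β M fun x y => w y * (x : ℂ) ^ i * taylorRem A B β N F x y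
  | add (f g : ℝ → ℝ → ℂ) (hf : IsTaylorRemSum A B β M f) (hg : IsTaylorRemSum A B β M g) :
      IsTaylorRemSum A B β M fun x y => f x y + g x y

variable {M : ℕ} {g : ℝ → ℝ → ℂ} {I J : Set ℝ}

theorem contDiffOn_ofReal_rpow (b : ℝ) :
    ContDiffOn ℝ ∞ (fun y : ℝ => ((y ^ b : ℝ) : ℂ)) (Ioi 0) :=
  Complex.ofRealCLM.contDiff.comp_contDiffOn fun _ hx =>
    (Real.contDiffAt_rpow_const_of_ne (ne_of_gt hx)).contDiffWithinAt

theorem IsTaylorRemSum.hasDerivAt_fst (h : IsTaylorRemSum A B β M g)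
    (hbox : ∀ x ∈ I, ∀ y ∈ J, 0 < x ∧ 0 < y ∧ 0 < (A - B * x) * y ^ β) :
    ∃ g', IsTaylorRemSum A B β M g' ∧
      ∀ x ∈ I, ∀ y ∈ J, HasDerivAt (fun t => g t y) (g' x y / x) x := by
  induction h with
  | mk w F i N hM hw hF =>
    have hwβ : ContDiffOn ℝ ∞ (fun y : ℝ => w y * ((-B : ℝ) * ((y ^ β : ℝ) : ℂ))) (Ioi 0) :=
      hw.mul (contDiffOn_const.mul (contDiffOn_ofReal_rpow β))
    refine ⟨_, .add _ _ (.mk (fun y => i * w y) F i N hM (contDiffOn_const.mul hw) hF)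
      (.mk _ (deriv F) (i + 1) (N - 1) (by omega) hwβ (contDiffOn_deriv_Ioi hF)),
      fun x hx y hy => ?_⟩
    obtain ⟨hx0, hy0, hpos⟩ := hbox x hx y hy
    have hxc : (x : ℂ) ≠ 0 := by exact_mod_cast hx0.ne'
    have h1 : HasDerivAt (fun t => taylorRem A B β N F t y)
        (((-B * y ^ β : ℝ) : ℂ) * taylorRem A B β (N - 1) (deriv F) x y) x := by
      cases N with
      | zero =>
        have h1 := (hasDerivAt_of_contDiffOn_Ioi hF hpos).scomp x
          ((((hasDerivAt_id x).const_mul B).const_sub A).mul_const (y ^ β))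
        simp only [taylorRem, taylorPart, Finset.range_zero, Finset.sum_empty, sub_zero, zero_tsub]
        refine h1.congr_deriv ?_
        rw [Complex.real_smul]
        push_cast
        ring
      | succ N => exact hasDerivAt_taylorRem_fst hF N hpos
    have h2 := ((((hasDerivAt_id x).ofReal_comp.pow i).const_mul (w y)).mul h1)
    refine h2.congr_deriv ?_
    simp only [id, Pi.pow_apply]
    cases i with
    | zero =>
      push_cast
      field_simp
      ring
    | succ i =>
      simp only [Nat.add_sub_cancel]
      push_cast
      field_simp
      ring
  | add f g hf hg ihf ihg =>
    obtain ⟨f', hf', hff'⟩ := ihf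
    obtain ⟨g', hg', hgg'⟩ := ihg
    refine ⟨_, .add _ _ hf' hg', fun x hx y hy => ?_⟩
    exact ((hff' x hx y hy).fun_add (hgg' x hx y hy)).congr_deriv (add_div _ _ _).symm

theorem IsTaylorRemSum.hasDerivAt_snd (hA : 0 < A) (h : IsTaylorRemSum A B β M g)
    (hbox : ∀ x ∈ I, ∀ y ∈ J, 0 < x ∧ 0 < y ∧ 0 < (A - B * x) * y ^ β) :
    ∃ g', IsTaylorRemSum A B β M g' ∧ ∀ x ∈ I, ∀ y ∈ J, HasDerivAt (g x) (g' x y) y := by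
  induction h with
  | mk w F i N hM hw hF =>
    refine ⟨_, .add _ _ (.mk (deriv w) F i N hM (contDiffOn_deriv_Ioi hw) hF)
      (.mk (fun y => β * w y * ((y : ℂ) ^ (-1 : ℂ))) (bDeriv F) i N hM
      ((contDiffOn_const.mul hw).mul (contDiffOn_cpow_Ioi _))
      (contDiffOn_bDeriv isOpen_Ioi hF)), fun x hx y hy => ?_⟩
    obtain ⟨hx0, hy0, hpos⟩ := hbox x hx y hy
    have h1 := ((hasDerivAt_of_contDiffOn_Ioi hw hy0).mul_const ((x : ℂ) ^ i)).mul
      (hasDerivAt_taylorRem_snd hA hF N hy0 hpos)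
    refine h1.congr_deriv ?_
    rw [Complex.cpow_neg_one]
    push_cast
    ring
  | add f g hf hg ihf ihg =>
    obtain ⟨f', hf', hff'⟩ := ihf
    obtain ⟨g', hg', hgg'⟩ := ihg
    exact ⟨_, .add _ _ hf' hg', fun x hx y hy => (hff' x hx y hy).add (hgg' x hx y hy)⟩

theorem IsTaylorRemSum.exists_bound (h : IsTaylorRemSum A B β M g) {δ p q p' q' r : ℝ} (hp : 0 < p)
    (hδ : δ ≤ 1) (hr : r ≤ M) (hp' : 0 < p') (hJ : J ⊆ Icc p' q')
    (hbox : ∀ x ∈ Ico 0 δ, ∀ y ∈ J, (A - B * x) * y ^ β ∈ Icc p q ∧ |B * y ^ β| ≤ q) :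
    ∃ C : ℝ, ∀ x ∈ Ioo 0 δ, ∀ y ∈ J, ‖g x y‖ ≤ C * x ^ r := by
  induction h with
  | mk w F i N hM hw hF =>
    obtain ⟨C, hC⟩ := exists_bound_taylorRem hF hp hbox N
    obtain ⟨D, hD⟩ := exists_bound_of_subset_Icc hw hp' hJ
    refine ⟨|C| * |D|, fun x hx y hy => ?_⟩
    have h1 := hC x (Ioo_subset_Ico_self hx) y hy
    have h2 : x ^ (i + N) ≤ x ^ r := by
      rw [← Real.rpow_natCast]
      refine Real.rpow_le_rpow_of_exponent_ge hx.1 (hx.2.le.trans hδ) (hr.trans ?_)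
      exact_mod_cast hM
    rw [norm_mul, norm_mul, norm_pow, Complex.norm_real, Real.norm_eq_abs, abs_of_pos hx.1]
    have hxi := pow_nonneg hx.1.le i
    have hxN := pow_nonneg hx.1.le N
    calc ‖w y‖ * x ^ i * ‖taylorRem A B β N F x y‖ ≤ |D| * x ^ i * (|C| * x ^ N) := by
          gcongr
          · exact (hD y hy).trans (le_abs_self D)
          · exact h1.trans (mul_le_mul_of_nonneg_right (le_abs_self C) hxN)
      _ = |C| * |D| * x ^ (i + N) := by ring
      _ ≤ |C| * |D| * x ^ r := by gcongr
  | add f g hf hg ihf ihg =>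
    obtain ⟨C, hC⟩ := ihf
    obtain ⟨D, hD⟩ := ihg
    refine ⟨C + D, fun x hx y hy => (norm_add_le _ _).trans ?_⟩
    linarith [hC x hx y hy, hD x hx y hy]

/-- The members of the index set of smooth functions up to order `r` are `(n, 0)` with `n < N`. -/
theorem exists_sum_gen_zero_eq (r : ℝ) : ∃ N : ℕ, r ≤ N ∧ ∀ f : ℂ × ℕ → ℂ,
    ∑ e ∈ (IndexSet.gen 0 0).upTo r, f e = ∑ n ∈ Finset.range N, f ((n : ℂ), 0) := by
  obtain ⟨N, hN, hN'⟩ : ∃ N : ℕ, r ≤ N ∧ ∀ n : ℕ, n < N ↔ (n : ℝ) ≤ r := by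
    rcases lt_or_ge r 0 with h | h
    · exact ⟨0, by simpa using h.le, fun n => ⟨fun h => absurd h (Nat.not_lt_zero n), fun h' =>
        absurd (h'.trans_lt h) (not_lt.2 n.cast_nonneg)⟩⟩
    · exact ⟨⌊r⌋₊ + 1, by exact_mod_cast (Nat.lt_floor_add_one r).le, fun n => by
        rw [Nat.lt_succ_iff, Nat.le_floor_iff h]⟩
  refine ⟨N, hN, fun f => ?_⟩
  rw [eq_comm]
  refine Finset.sum_bij (fun n _ => ((n : ℂ), 0)) (fun n hn => ?_) (fun n _ m _ h => ?_)
    (fun e he => ?_) fun n _ => rfl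
  · refine IndexSet.mem_upTo.2 ⟨⟨⟨n, by simp⟩, le_rfl⟩, ?_⟩
    simpa using (hN' n).1 (Finset.mem_range.1 hn)
  · simpa using h
  · obtain ⟨⟨⟨n, hn⟩, hk⟩, hr⟩ := IndexSet.mem_upTo.1 he
    rw [zero_add] at hn
    refine ⟨n, Finset.mem_range.2 ((hN' n).2 ?_), Prod.ext hn.symm (Nat.le_zero.1 hk).symm⟩
    simpa [hn] using hr

/-- A function smooth up to and across the boundary hypersurface has a Taylor expansion. -/
theorem isPolyhomogeneousAtFace_of_contDiffOn (hA : 0 < A) (hF : ContDiffOn ℝ ∞ F (Ioi 0))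
    {y₀ : ℝ} (hy₀ : 0 < y₀) :
    IsPolyhomogeneousAtFace (IndexSet.gen 0 0) y₀ fun x y => F ((A - B * x) * y ^ β) := by
  obtain ⟨δ, hδ, hδy, hδ1, hδε⟩ := exists_box B 0 hy₀ (half_pos hA)
  simp only [Real.rpow_zero, mul_one] at hδε
  have hJ : Ioo (y₀ - δ) (y₀ + δ) ⊆ Icc (y₀ / 2) (2 * y₀) := fun y hy =>
    ⟨by linarith [hy.1], by linarith [hy.2]⟩
  have hJ0 : Ioo (y₀ - δ) (y₀ + δ) ⊆ Ioi 0 := fun y hy => (half_pos hy₀).trans_le (hJ hy).1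
  -- bounds for `y ^ β` from above and from below
  have hcont : ∀ b : ℝ, ∃ C, ∀ y ∈ Ioo (y₀ - δ) (y₀ + δ), y ^ b ≤ C := fun b => by
    obtain ⟨C, hC⟩ := exists_bound_of_subset_Icc (contDiffOn_ofReal_rpow b) (half_pos hy₀) hJ
    exact ⟨C, fun y hy => by
      have := hC y hy
      rw [Complex.norm_real] at this
      exact (le_abs_self _).trans this⟩
  obtain ⟨C, hC⟩ := hcont β
  obtain ⟨D, hD⟩ := hcont (-β)
  have hy₀J : y₀ ∈ Ioo (y₀ - δ) (y₀ + δ) := ⟨by linarith, by linarith⟩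
  have hD0 : 0 < D := (Real.rpow_pos_of_pos hy₀ _).trans_le (hD y₀ hy₀J)
  have hC0 : 0 < C := (Real.rpow_pos_of_pos hy₀ _).trans_le (hC y₀ hy₀J)
  have hp : 0 < A / 2 * D⁻¹ := by positivity
  have hbox : ∀ x ∈ Ico 0 δ, ∀ y ∈ Ioo (y₀ - δ) (y₀ + δ), (A - B * x) * y ^ β ∈
      Icc (A / 2 * D⁻¹) (max (2 * A * C) (|B| * C)) ∧ |B * y ^ β| ≤ max (2 * A * C) (|B| * C) := by
    intro x hx y hy
    have h1 := abs_lt.1 (hδε x (Ico_subset_Icc_self hx) y hy)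
    have hyb := Real.rpow_pos_of_pos (hJ0 hy) β
    have h2 : D⁻¹ ≤ y ^ β := by
      refine inv_le_of_inv_le₀ hyb ?_
      rw [← Real.rpow_neg (hJ0 hy).le]
      exact hD y hy
    refine ⟨⟨mul_le_mul (by linarith) h2 (by positivity) (by linarith),
      le_max_of_le_left (mul_le_mul (by linarith) (hC y hy) hyb.le (by positivity))⟩,
      le_max_of_le_right ?_⟩
    rw [abs_mul, abs_of_pos hyb]
    exact mul_le_mul_of_nonneg_left (hC y hy) (abs_nonneg B)
  have hbox' : ∀ x ∈ Ioo 0 δ, ∀ y ∈ Ioo (y₀ - δ) (y₀ + δ),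
      0 < x ∧ 0 < y ∧ 0 < (A - B * x) * y ^ β := fun x hx y hy =>
    ⟨hx.1, hJ0 hy, hp.trans_le (hbox x (Ioo_subset_Ico_self hx) y hy).1.1⟩
  have hcoeff : ∀ n : ℕ, ContDiffOn ℝ ∞ (fun y : ℝ => iteratedDeriv n F (A * y ^ β)
      * ((-B * y ^ β : ℝ) : ℂ) ^ n / (n.factorial : ℂ)) (Ioi 0) := fun n => by
    have h1 : ContDiffOn ℝ ∞ (fun y : ℝ => A * y ^ β) (Ioi 0) := fun x hx =>
      (contDiffAt_const.mul (Real.contDiffAt_rpow_const_of_ne (ne_of_gt hx))).contDiffWithinAt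
    have h2 : ContDiffOn ℝ ∞ (fun y : ℝ => ((-B * y ^ β : ℝ) : ℂ)) (Ioi 0) := by
      simp only [Complex.ofReal_mul]
      exact contDiffOn_const.mul (contDiffOn_ofReal_rpow β)
    exact (((contDiffOn_iteratedDeriv_Ioi hF n).comp h1 fun y hy => mul_pos hA
      (Real.rpow_pos_of_pos hy β)).mul (h2.pow n)).div_const _
  refine ⟨δ, hδ, fun e y => iteratedDeriv ⌊e.1.re⌋₊ F (A * y ^ β)
    * ((-B * y ^ β : ℝ) : ℂ) ^ ⌊e.1.re⌋₊ / (⌊e.1.re⌋₊.factorial : ℂ), ?_,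
    fun e _ => (hcoeff _).mono hJ0, fun r m n => ?_⟩
  · refine hF.comp (f := fun q : ℝ × ℝ => (A - B * q.1) * q.2 ^ β) (fun q hq => ?_) fun q hq =>
      (hbox' q.1 hq.1 q.2 hq.2).2.2
    exact ((contDiffAt_const.sub (contDiffAt_const.mul contDiffAt_fst)).mul
      ((Real.contDiffAt_rpow_const_of_ne (ne_of_gt (hJ0 hq.2))).comp q
        contDiffAt_snd)).contDiffWithinAt
  · obtain ⟨N, hrN, hN⟩ := exists_sum_gen_zero_eq r
    have hR : IsTaylorRemSum A B β N fun x y => 1 * (x : ℂ) ^ 0 * taylorRem A B β N F x y :=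
      .mk (fun _ => 1) F 0 N (by simp) contDiffOn_const hF
    obtain ⟨C, hC⟩ := exists_bound_of_closed (I := Ioo 0 δ) (J := Ioo (y₀ - δ) (y₀ + δ)) isOpen_Ioo
      isOpen_Ioo Ioo_subset_Ioi_self (IsTaylorRemSum A B β N)
      (fun g hg => hg.exists_bound hp hδ1 hrN (half_pos hy₀) hJ hbox)
      (fun g hg => hg.hasDerivAt_fst hbox') (fun g hg => hg.hasDerivAt_snd hA hbox') hR m n
    refine ⟨C, fun x hx y hy => ?_⟩
    rw [bDerivFst_derivSnd_congr isOpen_Ioo isOpen_Ioo (fun s hs t ht => ?_) m n x hx y hy]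
    · exact hC x hx y hy
    · rw [hN, taylorRem, taylorPart]
      simp [logMonomial]

end

/-! ### Expansions at a corner of functions of one variable -/

section
variable {E F : IndexSet} {c : ℂ × ℕ → ℂ} {ε : ℝ} {f : ℝ → ℂ}

theorem hasExpansion_zero (E : IndexSet) (hε : ε ≤ 1) : HasExpansion E 0 ε 0 :=
  hasExpansion_of_isTermSum 1 hε contDiffOn_const fun a => ⟨∅, by simp, by simp, _,
    IsTermSum.sum (∅ : Finset ℕ) (fun _ _ => 0) (by simp), by simp⟩

open Classical in
theorem hasExpansion_const (w : ℂ) (hε : ε ≤ 1) :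
    HasExpansion (IndexSet.gen 0 0) (fun e => if e = (0, 0) then w else 0) ε fun _ => w :=
  hasExpansion_of_isTermSum 1 hε contDiffOn_const fun a => ⟨{(0, 0)},
    by simpa using ⟨⟨0, by simp⟩, le_rfl⟩, fun e _ _ he => if_neg (by simpa using he), _,
    IsTermSum.sum (∅ : Finset ℕ) (fun _ _ => 0) (by simp), by simp [logMonomial_zero]⟩

theorem bDerivSnd_iterate_const_fst (K : ℝ → ℂ) (n : ℕ) :
    bDerivSnd^[n] (fun _ u => K u) = fun _ u => (bDeriv^[n] K) u := by
  induction n with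
  | zero => rfl
  | succ n ih =>
    rw [Function.iterate_succ_apply', ih, Function.iterate_succ_apply']
    rfl

theorem bDerivFst_iterate_const_snd (K : ℝ → ℂ) (m : ℕ) :
    bDerivFst^[m] (fun t _ => K t) = fun t _ => (bDeriv^[m] K) t := by
  induction m with
  | zero => rfl
  | succ n ih =>
    rw [Function.iterate_succ_apply', ih, Function.iterate_succ_apply']
    rfl

theorem bDerivFst_iterate_const_fst (K : ℝ → ℂ) (m : ℕ) :
    bDerivFst^[m] (fun _ u => K u) = fun _ u => if m = 0 then K u else 0 := by
  induction m with
  | zero => simp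
  | succ n ih =>
    rw [Function.iterate_succ_apply', ih]
    funext x y
    simp [bDerivFst]

theorem bDerivSnd_iterate_const_snd (K : ℝ → ℂ) (n : ℕ) :
    bDerivSnd^[n] (fun t _ => K t) = fun t _ => if n = 0 then K t else 0 := by
  induction n with
  | zero => simp
  | succ n ih =>
    rw [Function.iterate_succ_apply', ih]
    funext x y
    simp [bDerivSnd]

theorem sum_gen_zero_eq (r : ℝ) {x : ℝ} (w : ℂ) (f : ℂ × ℕ → ℂ)
    (hf : ∀ e, f e = open Classical in if e = (0, 0) then w else 0) :
    ∑ e ∈ (IndexSet.gen 0 0).upTo r, f e * logMonomial e x = if 0 ≤ r then w else 0 := by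
  classical
  split_ifs with hr
  · rw [Finset.sum_eq_single (0, 0)]
    · rw [hf, if_pos rfl, logMonomial_zero, mul_one]
    · intro e _ he
      rw [hf, if_neg he, zero_mul]
    · exact fun h => absurd ((IndexSet.mem_upTo (E := IndexSet.gen 0 0) (e := (0, 0))).2
        ⟨⟨⟨0, by simp⟩, le_rfl⟩, by simpa using hr⟩) h
  · refine Finset.sum_eq_zero fun e he => ?_
    rw [hf, if_neg, zero_mul]
    rintro rfl
    exact hr (by simpa using (IndexSet.mem_upTo.1 he).2)

open Classical in
/-- A function of the second variable only, in a neighbourhood of a corner. -/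
theorem HasExpansion.hasCornerExpansion_snd (h : HasExpansion F c ε f) (hε : 0 < ε) (hε1 : ε ≤ 1) :
    HasCornerExpansion (IndexSet.gen 0 0) F (fun e e' => if e = (0, 0) then c e' else 0)
      fun _ y => f y := by
  refine ⟨ε, hε, fun e y => if e = (0, 0) then f y else 0, fun e' _ => c e',
    h.1.comp contDiffOn_snd fun q hq => hq.2, fun e _ => ?_,
    fun e' _ => hasExpansion_const (c e') hε1, fun r s m n => ?_⟩
  · by_cases he : e = (0, 0)
    · simpa [he] using h
    · simpa [he] using! hasExpansion_zero F hε1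
  · obtain ⟨C, hC⟩ := h.2 s n
    have hrem : ∀ x ∈ Ioo 0 ε, ∀ y ∈ Ioo 0 ε, f y
        - ∑ e ∈ (IndexSet.gen 0 0).upTo r, (if e = (0, 0) then f y else 0) * logMonomial e x
        - ∑ e' ∈ F.upTo s, c e' * logMonomial e' y
        + ∑ e ∈ (IndexSet.gen 0 0).upTo r, ∑ e' ∈ F.upTo s,
          (if e = (0, 0) then c e' else 0) * logMonomial e x * logMonomial e' y
        = if 0 ≤ r then 0 else f y - ∑ e' ∈ F.upTo s, c e' * logMonomial e' y := by
      intro x _ y _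
      rw [sum_gen_zero_eq r (f y) _ fun _ => rfl, Finset.sum_comm]
      have h1 : ∀ e' ∈ F.upTo s, ∑ e ∈ (IndexSet.gen 0 0).upTo r,
          (if e = (0, 0) then c e' else 0) * logMonomial e x * logMonomial e' y
          = (if 0 ≤ r then c e' else 0) * logMonomial e' y := fun e' _ => by
        rw [← Finset.sum_mul, sum_gen_zero_eq r (c e') _ fun _ => rfl]
      rw [Finset.sum_congr rfl h1]
      split_ifs
      · ring
      · simp
    refine ⟨|C|, fun x hx y hy => ?_⟩
    rw [bDerivFst_bDerivSnd_congr isOpen_Ioo isOpen_Ioo hrem m n x hx y hy]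
    have hy0 := Real.rpow_nonneg hy.1.le s
    have hx0 := Real.rpow_nonneg hx.1.le r
    split_ifs with hr
    · rw [bDerivSnd_iterate_const_fst (fun _ => 0), bDerivFst_iterate_const_fst]
      have h0 : (bDeriv^[n] fun _ => (0 : ℂ)) y = 0 := by
        have := congrFun (congrFun (bDerivSnd_iterate_const_snd (fun _ => 0) n) 0) y
        rw [bDerivSnd_iterate_const_fst (fun _ => 0)] at this
        simpa using this
      simp only [h0, ite_self, norm_zero]
      positivity
    · rw [bDerivSnd_iterate_const_fst fun u => f u - ∑ e' ∈ F.upTo s, c e' * logMonomial e' u,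
        bDerivFst_iterate_const_fst]
      have hx1 : 1 ≤ x ^ r :=
        Real.one_le_rpow_of_pos_of_le_one_of_nonpos hx.1 (hx.2.le.trans hε1) (not_le.1 hr).le
      have h1 : |C| * y ^ s ≤ |C| * x ^ r * y ^ s := by
        rw [mul_assoc]
        exact mul_le_mul_of_nonneg_left (le_mul_of_one_le_left hy0 hx1) (abs_nonneg C)
      split_ifs
      · exact (hC y hy).trans ((mul_le_mul_of_nonneg_right (le_abs_self C) hy0).trans h1)
      · rw [norm_zero]
        positivity

open Classical in
/-- A function of the first variable only, in a neighbourhood of a corner. -/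
theorem HasExpansion.hasCornerExpansion_fst (h : HasExpansion E c ε f) (hε : 0 < ε) (hε1 : ε ≤ 1) :
    HasCornerExpansion E (IndexSet.gen 0 0) (fun e e' => if e' = (0, 0) then c e else 0)
      fun x _ => f x := by
  refine ⟨ε, hε, fun e _ => c e, fun e' x => if e' = (0, 0) then f x else 0,
    h.1.comp contDiffOn_fst fun q hq => hq.1, fun e _ => hasExpansion_const (c e) hε1,
    fun e' _ => ?_, fun r s m n => ?_⟩
  · by_cases he : e' = (0, 0)
    · simpa [he] using h
    · simpa [he] using! hasExpansion_zero E hε1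
  · obtain ⟨C, hC⟩ := h.2 r m
    have hrem : ∀ x ∈ Ioo 0 ε, ∀ y ∈ Ioo 0 ε, f x
        - ∑ e ∈ E.upTo r, c e * logMonomial e x
        - ∑ e' ∈ (IndexSet.gen 0 0).upTo s, (if e' = (0, 0) then f x else 0) * logMonomial e' y
        + ∑ e ∈ E.upTo r, ∑ e' ∈ (IndexSet.gen 0 0).upTo s,
          (if e' = (0, 0) then c e else 0) * logMonomial e x * logMonomial e' y
        = if 0 ≤ s then 0 else f x - ∑ e ∈ E.upTo r, c e * logMonomial e x := by
      intro x _ y _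
      rw [sum_gen_zero_eq s (f x) _ fun _ => rfl]
      have h1 : ∀ e ∈ E.upTo r, ∑ e' ∈ (IndexSet.gen 0 0).upTo s,
          (if e' = (0, 0) then c e else 0) * logMonomial e x * logMonomial e' y
          = (if 0 ≤ s then c e else 0) * logMonomial e x := fun e _ => by
        rw [← sum_gen_zero_eq s (x := y) (c e) _ fun _ => rfl, Finset.sum_mul]
        exact Finset.sum_congr rfl fun e' _ => by ring
      rw [Finset.sum_congr rfl h1]
      split_ifs
      · ring
      · simp
    refine ⟨|C|, fun x hx y hy => ?_⟩
    rw [bDerivFst_bDerivSnd_congr isOpen_Ioo isOpen_Ioo hrem m n x hx y hy]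
    have hy0 := Real.rpow_nonneg hy.1.le s
    have hx0 := Real.rpow_nonneg hx.1.le r
    split_ifs with hs
    · rw [bDerivSnd_iterate_const_snd (fun _ => 0)]
      simp only [ite_self]
      rw [bDerivFst_iterate_const_fst (fun _ => 0)]
      simp only [ite_self, norm_zero]
      positivity
    · rw [bDerivSnd_iterate_const_snd fun u => f u - ∑ e ∈ E.upTo r, c e * logMonomial e u]
      have hy1 : 1 ≤ y ^ s :=
        Real.one_le_rpow_of_pos_of_le_one_of_nonpos hy.1 (hy.2.le.trans hε1) (not_le.1 hs).le
      have h1 : |C| * x ^ r ≤ |C| * x ^ r * y ^ s :=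
        le_mul_of_one_le_right (mul_nonneg (abs_nonneg C) hx0) hy1
      by_cases hn : n = 0
      · simp only [hn, if_true]
        rw [bDerivFst_iterate_const_snd fun u => f u - ∑ e ∈ E.upTo r, c e * logMonomial e u]
        exact (hC x hx).trans ((mul_le_mul_of_nonneg_right (le_abs_self C) hx0).trans h1)
      · simp only [hn, if_false]
        rw [bDerivFst_iterate_const_fst (fun _ => 0)]
        simp only [ite_self, norm_zero]
        positivity

theorem HasCornerExpansion.congr {c : ℂ × ℕ → ℂ × ℕ → ℂ} {f g : ℝ → ℝ → ℂ} {δ : ℝ}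
    (h : HasCornerExpansion E F c f) (hδ : 0 < δ)
    (hfg : ∀ x ∈ Ioo 0 δ, ∀ y ∈ Ioo 0 δ, g x y = f x y) : HasCornerExpansion E F c g := by
  obtain ⟨ε, hε, a, b, hf, ha, hb, hr⟩ := h
  have hle : Ioo 0 (min ε δ) ⊆ Ioo 0 ε := Ioo_subset_Ioo_right (min_le_left _ _)
  have hfg' : ∀ x ∈ Ioo 0 (min ε δ), ∀ y ∈ Ioo 0 (min ε δ), g x y = f x y := fun x hx y hy =>
    hfg x ⟨hx.1, hx.2.trans_le (min_le_right _ _)⟩ y ⟨hy.1, hy.2.trans_le (min_le_right _ _)⟩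
  refine ⟨min ε δ, lt_min hε hδ, a, b, (hf.mono (prod_mono hle hle)).congr fun q hq =>
    hfg' q.1 hq.1 q.2 hq.2, fun e he => (ha e he).mono_right (min_le_left _ _),
    fun e he => (hb e he).mono_right (min_le_left _ _), fun r s m n => ?_⟩
  obtain ⟨C, hC⟩ := hr r s m n
  refine ⟨C, fun x hx y hy => ?_⟩
  rw [bDerivFst_bDerivSnd_congr isOpen_Ioo isOpen_Ioo (fun t ht u hu => ?_) m n x hx y hy]
  · exact hC x (hle hx) y (hle hy)
  · rw [hfg' t ht u hu]

end

/-! ### Functions of the front face coordinate -/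

/-- The index sets of a function of `z / h ^ (2 / (κ + 2))` with index sets `E₀` at `0` and `E₁` at
infinity. -/
def frontFaceIndexSets (E₀ E₁ : IndexSet) : Face → IndexSet
  | .ie => IndexSet.gen 0 0
  | .ze => E₁
  | .fe => IndexSet.gen 0 0
  | .be => E₀

section
variable {κ : ℤ} {F : ℝ → ℂ} {E₀ E₁ : IndexSet} {c₀ c₁ : ℂ × ℕ → ℂ} {ε Z : ℝ}

theorem div_semiclassical_rpow (hκ : -1 ≤ κ) {s z : ℝ} (hs : 0 < s) (hz : 0 < z) :
    z / semiclassical κ s z ^ (2 / ((κ : ℝ) + 2)) = s ^ (-(1 / ((κ : ℝ) + 2))) := by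
  have hp := intCast_add_two_pos hκ
  rw [semiclassical, Real.mul_rpow (Real.sqrt_nonneg s) (Real.rpow_nonneg hz.le _),
    Real.sqrt_eq_rpow, ← Real.rpow_mul hs.le, ← Real.rpow_mul hz.le,
    show ((κ : ℝ) + 2) / 2 * (2 / ((κ : ℝ) + 2)) = 1 by field_simp, Real.rpow_one,
    show 1 / 2 * (2 / ((κ : ℝ) + 2)) = 1 / ((κ : ℝ) + 2) by field_simp, Real.rpow_neg hs.le]
  have := Real.rpow_pos_of_pos hs (1 / ((κ : ℝ) + 2))
  field_simp

theorem mul_div_rpow_rpow (hκ : -1 ≤ κ) {w l : ℝ} (hw : 0 < w) :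
    l * w / (w ^ (((κ : ℝ) + 2) / 2)) ^ (2 / ((κ : ℝ) + 2)) = l := by
  have hp := intCast_add_two_pos hκ
  rw [← Real.rpow_mul hw.le, show ((κ : ℝ) + 2) / 2 * (2 / ((κ : ℝ) + 2)) = 1 by field_simp,
    Real.rpow_one, mul_div_cancel_right₀ _ hw.ne']

open Classical in
/-- The expansion at a corner of a function of the front face coordinate. -/
theorem hasCornerExpansion_frontFace (hκ : -1 ≤ κ) (hε : 0 < ε) (hε1 : ε ≤ 1)
    (h₀ : HasExpansion E₀ c₀ ε F)
    (h₁ : HasExpansion E₁ c₁ ε fun s => F (s ^ (-(1 / ((κ : ℝ) + 2))))) (hZ : 0 < Z) (v : Corner) :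
    HasCornerExpansion (frontFaceIndexSets E₀ E₁ v.fst) (frontFaceIndexSets E₀ E₁ v.snd)
      (fun e e' => match v with
        | .zeIe => if e' = (0, 0) then c₁ e else 0
        | .zeFe => if e' = (0, 0) then c₁ e else 0
        | .feBe => if e = (0, 0) then c₀ e' else 0)
      (cornerChart κ Z (fun z h => F (z / h ^ (2 / ((κ : ℝ) + 2)))) v) := by
  cases v with
  | zeIe =>
    refine (h₁.hasCornerExpansion_fst hε hε1).congr hZ fun x hx y hy => ?_
    simp only [cornerChart]
    rw [div_semiclassical_rpow hκ hx.1 (sub_pos.2 hy.2)]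
  | zeFe =>
    refine (h₁.hasCornerExpansion_fst hε hε1).congr one_pos fun x hx y hy => ?_
    simp only [cornerChart]
    rw [div_semiclassical_rpow hκ hx.1 hy.1]
  | feBe =>
    refine (h₀.hasCornerExpansion_snd hε hε1).congr one_pos fun x hx y hy => ?_
    simp only [cornerChart]
    rw [mul_div_rpow_rpow hκ hx.1]

/-- A function of the front face coordinate `l` that is smooth for `l > 0` and has expansions as
`l → 0` and as `l → ∞` is polyhomogeneous on the blowup. -/
theorem isPolyhomogeneousOn_frontFace (hκ : -1 ≤ κ) (hF : ContDiffOn ℝ ∞ F (Ioi 0)) (hε : 0 < ε)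
    (hε1 : ε ≤ 1) (h₀ : HasExpansion E₀ c₀ ε F)
    (h₁ : HasExpansion E₁ c₁ ε fun s => F (s ^ (-(1 / ((κ : ℝ) + 2))))) (hZ : 0 < Z) :
    IsPolyhomogeneousOn κ Z (frontFaceIndexSets E₀ E₁)
      fun z h => F (z / h ^ (2 / ((κ : ℝ) + 2))) := by
  refine ⟨?_, fun i y₀ hy₀ => ?_, fun v => ⟨_, hasCornerExpansion_frontFace hκ hε hε1 h₀ h₁ hZ v⟩⟩
  · refine hF.comp (f := fun q : ℝ × ℝ => q.1 / q.2 ^ (2 / ((κ : ℝ) + 2))) (fun q hq => ?_)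
      fun q hq => div_pos hq.1.1 (Real.rpow_pos_of_pos hq.2 _)
    have hq2 : (0 : ℝ) < q.2 := hq.2
    exact (contDiffAt_fst.div ((Real.contDiffAt_rpow_const_of_ne hq2.ne').comp q
      contDiffAt_snd) (Real.rpow_pos_of_pos hq2 _).ne').contDiffWithinAt
  · cases i with
    | ie =>
      have hy : (0 : ℝ) < y₀ := hy₀
      refine (isPolyhomogeneousAtFace_of_contDiffOn (A := Z) (B := 1)
        (β := -(2 / ((κ : ℝ) + 2))) hZ hF hy).congr hy fun x _ y hy' => ?_
      simp only [faceChart]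
      rw [Real.rpow_neg (by linarith [hy'.1]), one_mul, div_eq_mul_inv]
    | ze =>
      have hy : (0 : ℝ) < y₀ := hy₀.1
      refine (h₁.isPolyhomogeneousAtFace hε 0 hy).congr hy fun x hx y hy' => ?_
      simp only [faceChart]
      rw [div_semiclassical_rpow hκ hx.1 (by linarith [hy'.1]), Real.rpow_zero, mul_one]
    | fe =>
      have hy : (0 : ℝ) < y₀ := hy₀
      refine (isPolyhomogeneousAtFace_of_contDiffOn (A := 1) (B := 0)
        (β := -(1 / ((κ : ℝ) + 2))) one_pos hF hy).congr hy fun x hx y hy' => ?_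
      simp only [faceChart]
      rw [div_semiclassical_rpow hκ (by linarith [hy'.1]) hx.1, zero_mul, sub_zero, one_mul]
    | be =>
      have hy : (0 : ℝ) < y₀ := hy₀
      refine (h₀.isPolyhomogeneousAtFace hε (-(2 / ((κ : ℝ) + 2))) hy).congr hy fun x _ y hy' => ?_
      simp only [faceChart]
      rw [Real.rpow_neg (by linarith [hy'.1]), div_eq_mul_inv]

end

/-! ### Amplitudes and phases on the blowup -/

/-- The phase `σ φ`, cut off near `l = 0`. -/
noncomputable def cutPhase (κ : ℤ) (σ : ℂ) (l : ℝ) : ℂ :=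
  σ * ((Real.smoothTransition (l - 1) * modelPhase κ l : ℝ) : ℂ)

/-- The amplitude of `Q` with respect to the cut off phase `σ φ`. -/
noncomputable def cutAmplitude (κ : ℤ) (σ : ℂ) (Q : ℝ → ℂ) (l : ℝ) : ℂ :=
  Q l * Complex.exp (-cutPhase κ σ l)

section
variable {κ : ℤ} {σ : ℂ} {ς : ℝ} {α : ℂ} {Ψ Q q : ℝ → ℂ} {Z : ℝ}

theorem contDiffOn_cutPhase (κ : ℤ) (σ : ℂ) : ContDiffOn ℝ ∞ (cutPhase κ σ) (Ioi 0) := by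
  have h1 : ContDiffOn ℝ ∞ (modelPhase κ) (Ioi 0) := fun l hl =>
    ((contDiffAt_const.mul (Real.contDiffAt_rpow_const_of_ne
      (ne_of_gt hl))).div_const _).contDiffWithinAt
  have h2 : ContDiffOn ℝ ∞ (fun l : ℝ => Real.smoothTransition (l - 1)) (Ioi 0) :=
    (Real.smoothTransition.contDiff.comp (contDiff_id.sub contDiff_const)).contDiffOn
  exact contDiffOn_const.mul (Complex.ofRealCLM.contDiff.comp_contDiffOn (h2.mul h1))

theorem cutPhase_of_le_one {l : ℝ} (hl : l ≤ 1) : cutPhase κ σ l = 0 := by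
  rw [cutPhase, Real.smoothTransition.zero_of_nonpos (by linarith)]
  simp

theorem cutPhase_of_two_le {l : ℝ} (hl : 2 ≤ l) : cutPhase κ σ l = σ * modelPhase κ l := by
  rw [cutPhase, Real.smoothTransition.one_of_one_le (by linarith), one_mul]

theorem cutPhase_neg (l : ℝ) : cutPhase κ (-σ) l = -cutPhase κ σ l := neg_mul _ _

theorem contDiffOn_cutAmplitude (hQ : ContDiffOn ℝ ∞ Q (Ioi 0)) :
    ContDiffOn ℝ ∞ (cutAmplitude κ σ Q) (Ioi 0) :=
  hQ.mul (contDiffOn_cutPhase κ σ).neg.cexp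

theorem two_le_rpow_neg_inv (hκ : -1 ≤ κ) {s : ℝ} (hs : s ∈ Ioo 0 ((2 : ℝ) ^ (-((κ : ℝ) + 2)))) :
    2 ≤ s ^ (-(1 / ((κ : ℝ) + 2))) := by
  have hp := intCast_add_two_pos hκ
  have h := Real.rpow_le_rpow_of_nonpos hs.1 hs.2.le (z := -(1 / ((κ : ℝ) + 2)))
    (by rw [Left.neg_nonpos_iff]; positivity)
  rwa [← Real.rpow_mul two_pos.le, show -((κ : ℝ) + 2) * -(1 / ((κ : ℝ) + 2)) = 1 by field_simp,
    Real.rpow_one] at h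

theorem modelPhase_rpow_neg_inv (hκ : -1 ≤ κ) {s : ℝ} (hs : 0 < s) :
    modelPhase κ (s ^ (-(1 / ((κ : ℝ) + 2)))) = 2 / ((κ : ℝ) + 2) * s ^ (-(1 / 2) : ℝ) := by
  have hp := intCast_add_two_pos hκ
  rw [modelPhase, ← Real.rpow_mul hs.le,
    show -(1 / ((κ : ℝ) + 2)) * (((κ : ℝ) + 2) / 2) = -(1 / 2) by field_simp]
  ring

/-- The exponent of the leading amplitude at `ze`. -/
noncomputable def leadingExponent (κ : ℤ) : ℂ := ((κ : ℂ) / (4 * (κ + 2)))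

theorem wkb_rpow_neg_inv (hκ : -1 ≤ κ) {s : ℝ} (hs : 0 < s) :
    wkb κ σ q (s ^ (-(1 / ((κ : ℝ) + 2)))) =
      Complex.exp (σ * modelPhase κ (s ^ (-(1 / ((κ : ℝ) + 2)))))
        * ((s : ℂ) ^ leadingExponent κ * (Real.log s : ℂ) ^ 0 * q (s ^ (1 / ((2 : ℕ) : ℝ)))) := by
  have hp := intCast_add_two_pos hκ
  rw [wkb, ← Real.rpow_mul hs.le, ← Real.rpow_mul hs.le,
    show -(1 / ((κ : ℝ) + 2)) * (-(((κ : ℝ) + 2) / 2)) = 1 / ((2 : ℕ) : ℝ) by push_cast; field_simp,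
    show -(1 / ((κ : ℝ) + 2)) * (-(κ : ℝ) / 4) = (κ : ℝ) / (4 * (κ + 2)) by field_simp,
    Complex.ofReal_cpow hs.le, leadingExponent]
  push_cast
  ring

theorem cutAmplitude_rpow_neg_inv (hκ : -1 ≤ κ) (hq : IsExpAtInfinity κ σ q Q) {s : ℝ}
    (hs : s ∈ Ioo 0 ((2 : ℝ) ^ (-((κ : ℝ) + 2)))) :
    cutAmplitude κ σ Q (s ^ (-(1 / ((κ : ℝ) + 2)))) =
      (s : ℂ) ^ leadingExponent κ * (Real.log s : ℂ) ^ 0 * q (s ^ (1 / ((2 : ℕ) : ℝ))) := by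
  rw [cutAmplitude, cutPhase_of_two_le (two_le_rpow_neg_inv hκ hs),
    ((isExpAtInfinity_iff hκ).1 hq).2 _ (Real.rpow_pos_of_pos hs.1 _), wkb_rpow_neg_inv hκ hs.1,
    Complex.exp_neg, mul_comm, inv_mul_cancel_left₀ (Complex.exp_ne_zero _)]

/-- The index set at `ze` of the amplitudes. -/
noncomputable def amplitudeIndexSet (κ : ℤ) : IndexSet :=
  (IndexSet.gen (leadingExponent κ) 0).union (IndexSet.gen (leadingExponent κ + 1 / 2) 0)

theorem mem_amplitudeIndexSet (κ : ℤ) (n : ℕ) :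
    (leadingExponent κ + n / (2 : ℕ), 0) ∈ (amplitudeIndexSet κ).carrier := by
  rcases Nat.even_or_odd' n with ⟨m, rfl | rfl⟩
  · exact Or.inl ⟨⟨m, by push_cast; ring⟩, le_rfl⟩
  · exact Or.inr ⟨⟨m, by push_cast; ring⟩, le_rfl⟩

/-- The two expansions of the amplitude. At infinity the variable is `s = l ^ (-(κ + 2))`, in which
the smooth factor is a function of `s ^ (1 / 2)`; near `0` the amplitude is the solution itself. -/
theorem exists_expansions_cutAmplitude (hκ : -1 ≤ κ) (hα : 0 ≤ α.re) (hΨ : IsAdmissible κ Ψ)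
    (hQ : Q ∈ modelKernel ς κ α Ψ) (hq : IsExpAtInfinity κ σ q Q) :
    ∃ ε > 0, ε ≤ 1 ∧ ∃ c₀ c₁, HasExpansion (rootIndexSet α) c₀ ε Q ∧
      HasExpansion (rootIndexSet α) c₀ ε (cutAmplitude κ σ Q) ∧
      HasExpansion (amplitudeIndexSet κ) c₁ ε
        (fun s => cutAmplitude κ σ Q (s ^ (-(1 / ((κ : ℝ) + 2))))) ∧
      c₁ (leadingExponent κ, 0) = q 0 := by
  obtain ⟨ε, hε, hε1, c₀, h₀⟩ := exists_hasExpansion_of_mem_modelKernel hκ hα hΨ hQ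
  obtain ⟨c₁, hc₁, h₁⟩ := exists_hasExpansion_term (d := 2) two_pos hq.1 (mem_amplitudeIndexSet κ)
  have hle : min ε ((2 : ℝ) ^ (-((κ : ℝ) + 2))) ≤ ε := min_le_left _ _
  have h₀' := h₀.mono_right hle
  refine ⟨min ε ((2 : ℝ) ^ (-((κ : ℝ) + 2))), lt_min hε (Real.rpow_pos_of_pos two_pos _),
    hle.trans hε1, c₀, c₁, h₀', h₀'.congr fun x hx => ?_,
    (h₁.mono_right (hle.trans hε1)).congr fun s hs => ?_, hc₁⟩
  · rw [cutAmplitude, cutPhase_of_le_one (hx.2.le.trans (hle.trans hε1)), neg_zero,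
        Complex.exp_zero,
      mul_one]
  · exact cutAmplitude_rpow_neg_inv hκ hq ⟨hs.1, hs.2.trans_le (min_le_right _ _)⟩

/-- At infinity the phase is a multiple of `s ^ (-1 / 2)`, `s = l ^ (-(κ + 2))`. -/
theorem exists_isPolyhomogeneousOn_cutPhase (hκ : -1 ≤ κ) (σ : ℂ) (hZ : 0 < Z) :
    ∃ E, IsPolyhomogeneousOn κ Z E fun z h => cutPhase κ σ (z / h ^ (2 / ((κ : ℝ) + 2))) := by
  obtain ⟨c₁, -, h₁⟩ := exists_hasExpansion_term (E := IndexSet.gen (-(1 / 2)) 0) (d := 1)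
    (j := -(1 / 2)) (k := 0) (S := fun _ => σ * (2 / (κ + 2))) one_pos contDiffOn_const
    fun n => ⟨⟨n, by simp⟩, le_rfl⟩
  have hle : min 1 ((2 : ℝ) ^ (-((κ : ℝ) + 2))) ≤ 1 := min_le_left _ _
  refine ⟨_, isPolyhomogeneousOn_frontFace hκ (contDiffOn_cutPhase κ σ)
    (lt_min one_pos (Real.rpow_pos_of_pos two_pos (-((κ : ℝ) + 2)))) hle
    ((hasExpansion_zero (IndexSet.gen 0 0) hle).congr fun x hx => ?_)
    ((h₁.mono_right hle).congr fun s hs => ?_) hZ⟩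
  · exact cutPhase_of_le_one (hx.2.le.trans hle)
  · rw [cutPhase_of_two_le (two_le_rpow_neg_inv hκ ⟨hs.1, hs.2.trans_le (min_le_right _ _)⟩),
      modelPhase_rpow_neg_inv hκ hs.1, Complex.ofReal_mul, Complex.ofReal_cpow hs.1.le]
    push_cast
    ring

/-! ### Nontriviality of the amplitudes -/

/-- A solution that is conormal of every order at `0` is zero. -/
theorem eq_zero_of_conormal (hκ : -1 ≤ κ) (hα : 0 ≤ α.re) (hΨ : IsAdmissible κ Ψ)
    (hQ : Q ∈ modelKernel ς κ α Ψ) {ε : ℝ} (hε : 0 < ε)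
    (h : ∀ (r : ℝ) (m : ℕ), ∃ C : ℝ, ∀ x ∈ Ioo 0 ε, ‖(bDeriv^[m] Q) x‖ ≤ C * x ^ r) :
    ∀ l > (0 : ℝ), Q l = 0 := by
  have hmem : ∀ᶠ x : ℝ in 𝓝[>] 0, x ∈ Ioo 0 ε := Ioo_mem_nhdsGT hε
  refine eq_zero_of_isBigO_pow hκ hα hΨ hQ (fun n => ?_) fun n => ?_
  · obtain ⟨C, hC⟩ := h n 0
    refine Asymptotics.IsBigO.of_bound C ?_
    filter_upwards [hmem] with x hx
    have := hC x hx
    rw [Real.rpow_natCast] at this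
    rwa [Real.norm_of_nonneg (pow_nonneg hx.1.le n)]
  · obtain ⟨C, hC⟩ := h (n + 1 : ℕ) 1
    refine Asymptotics.IsBigO.of_bound C ?_
    filter_upwards [hmem] with x hx
    have := hC x hx
    rw [Real.rpow_natCast, Function.iterate_one, bDeriv, norm_mul, Complex.norm_real,
      Real.norm_of_nonneg hx.1.le, pow_succ', mul_left_comm] at this
    rw [Real.norm_of_nonneg (pow_nonneg hx.1.le n)]
    exact le_of_mul_le_mul_left this hx.1

theorem bDerivFst_iterate_apply (g : ℝ → ℝ → ℂ) (m : ℕ) (x y : ℝ) :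
    (bDerivFst^[m] g) x y = (bDeriv^[m] fun t => g t y) x := by
  induction m generalizing g with
  | zero => rfl
  | succ m ih => exact ih (bDerivFst g)

/-- Bounds from polyhomogeneity, for orders below all exponents of the index set. -/
theorem IsPolyhomogeneousAtFace.exists_bound {E : IndexSet} {y₀ : ℝ} {g : ℝ → ℝ → ℂ}
    (h : IsPolyhomogeneousAtFace E y₀ g) : ∃ ε > 0, ∀ r : ℝ, E.upTo r = ∅ → ∀ m : ℕ,
      ∃ C : ℝ, ∀ x ∈ Ioo 0 ε, ‖(bDeriv^[m] fun t => g t y₀) x‖ ≤ C * x ^ r := by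
  obtain ⟨ε, hε, a, -, -, h⟩ := h
  refine ⟨ε, hε, fun r hr m => ?_⟩
  obtain ⟨C, hC⟩ := h r m 0
  refine ⟨C, fun x hx => ?_⟩
  have := hC x hx y₀ ⟨by linarith, by linarith⟩
  simpa only [hr, Finset.sum_empty, sub_zero, Function.iterate_zero_apply,
    bDerivFst_iterate_apply] using this

theorem exists_upTo_eq_empty (E : IndexSet) : ∃ r : ℝ, E.upTo r = ∅ := by
  obtain ⟨r, hr⟩ := ((E.finite_lt 0).image fun e => e.1.re).bddBelow
  refine ⟨min (r - 1) (-1), Finset.eq_empty_of_forall_notMem fun e he => ?_⟩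
  obtain ⟨h1, h2⟩ := IndexSet.mem_upTo.1 he
  have h3 := hr ⟨e, ⟨h1, by linarith [min_le_right (r - 1) (-1)]⟩, rfl⟩
  simp only at h3
  linarith [min_le_left (r - 1) (-1)]

theorem upTo_eq_empty_of_not_nonempty {E : IndexSet} (h : ¬E.carrier.Nonempty) (r : ℝ) :
    E.upTo r = ∅ :=
  Finset.eq_empty_of_forall_notMem fun e he => h ⟨e, (IndexSet.mem_upTo.1 he).1⟩

theorem eq_zero_of_tendsto_of_bound {g : ℝ → ℂ} {w : ℂ} {ε C r : ℝ} (hε : 0 < ε) (hr : 0 < r)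
    (hg : Tendsto g (𝓝[>] 0) (𝓝 w)) (h : ∀ x ∈ Ioo 0 ε, ‖g x‖ ≤ C * x ^ r) : w = 0 := by
  have h1 : Tendsto (fun x : ℝ => C * x ^ r) (𝓝[>] 0) (𝓝 0) := by
    have := (Real.continuousAt_rpow_const 0 r (Or.inr hr.le)).tendsto
    rw [Real.zero_rpow hr.ne'] at this
    simpa using (this.mono_left nhdsWithin_le_nhds).const_mul C
  refine tendsto_nhds_unique hg (squeeze_zero_norm' ?_ h1)
  filter_upwards [Ioo_mem_nhdsGT hε] with x hx using h x hx

theorem tendsto_comp_rpow_half (hq : ContDiffOn ℝ ∞ q (Ici 0)) :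
    Tendsto (fun s : ℝ => q (s ^ (1 / ((2 : ℕ) : ℝ)))) (𝓝[>] 0) (𝓝 (q 0)) := by
  have h1 : Tendsto (fun s : ℝ => s ^ (1 / ((2 : ℕ) : ℝ))) (𝓝[>] 0) (𝓝[≥] 0) := by
    refine tendsto_nhdsWithin_iff.2 ⟨?_, ?_⟩
    · have := (Real.continuousAt_rpow_const 0 (1 / ((2 : ℕ) : ℝ)) (Or.inr (by positivity))).tendsto
      rw [Real.zero_rpow (by norm_num)] at this
      exact this.mono_left nhdsWithin_le_nhds
    · filter_upwards [self_mem_nhdsWithin] with s hs using Real.rpow_nonneg (le_of_lt hs) _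
  exact (hq.continuousOn 0 self_mem_Ici).tendsto.comp h1

theorem norm_le_of_norm_cpow_mul_le {a b : ℂ} {j : ℂ} {s C r : ℝ} (hs : 0 < s) (hb : b = 1)
    (h : ‖(s : ℂ) ^ j * b * a‖ ≤ C * s ^ r) : ‖a‖ ≤ C * s ^ (r - j.re) := by
  rw [hb, mul_one, norm_mul, Complex.norm_cpow_eq_rpow_re_of_pos hs] at h
  have hj := Real.rpow_pos_of_pos hs j.re
  rw [Real.rpow_sub hs, mul_div_assoc', le_div_iff₀ hj]
  linarith

/-- The amplitude of a nonzero solution is nontrivial on the blowup. -/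
theorem isNontrivialPolyhomogeneousOn_cutAmplitude (hκ : -1 ≤ κ) (hα : 0 ≤ α.re)
    (hΨ : IsAdmissible κ Ψ) (hQ : Q ∈ modelKernel ς κ α Ψ) (hq : IsExpAtInfinity κ σ q Q)
    (hq0 : q 0 ≠ 0) (hZ : 0 < Z) :
    IsNontrivialPolyhomogeneousOn κ Z
      fun z h => cutAmplitude κ σ Q (z / h ^ (2 / ((κ : ℝ) + 2))) := by
  classical
  obtain ⟨ε, hε, hε1, c₀, c₁, hQ₀, h₀, h₁, hc₁⟩ :=
    exists_expansions_cutAmplitude hκ hα hΨ hQ hq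
  have hF := contDiffOn_cutAmplitude (κ := κ) (σ := σ) hQ.1
  obtain ⟨l₀, hl₀, hne⟩ := exists_ne_zero_of_isExpAtInfinity hκ hq hq0
  have hne' : cutAmplitude κ σ Q l₀ ≠ 0 := mul_ne_zero hne (Complex.exp_ne_zero _)
  have hp := intCast_add_two_pos hκ
  refine ⟨⟨_, isPolyhomogeneousOn_frontFace hκ hF hε hε1 h₀ h₁ hZ⟩, fun i E hE => ?_, fun v =>
    ⟨_, _, _, hasCornerExpansion_frontFace hκ hε hε1 h₀ h₁ hZ v, ?_⟩⟩
  · by_contra hemp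
    have hup := upTo_eq_empty_of_not_nonempty hemp
    cases i with
    | ie =>
      -- the point of `ie` at which `l = l₀`, where the amplitude does not vanish
      set y₀ : ℝ := (Z / l₀) ^ (((κ : ℝ) + 2) / 2) with hy₀
      have hy₀0 : 0 < y₀ := Real.rpow_pos_of_pos (div_pos hZ hl₀) _
      obtain ⟨δ, hδ, hb⟩ := (hE.2.1 .ie y₀ hy₀0).exists_bound
      obtain ⟨C, hC⟩ := hb 1 (hup 1) 0
      have hZl : (Z - 0) / y₀ ^ (2 / ((κ : ℝ) + 2)) = l₀ := by
        rw [hy₀, ← Real.rpow_mul (div_pos hZ hl₀).le,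
          show ((κ : ℝ) + 2) / 2 * (2 / ((κ : ℝ) + 2)) = 1 by field_simp, Real.rpow_one, sub_zero]
        field_simp
      have hc : ContinuousAt (fun x : ℝ =>
          cutAmplitude κ σ Q ((Z - x) / y₀ ^ (2 / ((κ : ℝ) + 2)))) 0 := by
        refine ContinuousAt.comp (g := cutAmplitude κ σ Q) ?_ (by fun_prop)
        rw [hZl]
        exact hF.continuousOn.continuousAt (Ioi_mem_nhds hl₀)
      have h := eq_zero_of_tendsto_of_bound hδ one_pos (hc.tendsto.mono_left nhdsWithin_le_nhds) hC
      rw [hZl] at h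
      exact hne' h
    | ze =>
      obtain ⟨δ, hδ, hb⟩ := (hE.2.1 .ze (Z / 2) ⟨by linarith, by linarith⟩).exists_bound
      obtain ⟨C, hC⟩ := hb ((leadingExponent κ).re + 1) (hup _) 0
      refine hq0 (eq_zero_of_tendsto_of_bound (lt_min hδ (Real.rpow_pos_of_pos two_pos
        (-((κ : ℝ) + 2)))) (C := C) (one_pos (α := ℝ)) (tendsto_comp_rpow_half hq.1) fun s hs => ?_)
      have h := hC s ⟨hs.1, hs.2.trans_le (min_le_left _ _)⟩
      simp only [Function.iterate_zero_apply, faceChart] at h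
      rw [div_semiclassical_rpow hκ hs.1 (by linarith),
        cutAmplitude_rpow_neg_inv hκ hq ⟨hs.1, hs.2.trans_le (min_le_right _ _)⟩] at h
      have h' := norm_le_of_norm_cpow_mul_le hs.1 (pow_zero _) h
      rwa [add_sub_cancel_left] at h'
    | fe =>
      -- the point of `fe` at which `l = l₀`
      set y₀ : ℝ := l₀ ^ (-((κ : ℝ) + 2)) with hy₀
      have hy₀0 : 0 < y₀ := Real.rpow_pos_of_pos hl₀ _
      obtain ⟨δ, hδ, hb⟩ := (hE.2.1 .fe y₀ hy₀0).exists_bound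
      obtain ⟨C, hC⟩ := hb 1 (hup 1) 0
      refine hne' (eq_zero_of_tendsto_of_bound hδ one_pos (C := C) tendsto_const_nhds fun x hx =>
          ?_)
      have h := hC x hx
      simp only [Function.iterate_zero_apply, faceChart] at h
      rwa [div_semiclassical_rpow hκ hy₀0 hx.1, hy₀, ← Real.rpow_mul hl₀.le,
        show -((κ : ℝ) + 2) * -(1 / ((κ : ℝ) + 2)) = 1 by field_simp, Real.rpow_one] at h
    | be =>
      obtain ⟨δ, hδ, hb⟩ := (hE.2.1 .be 1 (by simp [faceInterior])).exists_bound
      refine hne (eq_zero_of_conormal hκ hα hΨ hQ (lt_min hδ one_pos) (fun r m => ?_) l₀ hl₀)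
      obtain ⟨C, hC⟩ := hb r (hup r) m
      refine ⟨C, fun x hx => ?_⟩
      have h := hC x ⟨hx.1, hx.2.trans_le (min_le_left _ _)⟩
      rwa [bDeriv_iterate_congr isOpen_Ioo (g := Q) (fun y hy => ?_) m hx] at h
      simp only [faceChart, Real.one_rpow, div_one]
      rw [cutAmplitude, cutPhase_of_le_one (hy.2.le.trans (min_le_right _ _)), neg_zero,
        Complex.exp_zero, mul_one]
  · have hlead : (leadingExponent κ, 0) ∈ (amplitudeIndexSet κ).carrier := by
      simpa using mem_amplitudeIndexSet κ 0
    have hgen : (0, 0) ∈ (IndexSet.gen 0 0).carrier := ⟨⟨0, by simp⟩, le_rfl⟩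
    cases v with
    | zeIe => exact ⟨_, hlead, (0, 0), hgen, by simpa [hc₁] using hq0⟩
    | zeFe => exact ⟨_, hlead, (0, 0), hgen, by simpa [hc₁] using hq0⟩
    | feBe =>
      by_contra! hc
      refine hne (eq_zero_of_conormal hκ hα hΨ hQ hε (fun r m => ?_) l₀ hl₀)
      obtain ⟨C, hC⟩ := hQ₀.2 r m
      refine ⟨C, fun x hx => ?_⟩
      have hz : ∀ t, ∑ e ∈ (rootIndexSet α).upTo r, c₀ e * logMonomial e t = 0 := fun t =>
        Finset.sum_eq_zero fun e he => by
          have := hc (0, 0) hgen e (IndexSet.mem_upTo.1 he).1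
          simp only [if_true] at this
          rw [this, zero_mul]
      simpa only [hz, sub_zero] using hC x hx

end

/-! ### Oscillating terms are not polyhomogeneous -/

/-- The function `s ^ j P (s ^ (1 / 2)) exp (τ s ^ (-1 / 2))`. -/
noncomputable def oscTerm (τ j : ℂ) (P : ℝ → ℂ) (s : ℝ) : ℂ :=
  (s : ℂ) ^ j * (Real.log s : ℂ) ^ 0 * P (s ^ (1 / ((2 : ℕ) : ℝ)))
    * Complex.exp (τ * ((s ^ (-(1 / 2) : ℝ) : ℝ) : ℂ))

section
variable {τ j : ℂ} {P : ℝ → ℂ}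

theorem contDiffOn_oscTerm (hP : ContDiffOn ℝ ∞ P (Ici 0)) :
    ContDiffOn ℝ ∞ (oscTerm τ j P) (Ioi 0) :=
  (contDiffOn_term 2 j 0 (hP.mono Ioi_subset_Ici_self)).mul
    (contDiffOn_const.mul (contDiffOn_ofReal_rpow _)).cexp

/-- Every application of `s ∂ₛ` to an oscillating term loses half an order, and multiplies the
leading coefficient by a nonzero constant. -/
theorem exists_bDeriv_oscTerm (τ j : ℂ) (hP : ContDiffOn ℝ ∞ P (Ici 0)) :
    ∃ P' : ℝ → ℂ, ContDiffOn ℝ ∞ P' (Ici 0) ∧ P' 0 = -(τ / 2) * P 0 ∧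
      ∀ s > (0 : ℝ), bDeriv (oscTerm τ j P) s = oscTerm τ (j - 1 / 2) P' s := by
  refine ⟨fun t => t * (j * P t) + 1 / 2 * (t : ℂ) ^ 2 * derivWithin P (Ici 0) t + -(τ / 2) * P t,
    ((contDiffOn_ofReal.mul (contDiffOn_const.mul hP)).add
      ((contDiffOn_const.mul (contDiffOn_ofReal.pow 2)).mul (contDiffOn_derivWithin_Ici hP))).add
      (contDiffOn_const.mul hP), by simp, fun s hs => ?_⟩
  have hs0 : (s : ℂ) ≠ 0 := by exact_mod_cast (ne_of_gt hs)
  have h1 := ((hasDerivAt_ofReal_rpow (-(1 / 2)) hs).const_mul τ).cexp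
  have h2 := (hasDerivAt_term 2 j 0 hP hs).mul h1
  have hd : deriv (oscTerm τ j P) s = _ := h2.deriv
  have hpos := Real.rpow_pos_of_pos hs (1 / ((2 : ℕ) : ℝ))
  have ht : (s : ℂ) ^ j = (s : ℂ) ^ (j - 1 / 2) * ((s ^ (1 / ((2 : ℕ) : ℝ)) : ℝ) : ℂ) := by
    rw [Complex.ofReal_cpow (le_of_lt hs), ← Complex.cpow_add _ _ hs0]
    congr 1
    push_cast
    ring
  have hr : ((s ^ (-(1 / 2) : ℝ) : ℝ) : ℂ) = ((s ^ (1 / ((2 : ℕ) : ℝ)) : ℝ) : ℂ)⁻¹ := by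
    rw [← Complex.ofReal_inv, ← Real.rpow_neg (le_of_lt hs)]
    norm_num
  have ht0 : ((s ^ (1 / ((2 : ℕ) : ℝ)) : ℝ) : ℂ) ≠ 0 := by exact_mod_cast hpos.ne'
  rw [bDeriv, hd, oscTerm, ht, hr]
  generalize ((s ^ (1 / ((2 : ℕ) : ℝ)) : ℝ) : ℂ) = t at *
  push_cast
  field_simp
  ring

theorem exists_bDeriv_iterate_oscTerm (τ j : ℂ) (hP : ContDiffOn ℝ ∞ P (Ici 0)) (m : ℕ) :
    ∃ P' : ℝ → ℂ, ContDiffOn ℝ ∞ P' (Ici 0) ∧ P' 0 = (-(τ / 2)) ^ m * P 0 ∧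
      ∀ s > (0 : ℝ), (bDeriv^[m] (oscTerm τ j P)) s = oscTerm τ (j - m / 2) P' s := by
  induction m with
  | zero => exact ⟨P, hP, by simp, fun s _ => by simp⟩
  | succ m ih =>
    obtain ⟨P', hP', h0, h⟩ := ih
    obtain ⟨P'', hP'', h0', h'⟩ := exists_bDeriv_oscTerm τ (j - m / 2) hP'
    refine ⟨P'', hP'', by rw [h0', h0]; ring, fun s hs => ?_⟩
    rw [Function.iterate_succ_apply', bDeriv_congr isOpen_Ioi (fun x hx => h x hx)
      (show s ∈ Ioi (0 : ℝ) from hs), h' s hs]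
    congr 1
    push_cast
    ring

/-- An oscillating term with all `s ∂ₛ` derivatives bounded by a fixed power vanishes to leading
order. -/
theorem eq_zero_of_bound_oscTerm (hτ : τ ≠ 0) (hτr : τ.re = 0) (hP : ContDiffOn ℝ ∞ P (Ici 0))
    {r ε : ℝ} (hε : 0 < ε)
    (h : ∀ m : ℕ, ∃ C : ℝ, ∀ s ∈ Ioo 0 ε, ‖(bDeriv^[m] (oscTerm τ j P)) s‖ ≤ C * s ^ r) :
    P 0 = 0 := by
  -- after `m` applications of `s ∂ₛ` the order `j - m / 2` is below `r`
  obtain ⟨m, hm⟩ := exists_nat_gt (2 * (j.re - r))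
  obtain ⟨P', hP', h0, h'⟩ := exists_bDeriv_iterate_oscTerm τ j hP m
  obtain ⟨C, hC⟩ := h m
  have hre : (j - m / 2 : ℂ).re = j.re - m / 2 := by simp
  have h0' : P' 0 = 0 := by
    refine eq_zero_of_tendsto_of_bound (r := r - (j - m / 2 : ℂ).re) hε (by rw [hre]; linarith)
      (tendsto_comp_rpow_half hP') (C := C) fun s hs => ?_
    have h1 := hC s hs
    have h2 : ‖Complex.exp (τ * ((s ^ (-(1 / 2) : ℝ) : ℝ) : ℂ))‖ = 1 := by
      rw [Complex.norm_exp, mul_comm, Complex.re_ofReal_mul, hτr, mul_zero, Real.exp_zero]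
    rw [h' s hs.1, oscTerm, norm_mul, h2, mul_one] at h1
    exact norm_le_of_norm_cpow_mul_le hs.1 (pow_zero _) h1
  rw [h0] at h0'
  exact (mul_eq_zero.1 h0').resolve_left (pow_ne_zero _ (neg_ne_zero.2 (div_ne_zero hτ
      two_ne_zero)))

end

section
variable {κ : ℤ} {σ : ℂ} {ς : ℝ} {α : ℂ} {Ψ Q : ℝ → ℂ} {Z : ℝ}

/-- The sum of two solutions with opposite oscillating exponentials cannot be written with one of
these exponentials alone. -/
theorem not_single_exponential (hκ : -1 ≤ κ) (hσ0 : σ ≠ 0) (hσr : σ.re = 0) {A B q k : ℝ → ℂ}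
    (hq : IsExpAtInfinity κ σ q A)
    (hk : IsExpAtInfinity κ (-σ) k B) (hk0 : k 0 ≠ 0) (hZ : 0 < Z) {E : Face → IndexSet}
    {v : ℝ → ℝ → ℂ} (hv : IsPolyhomogeneousOn κ Z E v)
    (h : ∀ z ∈ Ioo 0 Z, ∀ h ∈ Ioi (0 : ℝ), A (z / h ^ (2 / ((κ : ℝ) + 2)))
      + B (z / h ^ (2 / ((κ : ℝ) + 2)))
        = v z h * Complex.exp (cutPhase κ σ (z / h ^ (2 / ((κ : ℝ) + 2))))) : False := by
  have hp := intCast_add_two_pos hκ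
  have hpc : (κ : ℂ) + 2 ≠ 0 := by exact_mod_cast hp.ne'
  have hz : Z / 2 ∈ Ioo 0 Z := ⟨by linarith, by linarith⟩
  obtain ⟨ε, hε, hb⟩ := (hv.2.1 .ze (Z / 2) hz).exists_bound
  obtain ⟨r, hr⟩ := exists_upTo_eq_empty (E .ze)
  -- `exp (-2 σ φ) = exp (τ s ^ (-1 / 2))` at `ze`
  set τ : ℂ := -(2 * σ) * (2 / (κ + 2)) with hτ
  set δ : ℝ := min (min ε 1) ((2 : ℝ) ^ (-((κ : ℝ) + 2))) with hδ
  have hδ0 : 0 < δ := lt_min (lt_min hε one_pos) (Real.rpow_pos_of_pos two_pos _)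
  have hτr : τ.re = 0 := by
    have : τ = ((-4 / ((κ : ℝ) + 2) : ℝ) : ℂ) * σ := by
      rw [hτ]
      push_cast
      field_simp
      ring
    rw [this, Complex.re_ofReal_mul, hσr, mul_zero]
  have hqT : IsTermSum 2 ((leadingExponent κ).re - 1) _ :=
    .term (leadingExponent κ) 0 (fun t => -q t) (by linarith) hq.1.neg
  -- the oscillating term as a difference of polyhomogeneous functions
  have hW : ∀ s ∈ Ioo 0 δ, oscTerm τ (leadingExponent κ) k s
      = faceChart κ Z v .ze s (Z / 2) + (s : ℂ) ^ leadingExponent κ * (Real.log s : ℂ) ^ 0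
        * (-q (s ^ (1 / ((2 : ℕ) : ℝ)))) := by
    intro s hs
    have hs2 : s ∈ Ioo 0 ((2 : ℝ) ^ (-((κ : ℝ) + 2))) := ⟨hs.1, hs.2.trans_le (min_le_right _ _)⟩
    have hh : 0 < semiclassical κ s (Z / 2) :=
      mul_pos (Real.sqrt_pos.2 hs.1) (Real.rpow_pos_of_pos hz.1 _)
    have h1 := h (Z / 2) hz _ hh
    rw [div_semiclassical_rpow hκ hs.1 hz.1] at h1
    have h2 : faceChart κ Z v .ze s (Z / 2)
        = cutAmplitude κ σ A (s ^ (-(1 / ((κ : ℝ) + 2))))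
          + cutAmplitude κ (-σ) B (s ^ (-(1 / ((κ : ℝ) + 2))))
            * Complex.exp (-(2 * σ) * modelPhase κ (s ^ (-(1 / ((κ : ℝ) + 2))))) := by
      have h3 : v (Z / 2) (semiclassical κ s (Z / 2))
          = (A (s ^ (-(1 / ((κ : ℝ) + 2)))) + B (s ^ (-(1 / ((κ : ℝ) + 2)))))
            * Complex.exp (-cutPhase κ σ (s ^ (-(1 / ((κ : ℝ) + 2))))) := by
        rw [h1, mul_assoc, ← Complex.exp_add, add_neg_cancel, Complex.exp_zero, mul_one]
      simp only [faceChart]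
      rw [h3, cutAmplitude, cutAmplitude, cutPhase_neg,
        cutPhase_of_two_le (two_le_rpow_neg_inv hκ hs2), add_mul, mul_assoc (B _),
        ← Complex.exp_add]
      congr 3
      ring
    rw [h2, cutAmplitude_rpow_neg_inv hκ hq hs2, cutAmplitude_rpow_neg_inv hκ hk hs2,
      modelPhase_rpow_neg_inv hκ hs.1, oscTerm, hτ]
    push_cast
    ring_nf
  refine hk0 (eq_zero_of_bound_oscTerm (τ := τ) (j := leadingExponent κ)
    (r := min r ((leadingExponent κ).re - 1)) (mul_ne_zero
    (neg_ne_zero.2 (mul_ne_zero two_ne_zero hσ0)) (div_ne_zero two_ne_zero hpc)) hτr hk.1 hδ0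
    fun m => ?_)
  obtain ⟨C, hC⟩ := hb r hr m
  obtain ⟨D, hD⟩ := hqT.conormal m
  have hVs : ContDiffOn ℝ ∞ (fun s => faceChart κ Z v .ze s (Z / 2)) (Ioo 0 δ) := by
    refine (((contDiffOn_oscTerm (τ := τ) (j := leadingExponent κ) hk.1).mono
      Ioo_subset_Ioi_self).sub (hqT.contDiffOn.mono Ioo_subset_Ioi_self)).congr fun s hs => ?_
    rw [hW s hs]
    ring
  refine ⟨|C| + |D|, fun s hs => ?_⟩
  have hs1 : s < 1 := hs.2.trans_le ((min_le_left _ _).trans (min_le_right _ _))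
  rw [bDeriv_iterate_congr isOpen_Ioo (fun s hs => hW s hs) m hs,
    bDeriv_iterate_add isOpen_Ioo hVs (hqT.contDiffOn.mono Ioo_subset_Ioi_self) m hs, add_mul]
  have hle : ∀ a : ℝ, min r ((leadingExponent κ).re - 1) ≤ a → ∀ C : ℝ,
      C * s ^ a ≤ |C| * s ^ min r ((leadingExponent κ).re - 1) := fun a ha C =>
    mul_le_mul (le_abs_self C) (Real.rpow_le_rpow_of_exponent_ge hs.1 hs1.le ha)
      (Real.rpow_nonneg hs.1.le _) (abs_nonneg C)
  exact (norm_add_le _ _).trans (add_le_add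
    ((hC s ⟨hs.1, hs.2.trans_le ((min_le_left _ _).trans (min_le_left _ _))⟩).trans
      (hle r (min_le_left _ _) C)) ((hD s ⟨hs.1, hs1⟩).trans (hle _ (min_le_right _ _) D)))

/-! ### Solutions on the blowup -/

theorem exists_div_rpow_eq (hκ : -1 ≤ κ) (hZ : 0 < Z) {l : ℝ} (hl : 0 < l) :
    ∃ z ∈ Ioo 0 Z, ∃ h ∈ Ioi (0 : ℝ), z / h ^ (2 / ((κ : ℝ) + 2)) = l := by
  have hp := intCast_add_two_pos hκ
  have hw : 0 < Z / 2 / l := by positivity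
  refine ⟨Z / 2, ⟨by linarith, by linarith⟩, (Z / 2 / l) ^ (((κ : ℝ) + 2) / 2),
    Real.rpow_pos_of_pos hw _, ?_⟩
  rw [← Real.rpow_mul hw.le, show ((κ : ℝ) + 2) / 2 * (2 / ((κ : ℝ) + 2)) = 1 by field_simp,
    Real.rpow_one]
  field_simp

theorem isNontrivialExp_of_eq_zero (hQ : ∀ l > (0 : ℝ), Q l = 0) :
    IsNontrivialExpPolyhomogeneousOn κ Z 0 fun z h => Q (z / h ^ (2 / ((κ : ℝ) + 2))) :=
  ⟨fun _ _ _ => 0, fun _ _ _ => 0, fun n => n.elim0, ⟨fun n => n.elim0, fun z hz h hh => by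
    simpa using hQ _ (div_pos hz.1 (Real.rpow_pos_of_pos hh _))⟩,
    fun _ hS => absurd (Subsingleton.elim _ _) hS, fun n => n.elim0⟩

/-- A nonzero solution is not an empty sum of exponentials. -/
theorem not_isPresentation_empty {ι : Type} (hκ : -1 ≤ κ) (hZ : 0 < Z) {l : ℝ} (hl : 0 < l)
    (hQ : Q l ≠ 0) (u θ : ι → ℝ → ℝ → ℂ) :
    ¬ IsPresentation κ Z (fun z h => Q (z / h ^ (2 / ((κ : ℝ) + 2)))) ∅ u θ := fun h => by
  obtain ⟨z, hz, h', hh, rfl⟩ := exists_div_rpow_eq hκ hZ hl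
  exact hQ (by simpa using h.2 z hz h' hh)

theorem cutAmplitude_mul_exp (l : ℝ) :
    cutAmplitude κ σ Q l * Complex.exp (cutPhase κ σ l) = Q l := by
  rw [cutAmplitude, mul_assoc, ← Complex.exp_add, neg_add_cancel, Complex.exp_zero, mul_one]

/-- A solution with a nonzero amplitude at infinity needs exactly one exponential. -/
theorem isNontrivialExp_one (hκ : -1 ≤ κ) (hα : 0 ≤ α.re) (hΨ : IsAdmissible κ Ψ) {q : ℝ → ℂ}
    (hQ : Q ∈ modelKernel ς κ α Ψ) (hq : IsExpAtInfinity κ σ q Q) (hq0 : q 0 ≠ 0) (hZ : 0 < Z) :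
    IsNontrivialExpPolyhomogeneousOn κ Z 1 fun z h => Q (z / h ^ (2 / ((κ : ℝ) + 2))) := by
  have hu := isNontrivialPolyhomogeneousOn_cutAmplitude hκ hα hΨ hQ hq hq0 hZ
  obtain ⟨l, hl, hne⟩ := exists_ne_zero_of_isExpAtInfinity hκ hq hq0
  refine ⟨fun _ z h => cutAmplitude κ σ Q (z / h ^ (2 / ((κ : ℝ) + 2))),
    fun _ z h => cutPhase κ σ (z / h ^ (2 / ((κ : ℝ) + 2))),
    fun _ => exists_isPolyhomogeneousOn_cutPhase hκ σ hZ, ⟨fun _ _ => hu.1, fun z _ h _ => by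
      simp [cutAmplitude_mul_exp]⟩, fun S hS => ?_, fun _ => hu⟩
  have hS' : S = ∅ := Finset.eq_empty_of_forall_notMem fun n hn => hS <|
    Finset.eq_univ_of_forall fun m => by rwa [Subsingleton.elim m n]
  rintro ⟨v, hv⟩
  rw [hS'] at hv
  exact not_isPresentation_empty hκ hZ hl hne _ _ hv

/-- The sum of two solutions with opposite oscillating exponentials needs both of them. -/
theorem isNontrivialExp_two (hκ : -1 ≤ κ) (hα : 0 ≤ α.re) (hΨ : IsAdmissible κ Ψ) (hσ0 : σ ≠ 0)
    (hσr : σ.re = 0) {A B q k : ℝ → ℂ} (hA : A ∈ modelKernel ς κ α Ψ)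
    (hB : B ∈ modelKernel ς κ α Ψ) (hq : IsExpAtInfinity κ σ q A)
    (hk : IsExpAtInfinity κ (-σ) k B) (hq0 : q 0 ≠ 0) (hk0 : k 0 ≠ 0)
    (hQ : ∀ l > (0 : ℝ), Q l = A l + B l) (hZ : 0 < Z) :
    IsNontrivialExpPolyhomogeneousOn κ Z 2 fun z h => Q (z / h ^ (2 / ((κ : ℝ) + 2))) := by
  have hu := isNontrivialPolyhomogeneousOn_cutAmplitude hκ hα hΨ hA hq hq0 hZ
  have hu' := isNontrivialPolyhomogeneousOn_cutAmplitude hκ hα hΨ hB hk hk0 hZ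
  have hl : ∀ z ∈ Ioo 0 Z, ∀ h ∈ Ioi (0 : ℝ), 0 < z / h ^ (2 / ((κ : ℝ) + 2)) :=
    fun z hz h hh => div_pos hz.1 (Real.rpow_pos_of_pos hh _)
  refine ⟨![fun z h => cutAmplitude κ σ A (z / h ^ (2 / ((κ : ℝ) + 2))),
      fun z h => cutAmplitude κ (-σ) B (z / h ^ (2 / ((κ : ℝ) + 2)))],
    ![fun z h => cutPhase κ σ (z / h ^ (2 / ((κ : ℝ) + 2))),
      fun z h => cutPhase κ (-σ) (z / h ^ (2 / ((κ : ℝ) + 2)))], fun n => ?_,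
    ⟨fun n _ => ?_, fun z hz h hh => ?_⟩, fun S hS => ?_, fun n => ?_⟩
  · fin_cases n
    · exact exists_isPolyhomogeneousOn_cutPhase hκ σ hZ
    · exact exists_isPolyhomogeneousOn_cutPhase hκ (-σ) hZ
  · fin_cases n
    · exact hu.1
    · exact hu'.1
  · simp [Fin.sum_univ_two, cutAmplitude_mul_exp, hQ _ (hl z hz h hh)]
  · rintro ⟨v, hv, hv'⟩
    -- a proper subset omits one of the two exponentials; the sum over it may be extended by zero
    -- to the other one
    have hcases : 0 ∉ S ∨ 1 ∉ S := by
      by_contra! h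
      exact hS (Finset.eq_univ_of_forall fun m => by fin_cases m; exacts [h.1, h.2])
    have h0 : ∃ E, IsPolyhomogeneousOn κ Z E fun _ _ => 0 := by
      have hz := hasExpansion_zero (IndexSet.gen 0 0) le_rfl
      exact ⟨_, isPolyhomogeneousOn_frontFace (F := 0) hκ contDiffOn_const one_pos le_rfl hz hz hZ⟩
    have hv0 : ∀ n, ∃ E, IsPolyhomogeneousOn κ Z E (if n ∈ S then v n else fun _ _ => 0) :=
      fun n => by
        split_ifs with h
        · exact hv n h
        · exact h0
    have hsum : ∀ z ∈ Ioo 0 Z, ∀ h ∈ Ioi (0 : ℝ), Q (z / h ^ (2 / ((κ : ℝ) + 2)))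
        = (if 0 ∈ S then v 0 else fun _ _ => 0) z h
            * Complex.exp (cutPhase κ σ (z / h ^ (2 / ((κ : ℝ) + 2))))
          + (if 1 ∈ S then v 1 else fun _ _ => 0) z h
            * Complex.exp (cutPhase κ (-σ) (z / h ^ (2 / ((κ : ℝ) + 2)))) := by
      intro z hz h hh
      have h1 := hv' z hz h hh
      beta_reduce at h1
      have h2 : ∀ f : Fin 2 → ℂ,
          ∑ n ∈ S, f n = (if 0 ∈ S then f 0 else 0) + (if 1 ∈ S then f 1 else 0) := fun f => by
        rw [← Fin.sum_univ_two fun n => if n ∈ S then f n else 0, Finset.sum_ite_mem,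
          Finset.univ_inter]
      rw [h1, h2]
      split_ifs <;> simp
    rcases hcases with hn | hn
    · obtain ⟨E, hE⟩ := hv0 1
      refine not_single_exponential (σ := -σ) hκ (neg_ne_zero.2 hσ0) (by simp [hσr]) hk
        (by rwa [neg_neg]) hq0 hZ hE fun z hz h hh => ?_
      have h1 := hsum z hz h hh
      rw [if_neg hn, zero_mul, zero_add, hQ _ (hl z hz h hh)] at h1
      rw [add_comm, h1]
    · obtain ⟨E, hE⟩ := hv0 0
      refine not_single_exponential hκ hσ0 hσr hq hk hk0 hZ hE fun z hz h hh => ?_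
      have h1 := hsum z hz h hh
      rw [if_neg hn, zero_mul, add_zero, hQ _ (hl z hz h hh)] at h1
      exact h1
  · fin_cases n
    · exact hu
    · exact hu'

theorem const_mul_mem_modelKernel (hΨ : ContDiffOn ℝ ∞ Ψ (Ici 0)) (hQ : Q ∈ modelKernel ς κ α Ψ)
    (c : ℂ) : (fun l => c * Q l) ∈ modelKernel ς κ α Ψ :=
  mem_modelKernel_of_hasDerivAt hΨ
    (fun l hl => (hasDerivAt_of_mem_modelKernel hQ hl).const_mul c)
    fun l hl => ((hasDerivAt_deriv_of_mem_modelKernel hQ hl).const_mul c).congr_deriv (by ring)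

theorem IsExpAtInfinity.const_mul {q R : ℝ → ℂ} (hq : IsExpAtInfinity κ σ q Q) (c : ℂ)
    (hR : ∀ l > (0 : ℝ), R l = c * Q l) : IsExpAtInfinity κ σ (fun t => c * q t) R :=
  ⟨contDiffOn_const.mul hq.1, fun l hl => by
    rw [hR l hl, hq.2 l hl]
    ring⟩

theorem exists_isNontrivialExp (hκ : -1 ≤ κ) (hς : ς = 1 ∨ ς = -1) (hα : 0 ≤ α.re)
    (hΨ : IsAdmissible κ Ψ) (hQ : Q ∈ modelKernel ς κ α Ψ) (hZ : 0 < Z) :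
    ∃ N : ℕ, (ς = 1 → N ≤ 1) ∧ (ς = -1 → N ≤ 2) ∧ IsNontrivialExpPolyhomogeneousOn κ Z N
      fun z h => Q (z / h ^ (2 / ((κ : ℝ) + 2))) := by
  by_cases hzero : ∀ l > (0 : ℝ), Q l = 0
  · exact ⟨0, by simp, by simp, isNontrivialExp_of_eq_zero hzero⟩
  push Not at hzero
  obtain ⟨l₀, hl₀, hne⟩ := hzero
  have hone : ∀ {σ : ℂ} {c : ℂ} {R k : ℝ → ℂ}, IsExpAtInfinity κ σ k R → k 0 ≠ 0 →
      (∀ l > (0 : ℝ), Q l = c * R l) → IsNontrivialExpPolyhomogeneousOn κ Z 1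
        fun z h => Q (z / h ^ (2 / ((κ : ℝ) + 2))) := by
    intro σ c R k hk hk0 hc
    refine isNontrivialExp_one hκ hα hΨ hQ (hk.const_mul c hc) (mul_ne_zero ?_ hk0) hZ
    rintro rfl
    exact hne (by rw [hc l₀ hl₀, zero_mul])
  rcases hς with rfl | rfl
  · refine ⟨1, fun _ => le_rfl, fun _ => one_le_two, ?_⟩
    obtain ⟨q, hq⟩ := exists_growing_form hκ hΨ hQ
    by_cases hq0 : q 0 = 0
    · obtain ⟨R, hR, ⟨k, hk, hk0⟩, -⟩ := forbidden_case (α := α) hκ hΨ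
      obtain ⟨c, hc⟩ := eq_const_mul_of_amplitude_eq_zero hκ hΨ hQ hR hq hk hk0 hq0
      exact hone hk hk0 hc
    · exact isNontrivialExp_one hκ hα hΨ hQ hq hq0 hZ
  · obtain ⟨A, hA, B, hB, ⟨q, hq, hq0⟩, ⟨k, hk, hk0⟩, hspan⟩ := allowed_case (α := α) hκ hΨ
    obtain ⟨c, d, hcd⟩ := hspan Q hQ
    by_cases hc : c = 0
    · exact ⟨1, fun _ => le_rfl, fun _ => one_le_two, hone hk hk0 fun l hl => by
        rw [hcd l hl, hc, zero_mul, zero_add]⟩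
    by_cases hd : d = 0
    · exact ⟨1, fun _ => le_rfl, fun _ => one_le_two, hone hq hq0 fun l hl => by
        rw [hcd l hl, hd, zero_mul, add_zero]⟩
    exact ⟨2, fun h => by norm_num at h, fun _ => le_rfl, isNontrivialExp_two hκ hα hΨ
      Complex.I_ne_zero Complex.I_re (const_mul_mem_modelKernel hΨ.1 hA c)
      (const_mul_mem_modelKernel hΨ.1 hB d) (hq.const_mul c fun _ _ => rfl)
      (hk.const_mul d fun _ _ => rfl) (mul_ne_zero hc hq0) (mul_ne_zero hd hk0) hcd hZ⟩

end

theorem mainTheorem4 (κ : ℤ) (hκ : -1 ≤ κ) (ς : ℝ) (hς : ς = 1 ∨ ς = -1)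
    (α : ℂ) (hα : 0 ≤ α.re) (Ψ : ℝ → ℂ) (hΨ : IsAdmissible κ Ψ) :
    -- behaviour at zero
    (∀ Q ∈ modelKernel ς κ α Ψ, IsPolyhomogeneousAtZero (rootIndexSet α) Q) ∧
    -- behaviour at infinity, forbidden case
    (ς = 1 →
      (∀ Q ∈ modelKernel ς κ α Ψ, ∃ q, IsExpAtInfinity κ 1 q Q) ∧
      ∃ Qinf ∈ modelKernel ς κ α Ψ,
        (∃ q, IsExpAtInfinity κ (-1) q Qinf ∧ q 0 ≠ 0) ∧
        ∀ Q ∈ modelKernel ς κ α Ψ,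
          Tendsto (fun l : ℝ => ((l ^ ((κ : ℝ) / 4) : ℝ) : ℂ)
            * Complex.exp (-(modelPhase κ l : ℂ)) * Q l) atTop (𝓝 0) →
          ∃ c : ℂ, ∀ l > (0 : ℝ), Q l = c * Qinf l) ∧
    -- behaviour at infinity, allowed case
    (ς = -1 →
      ∃ Qp ∈ modelKernel ς κ α Ψ, ∃ Qm ∈ modelKernel ς κ α Ψ,
        (∃ q, IsExpAtInfinity κ Complex.I q Qp ∧ q 0 ≠ 0) ∧
        (∃ q, IsExpAtInfinity κ (-Complex.I) q Qm ∧ q 0 ≠ 0) ∧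
        ∀ Q ∈ modelKernel ς κ α Ψ, ∃ c d : ℂ, ∀ l > (0 : ℝ), Q l = c * Qp l + d * Qm l) ∧
    -- behaviour on the blowup
    (∀ Q ∈ modelKernel ς κ α Ψ, ∀ Z > (0 : ℝ), ∃ N : ℕ,
      (ς = 1 → N ≤ 1) ∧ (ς = -1 → N ≤ 2) ∧
      IsNontrivialExpPolyhomogeneousOn κ Z N
        (fun z h => Q (z / h ^ (2 / ((κ : ℝ) + 2))))) := by
  refine ⟨fun Q hQ => ?_, ?_, ?_, fun Q hQ Z hZ => exists_isNontrivialExp hκ hς hα hΨ hQ hZ⟩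
  · obtain ⟨ε, hε, -, c, hc⟩ := exists_hasExpansion_of_mem_modelKernel hκ hα hΨ hQ
    exact ⟨ε, hε, c, hc⟩
  · rintro rfl
    exact ⟨fun Q hQ => exists_growing_form hκ hΨ hQ, forbidden_case hκ hΨ⟩
  · rintro rfl
    exact allowed_case hκ hΨ
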